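/- **Setting.** Let $0<s<\tfrac12$, $\|q\|_{H^s}^2=\int_{\mathbb R}(4+\xi^2)^s|\hat q(\xi)|^2\,d\xi$ with $\hat q(\xi)=(2\pi)^{-1/2}\int e^{-i\xi x}q(x)\,dx$, and let $B_\delta$ be the closed ball of radius $\delta$ in $H^s(\mathbb R)$. For Schwartz functions $q,r:\mathbb R\to\mathbb C$ and $\kappa\in\mathbb C$ with $i\kappa^2\in\mathbb R\setminus(-1,1)$ put $$L(\kappa)=\begin{bmatrix}\partial+i\kappa^2&-\kappa q\\-\kappa r&\partial-i\kappa^2\end{bmatrix}\quad\text{on }L^2(\mathbb R;\mathbb C^2).$$ If $L(\kappa)^{-1}$ exists and has an integral kernel $G(x,y;\kappa)$ such that $G-G_0$ is continuous, where $G_0$ is the kernel for $q=r=0$, write $$\gamma(x;\kappa)=\operatorname{sgn}(i\kappa^2)\,[G_{11}-G_{22}](x,x;\kappa)-1,\qquad g_{12}(x;\kappa)=\operatorname{sgn}(i\kappa^2)G_{12}(x,x;\kappa),\qquad g_{21}(x;\kappa)=\operatorname{sgn}(i\kappa^2)G_{21}(x,x;\kappa)$$ (where $G_{11}-G_{22}$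 is extended continuously to the diagonal). Let $$A(\kappa;q,r)=-\operatorname{sgn}(i\kappa^2)\sum_{m\ge1}\tfrac1m\operatorname{tr}\{(\Lambda\Gamma)^m\},\quad \Lambda=(\partial+i\kappa^2)^{-1/2}\kappa q(\partial-i\kappa^2)^{-1/2},\quad \Gamma=(\partial-i\kappa^2)^{-1/2}\kappa r(\partial+i\kappa^2)^{-1/2},$$ with powers given by Fourier multipliers and the principal branch. The functions $q$ and $r$ are treated as independent variables. The $A(\kappa)$ flow is $$\partial_t q=\partial_x\frac{\delta A(\kappa)}{\delta r},\qquad \partial_t r=\partial_x\frac{\delta A(\kappa)}{\delta q}.$$ **Proposition.** For every $s\in(0,\tfrac12)$ there is $\delta>0$ such that the following holds. (0) For all Schwartz $q,r\in B_\delta$ and all $\kappa$ with $i\kappa^2\in\mathbb R\setminus(-1,1)$, $L(\kappa)$ is invertible with exactly one Green's function $G$ as above, and $2+\gamma(x;\kappa)\neq0$ for all $x$. Let moreover $i\kappa^2,i\varkappa^2\in\mathbb R\setminus(-1,1)$ with $\kappa^2\ne\varkappa^2$, and let $t\mapsto(q(t),r(t))$, $t\in I$ ($I\subset\mathbb R$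 open), be a solution of the $A(\kappa)$ flow, differentiable in time in the topology of the Schwartz space, with $q(t),r(t)\in B_\delta$ for all $t\in I$. Put $\Theta=\frac{\varkappa\kappa^3}{\kappa^2-\varkappa^2}$ and $\Xi=\frac{\varkappa^2\kappa^2}{\kappa^2-\varkappa^2}$. Then at every $(t,x)\in I\times\mathbb R$ all the derivatives below exist and: (1) $\dfrac{d}{dt}g_{12}(\varkappa)=-\Xi\,g_{12}(\varkappa)[\gamma(\kappa)+1]+\Theta\,g_{12}(\kappa)[\gamma(\varkappa)+1]$, $\dfrac{d}{dt}g_{21}(\varkappa)=\Xi\,g_{21}(\varkappa)[\gamma(\kappa)+1]-\Theta\,g_{21}(\kappa)[\gamma(\varkappa)+1]$, $\dfrac{d}{dt}\gamma(\varkappa)=-2\Theta\,[g_{12}(\kappa)g_{21}(\varkappa)-g_{21}(\kappa)g_{12}(\varkappa)]$; (2) $\partial_t\{2i\varkappa\gamma(\varkappa)-(q\,g_{21}(\varkappa)+r\,g_{12}(\varkappa))\}+\partial_x j_\gamma(\varkappa,\kappa)=0$, where $$j_\gamma(\varkappa,\kappa)=-\tfrac{\kappa^3(\kappa^2+\varkappa^2)}{(\kappa^2-\varkappa^2)^2}[g_{12}(\kappa)g_{21}(\varkappa)+g_{21}(\kappa)g_{12}(\varkappa)]-\tfrac{\kappa^4\varkappa}{(\kappa^2-\varkappa^2)^2}(\gamma(\kappa)+1)(\gamma(\varkappa)+1);$$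 (3) $\partial_t\rho(\varkappa)+\partial_x j_{A(\kappa)}(\varkappa,\kappa)=0$, where $$\rho(\varkappa)=-\varkappa\,\frac{q\,g_{21}(\varkappa)+r\,g_{12}(\varkappa)}{2+\gamma(\varkappa)},\qquad j_{A(\kappa)}(\varkappa,\kappa)=-\Theta\,\frac{g_{12}(\kappa)g_{21}(\varkappa)+g_{12}(\varkappa)g_{21}(\kappa)}{2+\gamma(\varkappa)}-\Theta\,\frac{\varkappa}{2\kappa}\,\gamma(\kappa).$$ -/

import Mathlib

open MeasureTheory Filter Topology
open scoped SchwartzMap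

noncomputable section

namespace DNLS

/-! ### Fourier transform and Sobolev balls -/

/-- The unitary Fourier transform `q̂(ξ) = (2π)^(-1/2) ∫ exp(-i ξ x) q(x) dx`. -/
def fourierHat (q : 𝓢(ℝ, ℂ)) (ξ : ℝ) : ℂ :=
  ((Real.sqrt (2 * Real.pi))⁻¹ : ℝ) * ∫ x : ℝ, Complex.exp (-(Complex.I * ξ * x)) * q x

/-- `‖q‖_{H^s}`, with `‖q‖_{H^s}^2 = ∫ (4 + ξ^2)^s |q̂(ξ)|^2 dξ`. -/
def sobolevNorm (s : ℝ) (q : 𝓢(ℝ, ℂ)) : ℝ :=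
  Real.sqrt (∫ ξ : ℝ, (4 + ξ ^ 2) ^ s * ‖fourierHat q ξ‖ ^ 2)

/-- The Schwartz functions in the closed ball of radius `δ` of `H^s`. -/
def schwartzBall (s δ : ℝ) : Set 𝓢(ℝ, ℂ) := {q | sobolevNorm s q ≤ δ}

/-! ### The spectral parameter -/

/-- `i κ^2` is real and of modulus at least one. -/
def Admissible (κ : ℂ) : Prop :=
  (Complex.I * κ ^ 2).im = 0 ∧ 1 ≤ |(Complex.I * κ ^ 2).re|

/-- `sgn(i κ^2)`. -/
def sgn (κ : ℂ) : ℂ := (Real.sign (Complex.I * κ ^ 2).re : ℝ)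

/-! ### The Lax operator and its Green's function -/

/-- `L(κ) u = f` in the sense of distributions on the line, where
`L(κ) = [[∂ + iκ^2, -κ q], [-κ r, ∂ - iκ^2]]`. -/
def LaxEquation (κ : ℂ) (q r : 𝓢(ℝ, ℂ)) (u f : ℝ → Fin 2 → ℂ) : Prop :=
  ∀ φ : 𝓢(ℝ, ℂ),
    (∫ x : ℝ, (u x 0 * (-deriv φ x + Complex.I * κ ^ 2 * φ x) - κ * q x * u x 1 * φ x)
      = ∫ x : ℝ, f x 0 * φ x) ∧
    (∫ x : ℝ, (u x 1 * (-deriv φ x - Complex.I * κ ^ 2 * φ x) - κ * r x * u x 0 * φ x)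
      = ∫ x : ℝ, f x 1 * φ x)

/-- The Heaviside function with the midpoint value `1/2` at the origin. -/
def heaviside (x : ℝ) : ℂ := if 0 < x then 1 else if x = 0 then 1 / 2 else 0

/-- The Green's function of the unperturbed operator `L_0(κ) = diag(∂ + iκ^2, ∂ - iκ^2)`.
On the diagonal, where it jumps, it takes the mean of its one-sided limits; the difference of
its two diagonal entries is continuous there, with value `sgn(iκ^2)`. -/
def freeGreen (κ : ℂ) (x y : ℝ) : Matrix (Fin 2) (Fin 2) ℂ :=
  let e : ℂ := (Real.exp (-(|(Complex.I * κ ^ 2).re| * |x - y|)) : ℝ)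
  if 0 < (Complex.I * κ ^ 2).re then
    !![e * heaviside (x - y), 0; 0, -(e * heaviside (y - x))]
  else
    !![-(e * heaviside (y - x)), 0; 0, e * heaviside (x - y)]

/-- `G` is the integral kernel of the inverse of `L(κ)` on `L^2(ℝ; ℂ^2)`: for all `f` in `L^2`,
the equation `L(κ) u = f` has one and only one solution `u` in `L^2`, given by
`u(x) = ∫ G(x, y) f(y) dy`. (As `q`, `r` are bounded, such a `u` lies in `H^1`, the domain of
`L(κ)`.) The pointwise values of `G` are fixed by the continuity of `G - G_0`. -/
structure IsGreenFunction (κ : ℂ) (q r : 𝓢(ℝ, ℂ))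
    (G : ℝ → ℝ → Matrix (Fin 2) (Fin 2) ℂ) : Prop where
  continuous_sub : Continuous fun p : ℝ × ℝ => G p.1 p.2 - freeGreen κ p.1 p.2
  memLp_row : ∀ (x : ℝ) (i j : Fin 2), MemLp (fun y => G x y i j) 2 volume
  memLp_apply : ∀ f : ℝ → Fin 2 → ℂ, MemLp f 2 volume →
    MemLp (fun x => ∫ y : ℝ, (G x y).mulVec (f y)) 2 volume
  inverse : ∀ f u : ℝ → Fin 2 → ℂ, MemLp f 2 volume → MemLp u 2 volume →
    (LaxEquation κ q r u f ↔ u =ᵐ[volume] fun x => ∫ y : ℝ, (G x y).mulVec (f y))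

open Classical in
/-- The Green's function `G(x, y; κ)` of `L(κ)` (zero if `L(κ)` has none). -/
def green (κ : ℂ) (q r : 𝓢(ℝ, ℂ)) : ℝ → ℝ → Matrix (Fin 2) (Fin 2) ℂ :=
  if h : ∃ G, IsGreenFunction κ q r G then h.choose else 0

/-- `γ(x; κ) = sgn(iκ^2) [G_11(x,x;κ) - G_22(x,x;κ)] - 1`. -/
def gam (κ : ℂ) (q r : 𝓢(ℝ, ℂ)) (x : ℝ) : ℂ :=
  sgn κ * (green κ q r x x 0 0 - green κ q r x x 1 1) - 1

/-- `g_12(x; κ) = sgn(iκ^2) G_12(x,x;κ)`. -/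
def g12 (κ : ℂ) (q r : 𝓢(ℝ, ℂ)) (x : ℝ) : ℂ := sgn κ * green κ q r x x 0 1

/-- `g_21(x; κ) = sgn(iκ^2) G_21(x,x;κ)`. -/
def g21 (κ : ℂ) (q r : 𝓢(ℝ, ℂ)) (x : ℝ) : ℂ := sgn κ * green κ q r x x 1 0

/-! ### The logarithmic perturbation determinant `A(κ)` -/

/-- Composition of integral kernels. -/
def kerComp (K M : ℝ → ℝ → ℂ) (ξ η : ℝ) : ℂ := ∫ ζ : ℝ, K ξ ζ * M ζ η

/-- `kerPow K n` is the integral kernel of the `(n+1)`-st power of the operator with kernel `K`. -/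
def kerPow (K : ℝ → ℝ → ℂ) : ℕ → ℝ → ℝ → ℂ
  | 0 => K
  | n + 1 => kerComp K (kerPow K n)

/-- The trace of the operator with kernel `K`. -/
def kerTrace (K : ℝ → ℝ → ℂ) : ℂ := ∫ ξ : ℝ, K ξ ξ

/-- The operator `Λ = (∂ + iκ^2)^(-1/2) κ q (∂ - iκ^2)^(-1/2)`, conjugated by the unitary Fourier
transform, as an integral kernel: `∂` becomes multiplication by `iξ`, and multiplication by `q`
becomes the kernel `(2π)^(-1/2) q̂(ξ - η)`. Powers are principal. -/
def kerLambda (κ : ℂ) (q : 𝓢(ℝ, ℂ)) (ξ η : ℝ) : ℂ :=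
  (Complex.I * ξ + Complex.I * κ ^ 2) ^ (-(1 / 2) : ℂ)
    * (κ * ((Real.sqrt (2 * Real.pi))⁻¹ : ℝ) * fourierHat q (ξ - η))
    * (Complex.I * η - Complex.I * κ ^ 2) ^ (-(1 / 2) : ℂ)

/-- The operator `Γ = (∂ - iκ^2)^(-1/2) κ r (∂ + iκ^2)^(-1/2)` on the Fourier side. -/
def kerGamma (κ : ℂ) (r : 𝓢(ℝ, ℂ)) (ξ η : ℝ) : ℂ :=
  (Complex.I * ξ - Complex.I * κ ^ 2) ^ (-(1 / 2) : ℂ)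
    * (κ * ((Real.sqrt (2 * Real.pi))⁻¹ : ℝ) * fourierHat r (ξ - η))
    * (Complex.I * η + Complex.I * κ ^ 2) ^ (-(1 / 2) : ℂ)

/-- `A(κ; q, r) = - sgn(iκ^2) ∑_{m ≥ 1} (1/m) tr((Λ Γ)^m)`. -/
def A (κ : ℂ) (q r : 𝓢(ℝ, ℂ)) : ℂ :=
  -sgn κ * ∑' n : ℕ, (1 / ((n : ℂ) + 1))
    * kerTrace (kerPow (kerComp (kerLambda κ q) (kerGamma κ r)) n)

/-! ### Hamiltonian flows -/

/-- `u = δF/δq` and `v = δF/δr` at the point `(q, r)`, for a functional `F` of two Schwartz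
functions. -/
def HasFunctionalDerivs (F : 𝓢(ℝ, ℂ) → 𝓢(ℝ, ℂ) → ℂ) (q r u v : 𝓢(ℝ, ℂ)) : Prop :=
  ∀ f h : 𝓢(ℝ, ℂ),
    HasDerivAt (fun θ : ℝ => F (q + θ • f) (r + θ • h))
      ((∫ x : ℝ, f x * u x) + ∫ x : ℝ, h x * v x) 0

/-- The curve `f` in the Schwartz space is differentiable at time `t`, in the topology of the
Schwartz space, with derivative `w`. -/
def HasTimeDeriv (f : ℝ → 𝓢(ℝ, ℂ)) (w : 𝓢(ℝ, ℂ)) (t : ℝ) : Prop :=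
  Tendsto (fun τ : ℝ => (τ - t)⁻¹ • (f τ - f t)) (𝓝[≠] t) (𝓝 w)

/-- `(q, r)` solves, at the times in `I`, the Hamiltonian flow of `H`:
`∂_t q = ∂_x (δH/δr)`, `∂_t r = ∂_x (δH/δq)`. -/
def IsHamiltonianFlow (H : 𝓢(ℝ, ℂ) → 𝓢(ℝ, ℂ) → ℂ) (I : Set ℝ) (q r : ℝ → 𝓢(ℝ, ℂ)) : Prop :=
  ∀ t ∈ I, ∃ u v : 𝓢(ℝ, ℂ), HasFunctionalDerivs H (q t) (r t) u v ∧
    HasTimeDeriv q (SchwartzMap.derivCLM ℂ ℂ v) t ∧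
    HasTimeDeriv r (SchwartzMap.derivCLM ℂ ℂ u) t

/-! ### Densities and fluxes -/

/-- `Θ = ϰ κ^3 / (κ^2 - ϰ^2)`. -/
def Theta (κ ϰ : ℂ) : ℂ := ϰ * κ ^ 3 / (κ ^ 2 - ϰ ^ 2)

/-- `Ξ = ϰ^2 κ^2 / (κ^2 - ϰ^2)`. -/
def Xi (κ ϰ : ℂ) : ℂ := ϰ ^ 2 * κ ^ 2 / (κ ^ 2 - ϰ ^ 2)

/-- `2iϰ γ(ϰ) - (q g_21(ϰ) + r g_12(ϰ))`. -/
def gammaDensity (ϰ : ℂ) (q r : 𝓢(ℝ, ℂ)) (x : ℝ) : ℂ :=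
  2 * Complex.I * ϰ * gam ϰ q r x - (q x * g21 ϰ q r x + r x * g12 ϰ q r x)

/-- `ρ(ϰ) = -ϰ (q g_21(ϰ) + r g_12(ϰ)) / (2 + γ(ϰ))`. -/
def rho (ϰ : ℂ) (q r : 𝓢(ℝ, ℂ)) (x : ℝ) : ℂ :=
  -ϰ * ((q x * g21 ϰ q r x + r x * g12 ϰ q r x) / (2 + gam ϰ q r x))

/-- The flux `j_γ(ϰ, κ)`. -/
def jGamma (ϰ κ : ℂ) (q r : 𝓢(ℝ, ℂ)) (x : ℝ) : ℂ :=
  -(κ ^ 3 * (κ ^ 2 + ϰ ^ 2) / (κ ^ 2 - ϰ ^ 2) ^ 2)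
      * (g12 κ q r x * g21 ϰ q r x + g21 κ q r x * g12 ϰ q r x)
    - κ ^ 4 * ϰ / (κ ^ 2 - ϰ ^ 2) ^ 2 * ((gam κ q r x + 1) * (gam ϰ q r x + 1))

/-- The flux `j_{A(κ)}(ϰ, κ)`. -/
def jA (ϰ κ : ℂ) (q r : 𝓢(ℝ, ℂ)) (x : ℝ) : ℂ :=
  -Theta κ ϰ * ((g12 κ q r x * g21 ϰ q r x + g12 ϰ q r x * g21 κ q r x) / (2 + gam ϰ q r x))
    - Theta κ ϰ * (ϰ / (2 * κ)) * gam κ q r x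

/-- The microscopic conservation law `∂_t ρ + ∂_x j = 0` on `I × ℝ`, in the classical sense. -/
def MicroscopicLaw (I : Set ℝ) (ρ j : ℝ → ℝ → ℂ) : Prop :=
  ∀ t ∈ I, ∀ x : ℝ,
    DifferentiableAt ℝ (fun τ => ρ τ x) t ∧ DifferentiableAt ℝ (fun y => j t y) x ∧
      deriv (fun τ => ρ τ x) t + deriv (fun y => j t y) x = 0

end DNLS

end

noncomputable section

namespace DNLS

/-! ### Exponentially weighted half-line integrals -/

section HalfLine

variable {E : Type*} [NormedAddCommGroup E] [NormedSpace ℝ E]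

/-- `∫_x^∞ exp(-k (y - x)) g(y) dy`. -/
def rint (k : ℝ) (g : ℝ → E) (x : ℝ) : E :=
  ∫ y in Set.Ioi x, Real.exp (-(k * (y - x))) • g y

/-- `∫_{-∞}^x exp(-k (x - y)) g(y) dy`. -/
def lint (k : ℝ) (g : ℝ → E) (x : ℝ) : E := rint k (fun y => g (-y)) (-x)

theorem rint_eq_integral_shift (k : ℝ) (g : ℝ → E) (x : ℝ) :
    rint k g x = ∫ s in Set.Ioi (0 : ℝ), Real.exp (-(k * s)) • g (x + s) := by
  unfold rint
  rw [← integral_indicator measurableSet_Ioi, ← integral_indicator measurableSet_Ioi,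
    ← integral_add_left_eq_self _ x]
  refine integral_congr_ae (Eventually.of_forall fun s => ?_)
  by_cases hs : 0 < s
  · simp [Set.indicator, hs]
  · simp [Set.indicator, hs]

theorem lint_eq_integral (k : ℝ) (g : ℝ → E) (x : ℝ) :
    lint k g x = ∫ y in Set.Iic x, Real.exp (-(k * (x - y))) • g y := by
  unfold lint rint
  have := integral_comp_neg_Ioi (-x) (fun y => Real.exp (-(k * (x - y))) • g y)
  rw [neg_neg] at this
  rw [← this]
  refine integral_congr_ae (Eventually.of_forall fun s => ?_)
  simp only
  congr 3
  ring

theorem integrableOn_exp_decay {k : ℝ} (hk : 0 < k) (x : ℝ) :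
    IntegrableOn (fun y => Real.exp (-(k * (y - x)))) (Set.Ioi x) := by
  have := (integrableOn_exp_mul_Ioi (a := -k) (by linarith) x).const_mul (Real.exp (k * x))
  refine this.congr (Eventually.of_forall fun y => ?_)
  simp only
  rw [← Real.exp_add]
  congr 1
  ring

theorem integral_exp_decay {k : ℝ} (hk : 0 < k) (x : ℝ) :
    ∫ y in Set.Ioi x, Real.exp (-(k * (y - x))) = k⁻¹ := by
  have h := integral_exp_mul_Ioi (a := -k) (by linarith) x
  have : ∀ y, Real.exp (-(k * (y - x))) = Real.exp (k * x) * Real.exp (-k * y) := by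
    intro y
    rw [← Real.exp_add]
    congr 1
    ring
  simp_rw [this]
  rw [integral_const_mul, h, neg_div_neg_eq, ← mul_div_assoc, ← Real.exp_add]
  simp

theorem integrableOn_rint {k M : ℝ} (hk : 0 < k) {g : ℝ → E} (hg : AEStronglyMeasurable g)
    (hM : ∀ y, ‖g y‖ ≤ M) (x : ℝ) :
    IntegrableOn (fun y => Real.exp (-(k * (y - x))) • g y) (Set.Ioi x) := by
  refine ((integrableOn_exp_decay hk x).mul_const M).mono' ?_ ?_
  · exact AEStronglyMeasurable.smul (by fun_prop) hg.restrict
  · refine Eventually.of_forall fun y => ?_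
    rw [norm_smul, Real.norm_of_nonneg (Real.exp_nonneg _)]
    exact mul_le_mul_of_nonneg_left (hM y) (Real.exp_nonneg _)

theorem norm_rint_le {k M : ℝ} (hk : 0 < k) {g : ℝ → E} (x : ℝ)
    (hM : ∀ y, x < y → ‖g y‖ ≤ M) : ‖rint k g x‖ ≤ M / k := by
  have h1 : ‖rint k g x‖ ≤ ∫ y in Set.Ioi x, Real.exp (-(k * (y - x))) * M := by
    refine norm_integral_le_of_norm_le ((integrableOn_exp_decay hk x).mul_const M) ?_
    refine (ae_restrict_mem measurableSet_Ioi).mono fun y hy => ?_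
    rw [norm_smul, Real.norm_of_nonneg (Real.exp_nonneg _)]
    exact mul_le_mul_of_nonneg_left (hM y hy) (Real.exp_nonneg _)
  rw [integral_mul_const, integral_exp_decay hk] at h1
  rwa [div_eq_inv_mul]

theorem norm_lint_le {k M : ℝ} (hk : 0 < k) {g : ℝ → E} (x : ℝ)
    (hM : ∀ y, y < x → ‖g y‖ ≤ M) : ‖lint k g x‖ ≤ M / k :=
  norm_rint_le hk _ fun y hy => hM _ (by linarith)

theorem rint_const_smul {𝕜 : Type*} [NormedField 𝕜] [NormedSpace 𝕜 E] [SMulCommClass ℝ 𝕜 E]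
    (k : ℝ) (c : 𝕜) (g : ℝ → E) (x : ℝ) :
    rint k (fun y => c • g y) x = c • rint k g x := by
  unfold rint
  rw [← integral_smul]
  refine integral_congr_ae (Eventually.of_forall fun s => ?_)
  simp only
  rw [smul_comm]

theorem hasDerivAt_integral_Ioi [CompleteSpace E] {h : ℝ → E} (hc : Continuous h)
    (hi : ∀ x, IntegrableOn h (Set.Ioi x)) (x : ℝ) :
    HasDerivAt (fun x => ∫ y in Set.Ioi x, h y) (-h x) x := by
  have h1 : (fun x => ∫ y in Set.Ioi x, h y)
      = fun x => (∫ y in Set.Ioi 0, h y) - ∫ y in (0 : ℝ)..x, h y := by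
    funext x
    rw [← intervalIntegral.integral_Ioi_sub_Ioi' (hi 0) (hi x)]
    abel
  rw [h1]
  exact (intervalIntegral.integral_hasDerivAt_right (hc.intervalIntegrable _ _)
    hc.stronglyMeasurable.stronglyMeasurableAtFilter hc.continuousAt).const_sub _

theorem hasDerivAt_rint_of_integrableOn [CompleteSpace E] {k : ℝ} {g : ℝ → E} (hc : Continuous g)
    (hi : ∀ x, IntegrableOn (fun y => Real.exp (-(k * (y - x))) • g y) (Set.Ioi x)) (x : ℝ) :
    HasDerivAt (rint k g) (k • rint k g x - g x) x := by
  have hexp : ∀ x y, Real.exp (-(k * (y - x))) = Real.exp (k * x) * Real.exp (-(k * y)) := by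
    intro x y
    rw [← Real.exp_add]
    congr 1
    ring
  have hi' : ∀ x, IntegrableOn (fun y => Real.exp (-(k * y)) • g y) (Set.Ioi x) := by
    intro x
    have := (hi x).smul (Real.exp (-(k * x)))
    refine this.congr (Eventually.of_forall fun y => ?_)
    simp only [Pi.smul_apply, smul_smul]
    rw [← Real.exp_add]
    congr 2
    ring
  have h1 : rint k g = fun x => Real.exp (k * x) • ∫ y in Set.Ioi x, Real.exp (-(k * y)) • g y := by
    funext x
    unfold rint
    rw [← integral_smul]
    refine integral_congr_ae (Eventually.of_forall fun s => ?_)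
    simp only [hexp, smul_smul]
  have h2 : HasDerivAt (fun x => Real.exp (k * x)) (k * Real.exp (k * x)) x := by
    have := ((hasDerivAt_id x).const_mul k).exp
    simpa [mul_comm] using this
  have h3 := h2.smul (hasDerivAt_integral_Ioi
    (h := fun y => Real.exp (-(k * y)) • g y) (by fun_prop) hi' x)
  rw [h1]
  refine h3.congr_deriv ?_
  simp only [smul_smul, smul_neg]
  rw [← Real.exp_add]
  simp only [add_neg_cancel, Real.exp_zero, one_smul]
  abel

theorem hasDerivAt_rint [CompleteSpace E] {k M : ℝ} (hk : 0 < k) {g : ℝ → E} (hc : Continuous g)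
    (hM : ∀ y, ‖g y‖ ≤ M) (x : ℝ) :
    HasDerivAt (rint k g) (k • rint k g x - g x) x :=
  hasDerivAt_rint_of_integrableOn hc (integrableOn_rint hk hc.aestronglyMeasurable hM) x

theorem hasDerivAt_lint [CompleteSpace E] {k M : ℝ} (hk : 0 < k) {g : ℝ → E} (hc : Continuous g)
    (hM : ∀ y, ‖g y‖ ≤ M) (x : ℝ) :
    HasDerivAt (lint k g) (g x - k • lint k g x) x := by
  have h := (hasDerivAt_rint hk (g := fun y => g (-y)) (by fun_prop) (fun y => hM _) (-x)).scomp x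
    (hasDerivAt_neg x)
  refine h.congr_deriv ?_
  simp [lint]

theorem hasDerivAt_rint_zero [CompleteSpace E] {g : ℝ → E} (hc : Continuous g)
    (hi : Integrable g) (x : ℝ) : HasDerivAt (rint 0 g) (-g x) x := by
  have := hasDerivAt_rint_of_integrableOn (k := 0) hc (fun x => by simpa using hi.integrableOn) x
  simpa using this

theorem norm_rint_zero_le {g : ℝ → E} {G : ℝ → ℝ} (hG : Integrable G)
    (h : ∀ y, ‖g y‖ ≤ G y) (x : ℝ) : ‖rint 0 g x‖ ≤ ∫ y, G y := by
  have h0 : ∀ y, 0 ≤ G y := fun y => (norm_nonneg _).trans (h y)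
  calc ‖rint 0 g x‖ ≤ ∫ y in Set.Ioi x, G y := by
        refine norm_integral_le_of_norm_le hG.integrableOn (Eventually.of_forall fun y => ?_)
        simpa using h y
    _ ≤ ∫ y, G y := setIntegral_le_integral hG (Eventually.of_forall h0)

theorem tendsto_rint_zero_atTop (g : ℝ → E) :
    Tendsto (rint 0 g) atTop (𝓝 0) := by
  have h := tendsto_integral_Ioi_zero (μ := volume) (f := g) (b := fun x : ℝ => x)
    (l := atTop) tendsto_id
  refine h.congr fun x => ?_
  simp [rint]

theorem tendsto_rint_atTop {k : ℝ} (hk : 0 < k) {g : ℝ → E} (h : Tendsto g atTop (𝓝 0)) :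
    Tendsto (rint k g) atTop (𝓝 0) := by
  rw [Metric.tendsto_atTop] at h ⊢
  intro ε hε
  obtain ⟨N, hN⟩ := h (ε * k / 2) (by positivity)
  refine ⟨N, fun x hx => ?_⟩
  rw [dist_zero_right]
  have : ‖rint k g x‖ ≤ (ε * k / 2) / k := norm_rint_le hk x fun y hy => by
    have := hN y (by linarith)
    rw [dist_zero_right] at this
    exact this.le
  have h2 : (ε * k / 2) / k = ε / 2 := by field_simp
  linarith

theorem integrable_rint_kernel {k : ℝ} (hk : 0 < k) {g : ℝ → E} (hg : Integrable g) :
    Integrable (fun p : ℝ × ℝ => Real.exp (-(k * p.2)) • g (p.1 + p.2))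
      (volume.prod (volume.restrict (Set.Ioi 0))) := by
  have h1 : Integrable (fun s : ℝ => Real.exp (-(k * s))) (volume.restrict (Set.Ioi 0)) := by
    simpa [IntegrableOn] using integrableOn_exp_decay hk 0
  exact (measurePreserving_add_prod volume (volume.restrict (Set.Ioi (0 : ℝ)))).integrable_comp_of_integrable
    (h1.smul_prod hg).swap

theorem integrable_rint {k : ℝ} (hk : 0 < k) {g : ℝ → E} (hg : Integrable g) :
    Integrable (rint k g) := by
  have := (integrable_rint_kernel hk hg).integral_prod_left
  refine this.congr (Eventually.of_forall fun x => ?_)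
  simp only
  rw [rint_eq_integral_shift]

theorem integral_rint [CompleteSpace E] {k : ℝ} (hk : 0 < k) {g : ℝ → E} (hg : Integrable g) :
    ∫ x, rint k g x = k⁻¹ • ∫ x, g x := by
  simp_rw [rint_eq_integral_shift]
  rw [integral_integral_swap (integrable_rint_kernel hk hg)]
  simp_rw [integral_smul, integral_add_right_eq_self]
  rw [integral_smul_const]
  congr 1
  simpa using integral_exp_decay hk 0

theorem integrable_lint {k : ℝ} (hk : 0 < k) {g : ℝ → E} (hg : Integrable g) :
    Integrable (lint k g) :=
  (integrable_rint hk hg.comp_neg).comp_neg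

/-- A bounded solution of `X' = k X - g` with `k > 0`. -/
theorem eq_rint_of_hasDerivAt [CompleteSpace E] {k M N : ℝ} (hk : 0 < k) {g X : ℝ → E}
    (hc : Continuous g)
    (hM : ∀ y, ‖g y‖ ≤ M) (hN : ∀ y, ‖X y‖ ≤ N)
    (hX : ∀ x, HasDerivAt X (k • X x - g x) x) (x : ℝ) : X x = rint k g x := by
  set D : ℝ → E := fun x => X x - rint k g x with hD
  have hD' : ∀ x, HasDerivAt D (k • D x) x := fun x => by
    refine ((hX x).sub (hasDerivAt_rint hk hc hM x)).congr_deriv ?_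
    simp only [hD, smul_sub]
    abel
  have hF : ∀ x, HasDerivAt (fun x => Real.exp (-(k * x)) • D x) 0 x := fun x => by
    have h2 : HasDerivAt (fun x => Real.exp (-(k * x))) (-k * Real.exp (-(k * x))) x := by
      have := ((hasDerivAt_id x).const_mul k).neg.exp
      simpa [mul_comm] using this
    refine (h2.smul (hD' x)).congr_deriv ?_
    simp only [smul_smul]
    rw [← add_smul]
    convert zero_smul ℝ _
    ring
  have hconst : ∀ z, Real.exp (-(k * x)) • D x = Real.exp (-(k * z)) • D z := fun z =>
    is_const_of_deriv_eq_zero (fun y => (hF y).differentiableAt) (fun y => (hF y).deriv) x z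
  have hlim : Tendsto (fun z => Real.exp (-(k * z)) • D z) atTop (𝓝 0) := by
    have h1 : Tendsto (fun z => Real.exp (-(k * z)) * (N + M / k)) atTop (𝓝 (0 * (N + M / k))) := by
      refine Tendsto.mul_const _ ?_
      exact Real.tendsto_exp_neg_atTop_nhds_zero.comp (tendsto_id.const_mul_atTop hk)
    rw [zero_mul] at h1
    refine squeeze_zero_norm (fun z => ?_) h1
    rw [norm_smul, Real.norm_of_nonneg (Real.exp_nonneg _)]
    refine mul_le_mul_of_nonneg_left ?_ (Real.exp_nonneg _)
    exact (norm_sub_le _ _).trans (add_le_add (hN z) (norm_rint_le hk z fun y _ => hM y))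
  have h0 : Real.exp (-(k * x)) • D x = 0 := by
    refine tendsto_nhds_unique ?_ hlim
    simp_rw [← hconst]
    exact tendsto_const_nhds
  have h1 : D x = 0 := by
    rcases smul_eq_zero.1 h0 with h | h
    · exact absurd h (Real.exp_ne_zero _)
    · exact h
  exact sub_eq_zero.1 h1

theorem eq_lint_of_hasDerivAt [CompleteSpace E] {k M N : ℝ} (hk : 0 < k) {g X : ℝ → E}
    (hc : Continuous g)
    (hM : ∀ y, ‖g y‖ ≤ M) (hN : ∀ y, ‖X y‖ ≤ N)
    (hX : ∀ x, HasDerivAt X (g x - k • X x) x) (x : ℝ) : X x = lint k g x := by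
  have h := eq_rint_of_hasDerivAt hk (g := fun y => g (-y)) (X := fun y => X (-y)) (M := M) (N := N)
    (by fun_prop) (fun y => hM _) (fun y => hN _) (fun y => by
      refine ((hX (-y)).scomp y (hasDerivAt_neg y)).congr_deriv ?_
      simp) (-x)
  simpa [lint] using h

end HalfLine

/-! ### Norms of Schwartz functions -/

/-- The supremum norm, as a Schwartz seminorm. -/
def supNorm (P : 𝓢(ℝ, ℂ)) : ℝ := SchwartzMap.seminorm ℝ 0 0 P

/-- The square of the `L^2` norm. -/
def l2sq (P : 𝓢(ℝ, ℂ)) : ℝ := ∫ x, ‖P x‖ ^ 2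

theorem norm_le_supNorm (P : 𝓢(ℝ, ℂ)) (x : ℝ) : ‖P x‖ ≤ supNorm P :=
  SchwartzMap.norm_le_seminorm ℝ P x

theorem supNorm_nonneg (P : 𝓢(ℝ, ℂ)) : 0 ≤ supNorm P := apply_nonneg _ _

theorem l2sq_nonneg (P : 𝓢(ℝ, ℂ)) : 0 ≤ l2sq P := integral_nonneg fun _ => by positivity

theorem integrable_norm_sq (P : 𝓢(ℝ, ℂ)) : Integrable fun x => ‖P x‖ ^ 2 := by
  have := (P.memLp 2 volume).integrable_norm_pow (by norm_num)
  simpa using this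

theorem norm_toLp_two_sq (P : 𝓢(ℝ, ℂ)) : ‖P.toLp 2 volume‖ ^ 2 = l2sq P := by
  rw [← real_inner_self_eq_norm_sq, L2.inner_def]
  unfold l2sq
  refine integral_congr_ae ?_
  filter_upwards [P.coeFn_toLp 2 volume] with x hx
  rw [hx, real_inner_self_eq_norm_sq]

theorem continuous_l2sq : Continuous l2sq := by
  have h : l2sq = fun P : 𝓢(ℝ, ℂ) => ‖P.toLp 2 volume‖ ^ 2 := by
    funext P
    rw [norm_toLp_two_sq]
  rw [h]
  have := SchwartzMap.continuous_toLp (E := ℝ) (F := ℂ) (p := 2) (μ := volume)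
  fun_prop

theorem continuous_integral_norm : Continuous fun P : 𝓢(ℝ, ℂ) => ∫ x, ‖P x‖ := by
  have h : (fun P : 𝓢(ℝ, ℂ) => ∫ x, ‖P x‖) = fun P : 𝓢(ℝ, ℂ) => ‖P.toLp 1 volume‖ := by
    funext P
    rw [SchwartzMap.norm_toLp_one]
  rw [h]
  have := SchwartzMap.continuous_toLp (E := ℝ) (F := ℂ) (p := 1) (μ := volume)
  fun_prop

theorem continuous_seminorm (m n : ℕ) :
    Continuous fun P : 𝓢(ℝ, ℂ) => SchwartzMap.seminorm ℝ m n P :=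
  (schwartz_withSeminorms ℝ ℝ ℂ).continuous_seminorm (m, n)

theorem continuous_supNorm : Continuous supNorm := continuous_seminorm 0 0

theorem continuous_eval (x : ℝ) : Continuous fun P : 𝓢(ℝ, ℂ) => P x := by
  have h := (BoundedContinuousFunction.evalCLM ℝ x).continuous.comp
    (SchwartzMap.toBoundedContinuousFunctionCLM ℝ ℝ ℂ).continuous
  exact h

theorem norm_mul_one_add_sq_le (P : 𝓢(ℝ, ℂ)) (x : ℝ) :
    ‖P x‖ ≤ (SchwartzMap.seminorm ℝ 0 0 P + SchwartzMap.seminorm ℝ 2 0 P) * (1 + x ^ 2)⁻¹ := by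
  have h1 := SchwartzMap.norm_le_seminorm ℝ P x
  have h2 := SchwartzMap.norm_pow_mul_le_seminorm ℝ P 2 x
  rw [Real.norm_eq_abs, sq_abs] at h2
  rw [← div_eq_mul_inv, le_div_iff₀ (by positivity)]
  nlinarith

/-- Convergent families of Schwartz functions are eventually dominated by `C (1 + x^2)⁻¹`. -/
theorem eventually_norm_le_of_tendsto {ι : Type*} {l : Filter ι} {F : ι → 𝓢(ℝ, ℂ)} {F₀ : 𝓢(ℝ, ℂ)}
    (h : Tendsto F l (𝓝 F₀)) :
    ∃ C, 0 ≤ C ∧ ∀ᶠ τ in l, ∀ x, ‖F τ x‖ ≤ C * (1 + x ^ 2)⁻¹ := by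
  have h1 := (((continuous_seminorm 0 0).add (continuous_seminorm 2 0)).tendsto F₀).comp h
  have h2 := (h1.eventually_lt_const (lt_add_one _)).mono fun τ hτ => le_of_lt hτ
  refine ⟨SchwartzMap.seminorm ℝ 0 0 F₀ + SchwartzMap.seminorm ℝ 2 0 F₀ + 1, ?_, h2.mono fun τ hτ x => (norm_mul_one_add_sq_le (F τ) x).trans
    (mul_le_mul_of_nonneg_right hτ (by positivity))⟩
  positivity

/-- Reflection of a Schwartz function. -/
def refl : 𝓢(ℝ, ℂ) →L[ℂ] 𝓢(ℝ, ℂ) :=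
  SchwartzMap.compCLMOfContinuousLinearEquiv ℂ (ContinuousLinearEquiv.neg ℝ : ℝ ≃L[ℝ] ℝ)

@[simp] theorem refl_apply (P : 𝓢(ℝ, ℂ)) (x : ℝ) : refl P x = P (-x) := by
  simp [refl]

@[simp] theorem refl_refl (P : 𝓢(ℝ, ℂ)) : refl (refl P) = P := by
  ext x
  simp

@[simp] theorem l2sq_refl (P : 𝓢(ℝ, ℂ)) : l2sq (refl P) = l2sq P := by
  simp only [l2sq, refl_apply]
  exact integral_neg_eq_self (fun x => ‖P x‖ ^ 2) volume

@[simp] theorem supNorm_refl (P : 𝓢(ℝ, ℂ)) : supNorm (refl P) = supNorm P := by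
  have h : ∀ P : 𝓢(ℝ, ℂ), supNorm (refl P) ≤ supNorm P := fun P =>
    SchwartzMap.seminorm_le_bound ℝ 0 0 _ (supNorm_nonneg _) fun x => by
      simpa using norm_le_supNorm P (-x)
  refine le_antisymm (h P) ?_
  simpa using h (refl P)

/-! ### Jost solutions -/

/-- The smallness condition under which the Jost solutions are constructed. -/
def Small (k : ℝ) (P R : 𝓢(ℝ, ℂ)) : Prop := 0 < k ∧ l2sq P + l2sq R ≤ k

theorem Small.pos {k : ℝ} {P R : 𝓢(ℝ, ℂ)} (h : Small k P R) : 0 < k := h.1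

theorem Small.refl {k : ℝ} {P R : 𝓢(ℝ, ℂ)} (h : Small k P R) :
    Small k (DNLS.refl R) (DNLS.refl P) := ⟨h.1, by simpa [add_comm] using h.2⟩

/-- The inner integral of the Jost integral equation. -/
def jostInner (k : ℝ) (R : 𝓢(ℝ, ℂ)) (w : ℝ → ℂ) (x : ℝ) : ℂ :=
  rint (2 * k) (fun z => R z * w z) x

/-- The operator of the Jost integral equation. -/
def jostOp (k : ℝ) (P R : 𝓢(ℝ, ℂ)) (w : ℝ → ℂ) (x : ℝ) : ℂ :=
  rint 0 (fun y => P y * jostInner k R w y) x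

section JostOp

variable {k M : ℝ} {P R : 𝓢(ℝ, ℂ)} {w : ℝ → ℂ}

theorem norm_mul_le_supNorm (hM : ∀ x, ‖w x‖ ≤ M) (y : ℝ) : ‖R y * w y‖ ≤ supNorm R * M := by
  rw [norm_mul]
  exact mul_le_mul (norm_le_supNorm R y) (hM y) (norm_nonneg _) (supNorm_nonneg _)

theorem norm_jostInner_le (hk : 0 < k) (hM : ∀ x, ‖w x‖ ≤ M) (x : ℝ) :
    ‖jostInner k R w x‖ ≤ supNorm R * M / (2 * k) :=
  norm_rint_le (by positivity) x fun y _ => norm_mul_le_supNorm hM y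

theorem hasDerivAt_jostInner (hk : 0 < k) (hw : Continuous w) (hM : ∀ x, ‖w x‖ ≤ M) (x : ℝ) :
    HasDerivAt (jostInner k R w) (2 * k * jostInner k R w x - R x * w x) x := by
  have h := hasDerivAt_rint (k := 2 * k) (g := fun z => R z * w z) (by positivity)
    (R.continuous.mul hw) (norm_mul_le_supNorm hM) x
  refine h.congr_deriv ?_
  simp [jostInner]

theorem continuous_jostInner (hk : 0 < k) (hw : Continuous w) (hM : ∀ x, ‖w x‖ ≤ M) :
    Continuous (jostInner k R w) :=
  continuous_iff_continuousAt.2 fun x => (hasDerivAt_jostInner hk hw hM x).continuousAt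

theorem integrable_mul_jostInner (hk : 0 < k) (hw : Continuous w) (hM : ∀ x, ‖w x‖ ≤ M) :
    Integrable fun y => P y * jostInner k R w y :=
  P.integrable.mul_bdd (c := supNorm R * M / (2 * k))
    (continuous_jostInner hk hw hM).aestronglyMeasurable
    (Eventually.of_forall fun x => norm_jostInner_le hk hM x)

theorem hasDerivAt_jostOp (hk : 0 < k) (hw : Continuous w) (hM : ∀ x, ‖w x‖ ≤ M) (x : ℝ) :
    HasDerivAt (jostOp k P R w) (-(P x * jostInner k R w x)) x :=
  hasDerivAt_rint_zero (P.continuous.mul (continuous_jostInner hk hw hM))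
    (integrable_mul_jostInner hk hw hM) x

theorem continuous_jostOp (hk : 0 < k) (hw : Continuous w) (hM : ∀ x, ‖w x‖ ≤ M) :
    Continuous (jostOp k P R w) :=
  continuous_iff_continuousAt.2 fun x => (hasDerivAt_jostOp hk hw hM x).continuousAt

theorem norm_jostOp_le (hk : 0 < k) (hM : ∀ x, ‖w x‖ ≤ M) (x : ℝ) :
    ‖jostOp k P R w x‖ ≤ M * ((l2sq P + l2sq R) / (4 * k)) := by
  have hM0 : 0 ≤ M := (norm_nonneg _).trans (hM 0)
  have h2k : 0 < 2 * k := by positivity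
  have hR := integrable_norm_sq R
  set G : ℝ → ℝ := fun y =>
    M / 2 * ((2 * k)⁻¹ * ‖P y‖ ^ 2 + rint (2 * k) (fun z => ‖R z‖ ^ 2) y) with hG
  have hGi : Integrable G :=
    (((integrable_norm_sq P).const_mul _).add (integrable_rint h2k hR)).const_mul _
  have hle : ∀ y, ‖P y * jostInner k R w y‖ ≤ G y := fun y => by
    have hi : IntegrableOn (fun z => Real.exp (-(2 * k * (z - y))) • ‖R z‖ ^ 2) (Set.Ioi y) :=
      integrableOn_rint h2k (M := supNorm R ^ 2) hR.aestronglyMeasurable (fun z => by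
        rw [norm_pow, norm_norm]
        exact pow_le_pow_left₀ (norm_nonneg _) (norm_le_supNorm R z) 2) y
    have h1 : G y = ∫ z in Set.Ioi y,
        Real.exp (-(2 * k * (z - y))) * (M / 2 * (‖P y‖ ^ 2 + ‖R z‖ ^ 2)) := by
      simp only [hG, rint, ← integral_exp_decay h2k y]
      rw [← integral_mul_const, ← integral_add ((integrableOn_exp_decay h2k y).mul_const _) hi,
        ← integral_const_mul]
      refine integral_congr_ae (Eventually.of_forall fun z => ?_)
      simp only [smul_eq_mul]
      ring
    have h2 : P y * jostInner k R w y = ∫ z in Set.Ioi y,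
        Real.exp (-(2 * k * (z - y))) • (P y * (R z * w z)) := by
      simp only [jostInner, rint]
      rw [← integral_const_mul]
      refine integral_congr_ae (Eventually.of_forall fun z => ?_)
      simp only [Complex.real_smul]
      ring
    rw [h1, h2]
    refine norm_integral_le_of_norm_le ?_ (Eventually.of_forall fun z => ?_)
    · have h3 := (((integrableOn_exp_decay h2k y).mul_const (‖P y‖ ^ 2)).add hi).const_mul (M / 2)
      refine h3.congr (Eventually.of_forall fun z => ?_)
      simp only [smul_eq_mul, Pi.add_apply]
      ring
    · rw [norm_smul, Real.norm_of_nonneg (Real.exp_nonneg _), norm_mul, norm_mul]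
      refine mul_le_mul_of_nonneg_left ?_ (Real.exp_nonneg _)
      have h4 : ‖P y‖ * (‖R z‖ * ‖w z‖) ≤ ‖P y‖ * ‖R z‖ * M := by
        rw [← mul_assoc]
        exact mul_le_mul_of_nonneg_left (hM z) (by positivity)
      nlinarith [sq_nonneg (‖P y‖ - ‖R z‖)]
  refine (norm_rint_zero_le hGi hle x).trans (le_of_eq ?_)
  simp only [hG]
  rw [integral_const_mul, integral_add ((integrable_norm_sq P).const_mul _) (integrable_rint h2k hR),
    integral_const_mul, integral_rint h2k hR]
  simp only [l2sq, smul_eq_mul]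
  field_simp
  ring

theorem norm_jostOp_le' (hk : 0 < k) (hM : ∀ x, ‖w x‖ ≤ M) (x : ℝ) :
    ‖jostOp k P R w x‖ ≤ (∫ y, ‖P y‖) * (supNorm R * M / (2 * k)) := by
  have := norm_rint_zero_le (g := fun y => P y * jostInner k R w y)
    (P.integrable.norm.mul_const (supNorm R * M / (2 * k))) (fun y => by
      rw [norm_mul]
      exact mul_le_mul_of_nonneg_left (norm_jostInner_le hk hM y) (norm_nonneg _)) x
  rwa [integral_mul_const] at this

theorem jostInner_sub {R₁ R₂ : 𝓢(ℝ, ℂ)} {w₁ w₂ : ℝ → ℂ} {M₁ M₂ : ℝ} (hk : 0 < k)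
    (hw₁ : Continuous w₁) (hM₁ : ∀ x, ‖w₁ x‖ ≤ M₁)
    (hw₂ : Continuous w₂) (hM₂ : ∀ x, ‖w₂ x‖ ≤ M₂) (x : ℝ) :
    jostInner k R₁ w₁ x - jostInner k R₂ w₂ x
      = jostInner k R₁ (fun x => w₁ x - w₂ x) x + jostInner k (R₁ - R₂) w₂ x := by
  have h2k : 0 < 2 * k := by positivity
  have hM : ∀ x, ‖w₁ x - w₂ x‖ ≤ M₁ + M₂ := fun x =>
    (norm_sub_le _ _).trans (add_le_add (hM₁ x) (hM₂ x))
  simp only [jostInner, rint]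
  rw [← integral_sub, ← integral_add]
  · refine integral_congr_ae (Eventually.of_forall fun z => ?_)
    simp only [Complex.real_smul, sub_apply]
    ring
  · exact integrableOn_rint h2k (R₁.continuous.mul (hw₁.sub hw₂)).aestronglyMeasurable
      (norm_mul_le_supNorm hM) x
  · exact integrableOn_rint h2k ((R₁ - R₂).continuous.mul hw₂).aestronglyMeasurable
      (norm_mul_le_supNorm hM₂) x
  · exact integrableOn_rint h2k (R₁.continuous.mul hw₁).aestronglyMeasurable
      (norm_mul_le_supNorm hM₁) x
  · exact integrableOn_rint h2k (R₂.continuous.mul hw₂).aestronglyMeasurable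
      (norm_mul_le_supNorm hM₂) x

theorem jostOp_sub {P₁ P₂ R₁ R₂ : 𝓢(ℝ, ℂ)} {w₁ w₂ : ℝ → ℂ} {M₁ M₂ : ℝ} (hk : 0 < k)
    (hw₁ : Continuous w₁) (hM₁ : ∀ x, ‖w₁ x‖ ≤ M₁)
    (hw₂ : Continuous w₂) (hM₂ : ∀ x, ‖w₂ x‖ ≤ M₂) (x : ℝ) :
    jostOp k P₁ R₁ w₁ x - jostOp k P₂ R₂ w₂ x
      = jostOp k P₁ R₁ (fun x => w₁ x - w₂ x) x
        + (jostOp k P₁ (R₁ - R₂) w₂ x + jostOp k (P₁ - P₂) R₂ w₂ x) := by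
  have hM : ∀ x, ‖w₁ x - w₂ x‖ ≤ M₁ + M₂ := fun x =>
    (norm_sub_le _ _).trans (add_le_add (hM₁ x) (hM₂ x))
  simp only [jostOp, rint, zero_mul, neg_zero, Real.exp_zero, one_smul]
  rw [← integral_sub, ← integral_add, ← integral_add]
  · refine integral_congr_ae (Eventually.of_forall fun z => ?_)
    have h := jostInner_sub (R₁ := R₁) (R₂ := R₂) hk hw₁ hM₁ hw₂ hM₂ z
    simp only [sub_apply]
    linear_combination P₁ z * h
  · exact (integrable_mul_jostInner hk (hw₁.sub hw₂) hM).integrableOn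
  · exact (integrable_mul_jostInner hk hw₂ hM₂).integrableOn.add
      (integrable_mul_jostInner hk hw₂ hM₂).integrableOn
  · exact (integrable_mul_jostInner hk hw₂ hM₂).integrableOn
  · exact (integrable_mul_jostInner hk hw₂ hM₂).integrableOn
  · exact (integrable_mul_jostInner hk hw₁ hM₁).integrableOn
  · exact (integrable_mul_jostInner hk hw₂ hM₂).integrableOn

end JostOp

theorem exists_jost {k : ℝ} {P R : 𝓢(ℝ, ℂ)} (h : Small k P R) :
    ∃ a : ℝ → ℂ, Continuous a ∧ (∀ x, ‖a x - 1‖ ≤ 1 / 3) ∧ ∀ x, a x = 1 + jostOp k P R a x := by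
  have hk := h.pos
  have hsm : (l2sq P + l2sq R) / (4 * k) ≤ 1 / 4 := by
    rw [div_le_div_iff₀ (by positivity) (by norm_num)]
    linarith [h.2]
  let T : (BoundedContinuousFunction ℝ ℂ) → (BoundedContinuousFunction ℝ ℂ) := fun w =>
    BoundedContinuousFunction.ofNormedAddCommGroup (fun x => 1 + jostOp k P R w x)
      (continuous_const.add (continuous_jostOp hk w.continuous w.norm_coe_le_norm))
      (1 + ‖w‖ * ((l2sq P + l2sq R) / (4 * k))) (fun x => by
        refine (norm_add_le _ _).trans (add_le_add (by simp) ?_)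
        exact norm_jostOp_le hk w.norm_coe_le_norm x)
  have hT : ContractingWith (1 / 4) T := by
    refine ⟨by rw [← NNReal.coe_lt_coe]; norm_num, LipschitzWith.of_dist_le_mul fun v w => ?_⟩
    rw [BoundedContinuousFunction.dist_le (by positivity)]
    intro x
    have h1 := jostOp_sub (P₁ := P) (P₂ := P) (R₁ := R) (R₂ := R) hk v.continuous
      v.norm_coe_le_norm w.continuous w.norm_coe_le_norm x
    have h2 : T v x - T w x = jostOp k P R (fun x => v x - w x) x := by
      have hz : jostOp k P (R - R) w x = 0 := by simp [jostOp, jostInner, rint]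
      have hz' : jostOp k (P - P) R w x = 0 := by simp [jostOp, rint]
      rw [hz, hz'] at h1
      simp only [T, BoundedContinuousFunction.coe_ofNormedAddCommGroup]
      linear_combination h1
    rw [dist_eq_norm, h2]
    have h3 : ∀ x, ‖v x - w x‖ ≤ dist v w := fun x => by
      rw [← dist_eq_norm]
      exact BoundedContinuousFunction.dist_coe_le_dist x
    refine (norm_jostOp_le hk h3 x).trans ?_
    rw [mul_comm]
    refine mul_le_mul_of_nonneg_right (hsm.trans (by norm_num)) dist_nonneg
  set a := ContractingWith.fixedPoint T hT with ha
  have hfix : T a = a := hT.fixedPoint_isFixedPt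
  have hax : ∀ x, a x = 1 + jostOp k P R a x := fun x => by
    conv_lhs => rw [← hfix]
    simp [T]
  have hq : ∀ x, ‖a x - 1‖ ≤ ‖a‖ * (1 / 4) := fun x => by
    rw [hax x, add_sub_cancel_left]
    exact (norm_jostOp_le hk a.norm_coe_le_norm x).trans
      (mul_le_mul_of_nonneg_left hsm (norm_nonneg _))
  have hn : ‖a‖ ≤ 4 / 3 := by
    have : ‖a‖ ≤ 1 + ‖a‖ * (1 / 4) := by
      rw [BoundedContinuousFunction.norm_le (by positivity)]
      intro x
      calc ‖a x‖ = ‖1 + (a x - 1)‖ := by ring_nf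
        _ ≤ ‖(1 : ℂ)‖ + ‖a x - 1‖ := norm_add_le _ _
        _ ≤ _ := by simpa using hq x
    linarith
  exact ⟨a, a.continuous, fun x => (hq x).trans (by linarith), hax⟩

open Classical in
/-- The first component of the Jost solution `exp(-k x) (a, b)` that is normalised at `+∞`. -/
def jostA (k : ℝ) (P R : 𝓢(ℝ, ℂ)) : ℝ → ℂ :=
  if h : Small k P R then (exists_jost h).choose else 1

/-- The second component of the Jost solution `exp(-k x) (a, b)` that is normalised at `+∞`. -/
def jostB (k : ℝ) (P R : 𝓢(ℝ, ℂ)) (x : ℝ) : ℂ := -jostInner k R (jostA k P R) x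

/-- The first component of the Jost solution `exp(k x) (c, d)` that is normalised at `-∞`. -/
def jostC (k : ℝ) (P R : 𝓢(ℝ, ℂ)) (x : ℝ) : ℂ := -jostB k (refl R) (refl P) (-x)

/-- The second component of the Jost solution `exp(k x) (c, d)` that is normalised at `-∞`. -/
def jostD (k : ℝ) (P R : 𝓢(ℝ, ℂ)) (x : ℝ) : ℂ := jostA k (refl R) (refl P) (-x)

/-- The supremum bound of the small components of the Jost solutions. -/
def jostBound (k : ℝ) (P R : 𝓢(ℝ, ℂ)) : ℝ := (supNorm P + supNorm R) * (4 / 3) / (2 * k)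

theorem norm_le_of_norm_sub_one_le {z : ℂ} (h : ‖z - 1‖ ≤ 1 / 3) : ‖z‖ ≤ 4 / 3 := by
  calc ‖z‖ = ‖1 + (z - 1)‖ := by ring_nf
    _ ≤ ‖(1 : ℂ)‖ + ‖z - 1‖ := norm_add_le _ _
    _ ≤ _ := by rw [norm_one]; linarith

theorem ne_zero_of_norm_sub_one_le {z : ℂ} (h : ‖z - 1‖ ≤ 1 / 3) : z ≠ 0 := by
  rintro rfl
  norm_num at h

theorem jostA_spec {k : ℝ} {P R : 𝓢(ℝ, ℂ)} (h : Small k P R) :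
    Continuous (jostA k P R) ∧ (∀ x, ‖jostA k P R x - 1‖ ≤ 1 / 3) ∧
    ∀ x, jostA k P R x = 1 + jostOp k P R (jostA k P R) x := by
  have := (exists_jost h).choose_spec
  simpa [jostA, h] using this

section JostProperties

variable {k : ℝ} {P R : 𝓢(ℝ, ℂ)}

theorem norm_jostA_sub_one_le (h : Small k P R) (x : ℝ) : ‖jostA k P R x - 1‖ ≤ 1 / 3 :=
  (jostA_spec h).2.1 x

theorem norm_jostD_sub_one_le (h : Small k P R) (x : ℝ) : ‖jostD k P R x - 1‖ ≤ 1 / 3 :=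
  (jostA_spec h.refl).2.1 (-x)

theorem norm_jostA_le (h : Small k P R) (x : ℝ) : ‖jostA k P R x‖ ≤ 4 / 3 :=
  norm_le_of_norm_sub_one_le (norm_jostA_sub_one_le h x)

theorem norm_jostD_le (h : Small k P R) (x : ℝ) : ‖jostD k P R x‖ ≤ 4 / 3 :=
  norm_le_of_norm_sub_one_le (norm_jostD_sub_one_le h x)

theorem jostA_ne_zero (h : Small k P R) (x : ℝ) : jostA k P R x ≠ 0 :=
  ne_zero_of_norm_sub_one_le (norm_jostA_sub_one_le h x)

theorem jostD_ne_zero (h : Small k P R) (x : ℝ) : jostD k P R x ≠ 0 :=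
  ne_zero_of_norm_sub_one_le (norm_jostD_sub_one_le h x)

theorem jostBound_nonneg (h : Small k P R) : 0 ≤ jostBound k P R := by
  have := h.pos
  have := supNorm_nonneg P
  have := supNorm_nonneg R
  unfold jostBound
  positivity

theorem norm_jostB_le (h : Small k P R) (x : ℝ) : ‖jostB k P R x‖ ≤ jostBound k P R := by
  have hk := h.pos
  rw [jostB, norm_neg]
  refine (norm_jostInner_le hk (norm_jostA_le h) x).trans ?_
  unfold jostBound
  have := supNorm_nonneg P
  gcongr
  linarith

theorem norm_jostC_le (h : Small k P R) (x : ℝ) : ‖jostC k P R x‖ ≤ jostBound k P R := by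
  rw [jostC, norm_neg]
  refine (norm_jostB_le h.refl _).trans (le_of_eq ?_)
  simp [jostBound, add_comm]

theorem hasDerivAt_jostA (h : Small k P R) (x : ℝ) :
    HasDerivAt (jostA k P R) (P x * jostB k P R x) x := by
  have hs := jostA_spec h
  have h1 := (hasDerivAt_jostOp (P := P) (R := R) h.pos hs.1 (norm_jostA_le h) x).const_add 1
  refine (h1.congr_of_eventuallyEq (Eventually.of_forall hs.2.2)).congr_deriv ?_
  rw [jostB]
  ring

theorem hasDerivAt_jostB (h : Small k P R) (x : ℝ) :
    HasDerivAt (jostB k P R) (2 * k * jostB k P R x + R x * jostA k P R x) x := by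
  have h1 := (hasDerivAt_jostInner (R := R) h.pos (jostA_spec h).1 (norm_jostA_le h) x).neg
  refine h1.congr_deriv ?_
  rw [jostB]
  ring

theorem hasDerivAt_jostC (h : Small k P R) (x : ℝ) :
    HasDerivAt (jostC k P R) (-(2 * k) * jostC k P R x + P x * jostD k P R x) x := by
  have h1 := ((hasDerivAt_jostB h.refl (-x)).scomp x (hasDerivAt_neg x)).neg
  refine h1.congr_deriv ?_
  simp [jostC, jostD, add_comm]

theorem hasDerivAt_jostD (h : Small k P R) (x : ℝ) :
    HasDerivAt (jostD k P R) (R x * jostC k P R x) x := by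
  have h1 := (hasDerivAt_jostA h.refl (-x)).scomp x (hasDerivAt_neg x)
  refine h1.congr_deriv ?_
  simp [jostC]

theorem continuous_jostA (h : Small k P R) : Continuous (jostA k P R) := (jostA_spec h).1

theorem continuous_jostB (h : Small k P R) : Continuous (jostB k P R) :=
  continuous_iff_continuousAt.2 fun x => (hasDerivAt_jostB h x).continuousAt

theorem continuous_jostC (h : Small k P R) : Continuous (jostC k P R) :=
  (continuous_jostB h.refl).comp continuous_neg |>.neg

theorem continuous_jostD (h : Small k P R) : Continuous (jostD k P R) :=
  (continuous_jostA h.refl).comp continuous_neg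

theorem tendsto_jostA (h : Small k P R) : Tendsto (jostA k P R) atTop (𝓝 1) := by
  have h1 := (tendsto_rint_zero_atTop
    (fun y => P y * jostInner k R (jostA k P R) y)).const_add (1 : ℂ)
  rw [add_zero] at h1
  exact h1.congr fun x => ((jostA_spec h).2.2 x).symm

theorem tendsto_schwartz_atTop (P : 𝓢(ℝ, ℂ)) : Tendsto P atTop (𝓝 0) :=
  P.tendsto_cocompact.mono_left atTop_le_cocompact

theorem tendsto_jostB (h : Small k P R) : Tendsto (jostB k P R) atTop (𝓝 0) := by
  have hk := h.pos
  have h0 : Tendsto (fun z => R z * jostA k P R z) atTop (𝓝 0) := by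
    have := (tendsto_schwartz_atTop R).mul (tendsto_jostA h)
    rwa [zero_mul] at this
  have h1 := (tendsto_rint_atTop (k := 2 * k) (by positivity) h0).neg
  rwa [neg_zero] at h1

theorem tendsto_jostC (h : Small k P R) : Tendsto (jostC k P R) atBot (𝓝 0) := by
  have := ((tendsto_jostB h.refl).comp tendsto_neg_atBot_atTop).neg
  rwa [neg_zero] at this

theorem tendsto_jostD (h : Small k P R) : Tendsto (jostD k P R) atBot (𝓝 1) :=
  (tendsto_jostA h.refl).comp tendsto_neg_atBot_atTop

theorem contDiff_jostA_jostB (h : Small k P R) (n : ℕ) :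
    ContDiff ℝ n (jostA k P R) ∧ ContDiff ℝ n (jostB k P R) := by
  induction n with
  | zero =>
    simp only [Nat.cast_zero, contDiff_zero]
    exact ⟨continuous_jostA h, continuous_jostB h⟩
  | succ n ih =>
    have hP : ContDiff ℝ n P := P.smooth n
    have hR : ContDiff ℝ n R := R.smooth n
    have hA := fun x => hasDerivAt_jostA h x
    have hB := fun x => hasDerivAt_jostB h x
    push_cast
    rw [contDiff_succ_iff_deriv, contDiff_succ_iff_deriv]
    refine ⟨⟨fun x => (hA x).differentiableAt, by simp, ?_⟩,
      ⟨fun x => (hB x).differentiableAt, by simp, ?_⟩⟩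
    · rw [funext fun x => (hA x).deriv]
      exact hP.mul ih.2
    · rw [funext fun x => (hB x).deriv]
      exact (contDiff_const.mul ih.2).add (hR.mul ih.1)

theorem contDiff_jostA (h : Small k P R) : ContDiff ℝ (⊤ : ℕ∞) (jostA k P R) :=
  contDiff_infty.2 fun n => (contDiff_jostA_jostB h n).1

theorem contDiff_jostB (h : Small k P R) : ContDiff ℝ (⊤ : ℕ∞) (jostB k P R) :=
  contDiff_infty.2 fun n => (contDiff_jostA_jostB h n).2

theorem contDiff_jostC (h : Small k P R) : ContDiff ℝ (⊤ : ℕ∞) (jostC k P R) :=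
  ((contDiff_jostB h.refl).comp contDiff_neg).neg

theorem contDiff_jostD (h : Small k P R) : ContDiff ℝ (⊤ : ℕ∞) (jostD k P R) :=
  (contDiff_jostA h.refl).comp contDiff_neg

/-! ### The Wronskian -/

/-- The Wronskian of the two Jost solutions. -/
def wronskian (k : ℝ) (P R : 𝓢(ℝ, ℂ)) : ℂ :=
  jostA k P R 0 * jostD k P R 0 - jostB k P R 0 * jostC k P R 0

theorem wronskian_eq (h : Small k P R) (x : ℝ) :
    jostA k P R x * jostD k P R x - jostB k P R x * jostC k P R x = wronskian k P R := by
  have hd : ∀ x, HasDerivAt (fun x => jostA k P R x * jostD k P R x - jostB k P R x * jostC k P R x)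
      0 x := fun x => by
    refine (((hasDerivAt_jostA h x).mul (hasDerivAt_jostD h x)).sub
      ((hasDerivAt_jostB h x).mul (hasDerivAt_jostC h x))).congr_deriv ?_
    ring
  exact is_const_of_deriv_eq_zero (fun y => (hd y).differentiableAt) (fun y => (hd y).deriv) x 0

theorem tendsto_mul_jostC (h : Small k P R) :
    Tendsto (fun x => jostB k P R x * jostC k P R x) atBot (𝓝 0) := by
  refine (tendsto_jostC h).zero_mul_isBoundedUnder_le ?_ |>.congr fun x => mul_comm _ _
  exact isBoundedUnder_of ⟨jostBound k P R, fun x => norm_jostB_le h x⟩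

/-- The first component of the right Jost solution tends to the Wronskian at `-∞`. -/
theorem tendsto_jostA_atBot (h : Small k P R) :
    Tendsto (jostA k P R) atBot (𝓝 (wronskian k P R)) := by
  have h1 := ((tendsto_const_nhds (x := wronskian k P R)).add (tendsto_mul_jostC h)).div
    (tendsto_jostD h) one_ne_zero
  rw [add_zero, div_one] at h1
  refine h1.congr fun x => ?_
  simp only [Pi.div_apply]
  rw [← wronskian_eq h x, sub_add_cancel, mul_div_cancel_right₀ _ (jostD_ne_zero h x)]

theorem norm_wronskian_sub_one_le (h : Small k P R) : ‖wronskian k P R - 1‖ ≤ 1 / 3 :=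
  le_of_tendsto ((tendsto_jostA_atBot h).sub_const 1).norm
    (Eventually.of_forall fun x => norm_jostA_sub_one_le h x)

theorem wronskian_ne_zero (h : Small k P R) : wronskian k P R ≠ 0 :=
  ne_zero_of_norm_sub_one_le (norm_wronskian_sub_one_le h)

theorem wronskian_mem_slitPlane (h : Small k P R) : wronskian k P R ∈ Complex.slitPlane := by
  left
  have h1 := (Complex.abs_re_le_norm _).trans (norm_wronskian_sub_one_le h)
  rw [abs_le, Complex.sub_re, Complex.one_re] at h1
  linarith

theorem wronskian_refl (k : ℝ) (P R : 𝓢(ℝ, ℂ)) : wronskian k (refl R) (refl P) = wronskian k P R := by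
  simp only [wronskian, jostC, jostD, refl_refl, neg_zero]
  ring

theorem tendsto_jostD_atTop (h : Small k P R) :
    Tendsto (jostD k P R) atTop (𝓝 (wronskian k P R)) := by
  rw [← wronskian_refl k P R]
  exact (tendsto_jostA_atBot h.refl).comp tendsto_neg_atTop_atBot

end JostProperties

/-! ### Continuity of the Jost solutions in the potentials -/

theorem norm_le_of_contraction {w : ℝ → ℂ} {M₀ e : ℝ} (h0 : ∀ x, ‖w x‖ ≤ M₀)
    (h : ∀ M, (∀ x, ‖w x‖ ≤ M) → ∀ x, ‖w x‖ ≤ M / 4 + e) (x : ℝ) : ‖w x‖ ≤ 4 / 3 * e := by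
  have hb : BddAbove (Set.range fun x => ‖w x‖) := ⟨M₀, by rintro _ ⟨x, rfl⟩; exact h0 x⟩
  have h1 : ∀ x, ‖w x‖ ≤ ⨆ x, ‖w x‖ := fun x => le_ciSup hb x
  have h2 := ciSup_le (h _ h1)
  linarith [h1 x]

/-- Smallness gives the contraction constant `1/4`. -/
theorem Small.div_le {k : ℝ} {P R : 𝓢(ℝ, ℂ)} (h : Small k P R) :
    (l2sq P + l2sq R) / (4 * k) ≤ 1 / 4 := by
  have := h.pos
  rw [div_le_div_iff₀ (by positivity) (by norm_num)]
  linarith [h.2]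

theorem norm_jostA_sub_le {k : ℝ} {P₁ P₂ R₁ R₂ : 𝓢(ℝ, ℂ)} (h₁ : Small k P₁ R₁)
    (h₂ : Small k P₂ R₂) (x : ℝ) :
    ‖jostA k P₁ R₁ x - jostA k P₂ R₂ x‖ ≤ 4 / 3 *
      ((∫ y, ‖P₁ y‖) * (supNorm (R₁ - R₂) * (4 / 3) / (2 * k))
        + (∫ y, ‖(P₁ - P₂) y‖) * (supNorm R₂ * (4 / 3) / (2 * k))) := by
  have hk := h₁.pos
  refine norm_le_of_contraction (w := fun x => jostA k P₁ R₁ x - jostA k P₂ R₂ x)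
    (M₀ := 4 / 3 + 4 / 3) (fun x => (norm_sub_le _ _).trans
      (add_le_add (norm_jostA_le h₁ x) (norm_jostA_le h₂ x))) (fun M hM x => ?_) x
  have h := jostOp_sub (P₁ := P₁) (P₂ := P₂) (R₁ := R₁) (R₂ := R₂) hk (continuous_jostA h₁)
    (norm_jostA_le h₁) (continuous_jostA h₂) (norm_jostA_le h₂) x
  have e : jostA k P₁ R₁ x - jostA k P₂ R₂ x = jostOp k P₁ R₁ (jostA k P₁ R₁) x
      - jostOp k P₂ R₂ (jostA k P₂ R₂) x := by
    rw [(jostA_spec h₁).2.2 x, (jostA_spec h₂).2.2 x]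
    ring
  rw [e, h]
  refine (norm_add_le _ _).trans (add_le_add ?_ ((norm_add_le _ _).trans (add_le_add ?_ ?_)))
  · refine (norm_jostOp_le hk hM x).trans ?_
    have hM0 : 0 ≤ M := (norm_nonneg _).trans (hM 0)
    have := mul_le_mul_of_nonneg_left h₁.div_le hM0
    linarith
  · exact norm_jostOp_le' hk (norm_jostA_le h₂) x
  · exact norm_jostOp_le' hk (norm_jostA_le h₂) x

section Limits

variable {ι : Type*} {l : Filter ι} {k : ℝ} {F G : ι → 𝓢(ℝ, ℂ)} {P R : 𝓢(ℝ, ℂ)}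

/-- The bound of `norm_jostA_sub_le` tends to zero. -/
theorem tendsto_jost_error (hF : Tendsto F l (𝓝 P)) (hG : Tendsto G l (𝓝 R)) :
    Tendsto (fun τ => 4 / 3 * ((∫ y, ‖F τ y‖) * (supNorm (G τ - R) * (4 / 3) / (2 * k))
        + (∫ y, ‖(F τ - P) y‖) * (supNorm R * (4 / 3) / (2 * k)))) l (𝓝 0) := by
  have h1 := (continuous_integral_norm.tendsto P).comp hF
  have h2 : Tendsto (fun τ => supNorm (G τ - R)) l (𝓝 0) := by
    have := (continuous_supNorm.tendsto _).comp (hG.sub_const R)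
    simpa [supNorm, Function.comp_def] using this
  have h3 : Tendsto (fun τ => ∫ y, ‖(F τ - P) y‖) l (𝓝 0) := by
    have := (continuous_integral_norm.tendsto _).comp (hF.sub_const P)
    simpa [Function.comp_def] using this
  have h4 := ((h1.mul ((h2.mul_const (4 / 3 : ℝ)).div_const (2 * k))).add
    (h3.mul_const (supNorm R * (4 / 3) / (2 * k)))).const_mul (4 / 3 : ℝ)
  simpa using h4

theorem tendsto_jostA_of_tendsto (hF : Tendsto F l (𝓝 P)) (hG : Tendsto G l (𝓝 R))
    (hs : ∀ᶠ τ in l, Small k (F τ) (G τ)) (h : Small k P R) (x : ℝ) :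
    Tendsto (fun τ => jostA k (F τ) (G τ) x) l (𝓝 (jostA k P R x)) := by
  rw [tendsto_iff_norm_sub_tendsto_zero]
  exact squeeze_zero' (Eventually.of_forall fun τ => norm_nonneg _)
    (hs.mono fun τ hτ => norm_jostA_sub_le hτ h x) (tendsto_jost_error hF hG)

theorem tendsto_jostB_of_tendsto (hF : Tendsto F l (𝓝 P)) (hG : Tendsto G l (𝓝 R))
    (hs : ∀ᶠ τ in l, Small k (F τ) (G τ)) (h : Small k P R) (x : ℝ) :
    Tendsto (fun τ => jostB k (F τ) (G τ) x) l (𝓝 (jostB k P R x)) := by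
  rw [tendsto_iff_norm_sub_tendsto_zero]
  have hk := h.pos
  have h1 := (((continuous_supNorm.tendsto R).comp hG).mul
    (tendsto_jost_error (k := k) hF hG)).div_const (2 * k)
  have h2 : Tendsto (fun τ => supNorm (G τ - R)) l (𝓝 0) := by
    have := (continuous_supNorm.tendsto _).comp (hG.sub_const R)
    simpa [supNorm, Function.comp_def] using this
  have h3 := h1.add ((h2.mul_const (4 / 3 : ℝ)).div_const (2 * k))
  rw [mul_zero, zero_mul, zero_div, add_zero] at h3
  refine squeeze_zero' (Eventually.of_forall fun τ => norm_nonneg _) (hs.mono fun τ hτ => ?_) h3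
  have e := jostInner_sub (R₁ := G τ) (R₂ := R) hk (continuous_jostA hτ) (norm_jostA_le hτ)
    (continuous_jostA h) (norm_jostA_le h) x
  rw [jostB, jostB, neg_sub_neg, norm_sub_rev, e]
  exact (norm_add_le _ _).trans (add_le_add
    (norm_jostInner_le hk (fun x => norm_jostA_sub_le hτ h x) x)
    (norm_jostInner_le hk (norm_jostA_le h) x))

theorem tendsto_refl (hF : Tendsto F l (𝓝 P)) :
    Tendsto (fun τ => refl (F τ)) l (𝓝 (refl P)) :=
  (refl.continuous.tendsto P).comp hF

theorem tendsto_jostC_of_tendsto (hF : Tendsto F l (𝓝 P)) (hG : Tendsto G l (𝓝 R))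
    (hs : ∀ᶠ τ in l, Small k (F τ) (G τ)) (h : Small k P R) (x : ℝ) :
    Tendsto (fun τ => jostC k (F τ) (G τ) x) l (𝓝 (jostC k P R x)) :=
  (tendsto_jostB_of_tendsto (tendsto_refl hG) (tendsto_refl hF)
    (hs.mono fun _ hτ => hτ.refl) h.refl (-x)).neg

theorem tendsto_jostD_of_tendsto (hF : Tendsto F l (𝓝 P)) (hG : Tendsto G l (𝓝 R))
    (hs : ∀ᶠ τ in l, Small k (F τ) (G τ)) (h : Small k P R) (x : ℝ) :
    Tendsto (fun τ => jostD k (F τ) (G τ) x) l (𝓝 (jostD k P R x)) :=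
  tendsto_jostA_of_tendsto (tendsto_refl hG) (tendsto_refl hF)
    (hs.mono fun _ hτ => hτ.refl) h.refl (-x)

theorem tendsto_wronskian_of_tendsto (hF : Tendsto F l (𝓝 P)) (hG : Tendsto G l (𝓝 R))
    (hs : ∀ᶠ τ in l, Small k (F τ) (G τ)) (h : Small k P R) :
    Tendsto (fun τ => wronskian k (F τ) (G τ)) l (𝓝 (wronskian k P R)) :=
  ((tendsto_jostA_of_tendsto hF hG hs h 0).mul (tendsto_jostD_of_tendsto hF hG hs h 0)).sub
    ((tendsto_jostB_of_tendsto hF hG hs h 0).mul (tendsto_jostC_of_tendsto hF hG hs h 0))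

theorem eventually_jostBound_le (hF : Tendsto F l (𝓝 P)) (hG : Tendsto G l (𝓝 R)) :
    ∀ᶠ τ in l, jostBound k (F τ) (G τ) ≤ jostBound k P R + 1 := by
  have h1 := (((((continuous_supNorm.tendsto P).comp hF).add
    ((continuous_supNorm.tendsto R).comp hG)).mul_const (4 / 3 : ℝ)).div_const (2 * k))
  exact (h1.eventually_lt_const (lt_add_one _)).mono fun τ hτ => le_of_lt hτ

end Limits

/-! ### Comparison of two pairs of potentials -/

section Comparison

variable {k : ℝ} {P₁ P₂ R₁ R₂ : 𝓢(ℝ, ℂ)}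

theorem norm_mul_mul_le {p u v : ℂ} {p' u' v' : ℝ} (hp : ‖p‖ ≤ p') (hu : ‖u‖ ≤ u')
    (hv : ‖v‖ ≤ v') : ‖p * (u * v)‖ ≤ p' * (u' * v') := by
  have := (norm_nonneg _).trans hp
  have := (norm_nonneg _).trans hu
  rw [norm_mul, norm_mul]
  gcongr

theorem integrable_schwartz_mul (P : 𝓢(ℝ, ℂ)) {u v : ℝ → ℂ} {u' v' : ℝ} (hu : Continuous u)
    (hv : Continuous v) (hu' : ∀ x, ‖u x‖ ≤ u') (hv' : ∀ x, ‖v x‖ ≤ v') :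
    Integrable fun x => P x * (u x * v x) :=
  P.integrable.mul_bdd (c := u' * v') (hu.mul hv).aestronglyMeasurable
    (Eventually.of_forall fun x => by
      rw [norm_mul]
      exact mul_le_mul (hu' x) (hv' x) (norm_nonneg _) ((norm_nonneg _).trans (hu' x)))

theorem wronskian_sub (h₁ : Small k P₁ R₁) (h₂ : Small k P₂ R₂) :
    wronskian k P₂ R₂ - wronskian k P₁ R₁
      = ∫ x, ((P₁ - P₂) x * (jostB k P₁ R₁ x * jostD k P₂ R₂ x)
          - (R₁ - R₂) x * (jostA k P₁ R₁ x * jostC k P₂ R₂ x)) := by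
  symm
  refine integral_of_hasDerivAt_of_tendsto
    (f := fun x => jostA k P₁ R₁ x * jostD k P₂ R₂ x - jostB k P₁ R₁ x * jostC k P₂ R₂ x)
    (fun x => ?_) ?_ ?_ ?_
  · refine (((hasDerivAt_jostA h₁ x).mul (hasDerivAt_jostD h₂ x)).sub
      ((hasDerivAt_jostB h₁ x).mul (hasDerivAt_jostC h₂ x))).congr_deriv ?_
    simp only [sub_apply]
    ring
  · exact (integrable_schwartz_mul _ (continuous_jostB h₁) (continuous_jostD h₂) (norm_jostB_le h₁)
      (norm_jostD_le h₂)).sub (integrable_schwartz_mul _ (continuous_jostA h₁)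
      (continuous_jostC h₂) (norm_jostA_le h₁) (norm_jostC_le h₂))
  · have e : Tendsto (fun x => jostB k P₁ R₁ x * jostC k P₂ R₂ x) atBot (𝓝 0) := by
      refine (tendsto_jostC h₂).zero_mul_isBoundedUnder_le ?_ |>.congr fun x => mul_comm _ _
      exact isBoundedUnder_of ⟨jostBound k P₁ R₁, fun x => norm_jostB_le h₁ x⟩
    have := ((tendsto_jostA_atBot h₁).mul (tendsto_jostD h₂)).sub e
    simpa using this
  · have e : Tendsto (fun x => jostB k P₁ R₁ x * jostC k P₂ R₂ x) atTop (𝓝 0) := by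
      refine (tendsto_jostB h₁).zero_mul_isBoundedUnder_le ?_
      exact isBoundedUnder_of ⟨jostBound k P₂ R₂, fun x => norm_jostC_le h₂ x⟩
    have := ((tendsto_jostA h₁).mul (tendsto_jostD_atTop h₂)).sub e
    simpa using this

theorem jost_left_sub (h₁ : Small k P₁ R₁) (h₂ : Small k P₂ R₂) (x : ℝ) :
    jostC k P₁ R₁ x * jostD k P₂ R₂ x - jostD k P₁ R₁ x * jostC k P₂ R₂ x
      = lint (2 * k) (fun y => (P₁ - P₂) y * (jostD k P₁ R₁ y * jostD k P₂ R₂ y)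
          - (R₁ - R₂) y * (jostC k P₁ R₁ y * jostC k P₂ R₂ y)) x := by
  have hk := h₁.pos
  have := continuous_jostC h₁
  have := continuous_jostC h₂
  have := continuous_jostD h₁
  have := continuous_jostD h₂
  have := (P₁ - P₂).continuous
  have := (R₁ - R₂).continuous
  refine eq_lint_of_hasDerivAt (k := 2 * k)
    (X := fun x => jostC k P₁ R₁ x * jostD k P₂ R₂ x - jostD k P₁ R₁ x * jostC k P₂ R₂ x)
    (by positivity) (by fun_prop)
    (fun y => (norm_sub_le _ _).trans (add_le_add
      (norm_mul_mul_le (norm_le_supNorm _ y) (norm_jostD_le h₁ y) (norm_jostD_le h₂ y))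
      (norm_mul_mul_le (norm_le_supNorm _ y) (norm_jostC_le h₁ y) (norm_jostC_le h₂ y))))
    (N := jostBound k P₁ R₁ * (4 / 3) + 4 / 3 * jostBound k P₂ R₂)
    (fun y => (norm_sub_le _ _).trans (add_le_add ?_ ?_)) (fun y => ?_) x
  · rw [norm_mul]
    exact mul_le_mul (norm_jostC_le h₁ y) (norm_jostD_le h₂ y) (norm_nonneg _)
      (jostBound_nonneg h₁)
  · rw [norm_mul]
    exact mul_le_mul (norm_jostD_le h₁ y) (norm_jostC_le h₂ y) (norm_nonneg _) (by norm_num)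
  · refine (((hasDerivAt_jostC h₁ y).mul (hasDerivAt_jostD h₂ y)).sub
      ((hasDerivAt_jostD h₁ y).mul (hasDerivAt_jostC h₂ y))).congr_deriv ?_
    simp only [sub_apply, Complex.real_smul, Complex.ofReal_mul, Complex.ofReal_ofNat]
    ring

theorem jost_right_sub (h₁ : Small k P₁ R₁) (h₂ : Small k P₂ R₂) (x : ℝ) :
    jostB k P₁ R₁ x * jostA k P₂ R₂ x - jostA k P₁ R₁ x * jostB k P₂ R₂ x
      = rint (2 * k) (fun y => (P₁ - P₂) y * (jostB k P₁ R₁ y * jostB k P₂ R₂ y)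
          - (R₁ - R₂) y * (jostA k P₁ R₁ y * jostA k P₂ R₂ y)) x := by
  have hk := h₁.pos
  have := continuous_jostA h₁
  have := continuous_jostA h₂
  have := continuous_jostB h₁
  have := continuous_jostB h₂
  have := (P₁ - P₂).continuous
  have := (R₁ - R₂).continuous
  refine eq_rint_of_hasDerivAt (k := 2 * k)
    (X := fun x => jostB k P₁ R₁ x * jostA k P₂ R₂ x - jostA k P₁ R₁ x * jostB k P₂ R₂ x)
    (by positivity) (by fun_prop)
    (fun y => (norm_sub_le _ _).trans (add_le_add
      (norm_mul_mul_le (norm_le_supNorm _ y) (norm_jostB_le h₁ y) (norm_jostB_le h₂ y))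
      (norm_mul_mul_le (norm_le_supNorm _ y) (norm_jostA_le h₁ y) (norm_jostA_le h₂ y))))
    (N := jostBound k P₁ R₁ * (4 / 3) + 4 / 3 * jostBound k P₂ R₂)
    (fun y => (norm_sub_le _ _).trans (add_le_add ?_ ?_)) (fun y => ?_) x
  · rw [norm_mul]
    exact mul_le_mul (norm_jostB_le h₁ y) (norm_jostA_le h₂ y) (norm_nonneg _)
      (jostBound_nonneg h₁)
  · rw [norm_mul]
    exact mul_le_mul (norm_jostA_le h₁ y) (norm_jostB_le h₂ y) (norm_nonneg _) (by norm_num)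
  · refine (((hasDerivAt_jostB h₁ y).mul (hasDerivAt_jostA h₂ y)).sub
      ((hasDerivAt_jostA h₁ y).mul (hasDerivAt_jostB h₂ y))).congr_deriv ?_
    simp only [sub_apply, Complex.real_smul, Complex.ofReal_mul, Complex.ofReal_ofNat]
    ring

end Comparison

/-! ### Derivatives along curves of potentials -/

theorem HasTimeDeriv.tendsto {f : ℝ → 𝓢(ℝ, ℂ)} {w : 𝓢(ℝ, ℂ)} {t : ℝ} (h : HasTimeDeriv f w t) :
    Tendsto f (𝓝[≠] t) (𝓝 (f t)) := by
  have h1 : Tendsto (fun τ : ℝ => τ - t) (𝓝[≠] t) (𝓝 0) := by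
    have : Tendsto (fun τ : ℝ => τ - t) (𝓝 t) (𝓝 (t - t)) := (continuous_sub_right t).tendsto t
    rw [sub_self] at this
    exact this.mono_left nhdsWithin_le_nhds
  have h2 := (h1.smul h).add_const (f t)
  rw [zero_smul, zero_add] at h2
  refine h2.congr' ?_
  filter_upwards [self_mem_nhdsWithin] with τ hτ
  rw [smul_smul, mul_inv_cancel₀ (sub_ne_zero.2 hτ), one_smul, sub_add_cancel]

theorem HasTimeDeriv.map {f : ℝ → 𝓢(ℝ, ℂ)} {w : 𝓢(ℝ, ℂ)} {t : ℝ} (h : HasTimeDeriv f w t)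
    (T : 𝓢(ℝ, ℂ) →L[ℂ] 𝓢(ℝ, ℂ)) : HasTimeDeriv (fun τ => T (f τ)) (T w) t := by
  refine ((T.continuous.tendsto w).comp h).congr fun τ => ?_
  have : T ((τ - t)⁻¹ • (f τ - f t)) = (τ - t)⁻¹ • T (f τ - f t) :=
    (T.restrictScalars ℝ).map_smul _ _
  simp only [Function.comp_def, this, map_sub]

theorem HasTimeDeriv.hasDerivAt_eval {f : ℝ → 𝓢(ℝ, ℂ)} {w : 𝓢(ℝ, ℂ)} {t : ℝ}
    (h : HasTimeDeriv f w t) (x : ℝ) : HasDerivAt (fun τ => f τ x) (w x) t := by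
  rw [hasDerivAt_iff_tendsto_slope]
  refine (((continuous_eval x).tendsto w).comp h).congr fun τ => ?_
  simp [slope]

theorem hasTimeDeriv_affine (P f : 𝓢(ℝ, ℂ)) (t : ℝ) :
    HasTimeDeriv (fun τ => P + τ • f) f t := by
  refine tendsto_const_nhds.congr' ?_
  filter_upwards [self_mem_nhdsWithin] with τ hτ
  rw [add_sub_add_left_eq_sub, ← sub_smul, smul_smul, inv_mul_cancel₀ (sub_ne_zero.2 hτ), one_smul]

theorem integrable_dominating (C : ℝ) : Integrable fun x : ℝ => C * (1 + x ^ 2)⁻¹ :=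
  integrable_inv_one_add_sq.const_mul C

theorem dominating_le {C : ℝ} (hC : 0 ≤ C) (x : ℝ) : C * (1 + x ^ 2)⁻¹ ≤ C := by
  have : (1 + x ^ 2)⁻¹ ≤ 1 := inv_le_one_of_one_le₀ (by nlinarith)
  nlinarith

theorem tendsto_rint_of_dominated {ι : Type*} {l : Filter ι} [l.IsCountablyGenerated] {k M : ℝ}
    (hk : 0 < k) {f : ι → ℝ → ℂ} {f₀ : ℝ → ℂ}
    (hf : ∀ᶠ τ in l, Continuous (f τ) ∧ ∀ y, ‖f τ y‖ ≤ M)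
    (ht : ∀ y, Tendsto (fun τ => f τ y) l (𝓝 (f₀ y))) (x : ℝ) :
    Tendsto (fun τ => rint k (f τ) x) l (𝓝 (rint k f₀ x)) := by
  unfold rint
  refine tendsto_integral_filter_of_dominated_convergence
    (fun y => Real.exp (-(k * (y - x))) * M) ?_ ?_ ((integrableOn_exp_decay hk x).mul_const M) ?_
  · filter_upwards [hf] with τ hτ
    have := hτ.1
    exact Continuous.aestronglyMeasurable (by fun_prop)
  · filter_upwards [hf] with τ hτ
    refine Eventually.of_forall fun y => ?_
    rw [norm_smul, Real.norm_of_nonneg (Real.exp_nonneg _)]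
    exact mul_le_mul_of_nonneg_left (hτ.2 y) (Real.exp_nonneg _)
  · exact Eventually.of_forall fun y => (ht y).const_smul _

theorem tendsto_lint_of_dominated {ι : Type*} {l : Filter ι} [l.IsCountablyGenerated] {k M : ℝ}
    (hk : 0 < k) {f : ι → ℝ → ℂ} {f₀ : ℝ → ℂ}
    (hf : ∀ᶠ τ in l, Continuous (f τ) ∧ ∀ y, ‖f τ y‖ ≤ M)
    (ht : ∀ y, Tendsto (fun τ => f τ y) l (𝓝 (f₀ y))) (x : ℝ) :
    Tendsto (fun τ => lint k (f τ) x) l (𝓝 (lint k f₀ x)) :=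
  tendsto_rint_of_dominated hk (f := fun τ y => f τ (-y)) (f₀ := fun y => f₀ (-y))
    (hf.mono fun _ hτ => ⟨hτ.1.comp continuous_neg, fun y => hτ.2 (-y)⟩) (fun y => ht (-y)) (-x)

/-- A family of continuous functions that converges pointwise and is dominated by
`C (1 + x^2)⁻¹`. -/
structure DominatedLimit {ι : Type*} (l : Filter ι) (f : ι → ℝ → ℂ) (f₀ : ℝ → ℂ) : Prop where
  dominated : ∃ C, 0 ≤ C ∧ ∀ᶠ τ in l, Continuous (f τ) ∧ ∀ y, ‖f τ y‖ ≤ C * (1 + y ^ 2)⁻¹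
  tendsto : ∀ y, Tendsto (fun τ => f τ y) l (𝓝 (f₀ y))

namespace DominatedLimit

variable {ι : Type*} {l : Filter ι} {f g : ι → ℝ → ℂ} {f₀ g₀ : ℝ → ℂ}

theorem sub (hf : DominatedLimit l f f₀) (hg : DominatedLimit l g g₀) :
    DominatedLimit l (fun τ y => f τ y - g τ y) (fun y => f₀ y - g₀ y) := by
  obtain ⟨C, hC, h1⟩ := hf.dominated
  obtain ⟨D, hD, h2⟩ := hg.dominated
  refine ⟨⟨C + D, by positivity, ?_⟩, fun y => (hf.tendsto y).sub (hg.tendsto y)⟩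
  filter_upwards [h1, h2] with τ h1 h2
  refine ⟨h1.1.sub h2.1, fun y => (norm_sub_le _ _).trans ?_⟩
  rw [add_mul]
  exact add_le_add (h1.2 y) (h2.2 y)

theorem schwartz_mul {D : ι → 𝓢(ℝ, ℂ)} {D₀ : 𝓢(ℝ, ℂ)} (hD : Tendsto D l (𝓝 D₀))
    {u v : ι → ℝ → ℂ} {u₀ v₀ : ℝ → ℂ} {B B' : ℝ}
    (hu : ∀ᶠ τ in l, Continuous (u τ) ∧ ∀ y, ‖u τ y‖ ≤ B)
    (hv : ∀ᶠ τ in l, Continuous (v τ) ∧ ∀ y, ‖v τ y‖ ≤ B')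
    (hut : ∀ y, Tendsto (fun τ => u τ y) l (𝓝 (u₀ y)))
    (hvt : ∀ y, Tendsto (fun τ => v τ y) l (𝓝 (v₀ y))) :
    DominatedLimit l (fun τ y => D τ y * (u τ y * v τ y)) (fun y => D₀ y * (u₀ y * v₀ y)) := by
  obtain ⟨C, hC, h1⟩ := eventually_norm_le_of_tendsto hD
  refine ⟨⟨C * (|B| * |B'|), by positivity, ?_⟩, fun y =>
    (((continuous_eval y).tendsto D₀).comp hD).mul ((hut y).mul (hvt y))⟩
  filter_upwards [h1, hu, hv] with τ h1 hu hv
  refine ⟨(D τ).continuous.mul (hu.1.mul hv.1), fun y => ?_⟩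
  refine (norm_mul_mul_le (h1 y) ((hu.2 y).trans (le_abs_self B))
    ((hv.2 y).trans (le_abs_self B'))).trans (le_of_eq ?_)
  ring

theorem integral [l.IsCountablyGenerated] (hf : DominatedLimit l f f₀) :
    Tendsto (fun τ => ∫ y, f τ y) l (𝓝 (∫ y, f₀ y)) := by
  obtain ⟨C, -, h1⟩ := hf.dominated
  exact tendsto_integral_filter_of_dominated_convergence (fun y => C * (1 + y ^ 2)⁻¹)
    (h1.mono fun τ h => h.1.aestronglyMeasurable) (h1.mono fun τ h => Eventually.of_forall h.2)
    (integrable_dominating C) (Eventually.of_forall hf.tendsto)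

theorem rint [l.IsCountablyGenerated] (hf : DominatedLimit l f f₀) {k : ℝ} (hk : 0 < k) (x : ℝ) :
    Tendsto (fun τ => rint k (f τ) x) l (𝓝 (DNLS.rint k f₀ x)) := by
  obtain ⟨C, hC, h1⟩ := hf.dominated
  exact tendsto_rint_of_dominated hk
    (h1.mono fun τ h => ⟨h.1, fun y => (h.2 y).trans (dominating_le hC y)⟩) hf.tendsto x

theorem lint [l.IsCountablyGenerated] (hf : DominatedLimit l f f₀) {k : ℝ} (hk : 0 < k) (x : ℝ) :
    Tendsto (fun τ => lint k (f τ) x) l (𝓝 (DNLS.lint k f₀ x)) := by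
  obtain ⟨C, hC, h1⟩ := hf.dominated
  exact tendsto_lint_of_dominated hk
    (h1.mono fun τ h => ⟨h.1, fun y => (h.2 y).trans (dominating_le hC y)⟩) hf.tendsto x

end DominatedLimit

section Curves

variable {k t : ℝ} {P R : ℝ → 𝓢(ℝ, ℂ)} {Pd Rd : 𝓢(ℝ, ℂ)}

/-- A curve of small potentials, differentiable at time `t` in the Schwartz topology. -/
structure SmallCurve (k t : ℝ) (P R : ℝ → 𝓢(ℝ, ℂ)) (Pd Rd : 𝓢(ℝ, ℂ)) : Prop where
  left : HasTimeDeriv P Pd t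
  right : HasTimeDeriv R Rd t
  small : ∀ᶠ τ in 𝓝 t, Small k (P τ) (R τ)

namespace SmallCurve

theorem small_self (h : SmallCurve k t P R Pd Rd) : Small k (P t) (R t) := h.small.self_of_nhds

theorem small_punctured (h : SmallCurve k t P R Pd Rd) :
    ∀ᶠ τ in 𝓝[≠] t, Small k (P τ) (R τ) := h.small.filter_mono nhdsWithin_le_nhds

theorem tendsto_a (h : SmallCurve k t P R Pd Rd) (x : ℝ) :
    Tendsto (fun τ => jostA k (P τ) (R τ) x) (𝓝[≠] t) (𝓝 (jostA k (P t) (R t) x)) :=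
  tendsto_jostA_of_tendsto h.left.tendsto h.right.tendsto h.small_punctured h.small_self x

theorem tendsto_b (h : SmallCurve k t P R Pd Rd) (x : ℝ) :
    Tendsto (fun τ => jostB k (P τ) (R τ) x) (𝓝[≠] t) (𝓝 (jostB k (P t) (R t) x)) :=
  tendsto_jostB_of_tendsto h.left.tendsto h.right.tendsto h.small_punctured h.small_self x

theorem tendsto_c (h : SmallCurve k t P R Pd Rd) (x : ℝ) :
    Tendsto (fun τ => jostC k (P τ) (R τ) x) (𝓝[≠] t) (𝓝 (jostC k (P t) (R t) x)) :=
  tendsto_jostC_of_tendsto h.left.tendsto h.right.tendsto h.small_punctured h.small_self x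

theorem tendsto_d (h : SmallCurve k t P R Pd Rd) (x : ℝ) :
    Tendsto (fun τ => jostD k (P τ) (R τ) x) (𝓝[≠] t) (𝓝 (jostD k (P t) (R t) x)) :=
  tendsto_jostD_of_tendsto h.left.tendsto h.right.tendsto h.small_punctured h.small_self x

theorem tendsto_wronskian (h : SmallCurve k t P R Pd Rd) :
    Tendsto (fun τ => wronskian k (P τ) (R τ)) (𝓝[≠] t) (𝓝 (wronskian k (P t) (R t))) :=
  tendsto_wronskian_of_tendsto h.left.tendsto h.right.tendsto h.small_punctured h.small_self

theorem bound_a (h : SmallCurve k t P R Pd Rd) : ∀ᶠ τ in 𝓝[≠] t,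
    Continuous (jostA k (P τ) (R τ)) ∧ ∀ y, ‖jostA k (P τ) (R τ) y‖ ≤ 4 / 3 :=
  h.small_punctured.mono fun _ hτ => ⟨continuous_jostA hτ, norm_jostA_le hτ⟩

theorem bound_d (h : SmallCurve k t P R Pd Rd) : ∀ᶠ τ in 𝓝[≠] t,
    Continuous (jostD k (P τ) (R τ)) ∧ ∀ y, ‖jostD k (P τ) (R τ) y‖ ≤ 4 / 3 :=
  h.small_punctured.mono fun _ hτ => ⟨continuous_jostD hτ, norm_jostD_le hτ⟩

theorem bound_b (h : SmallCurve k t P R Pd Rd) : ∀ᶠ τ in 𝓝[≠] t,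
    Continuous (jostB k (P τ) (R τ)) ∧
      ∀ y, ‖jostB k (P τ) (R τ) y‖ ≤ jostBound k (P t) (R t) + 1 := by
  filter_upwards [h.small_punctured, eventually_jostBound_le h.left.tendsto h.right.tendsto]
    with τ h1 h2
  exact ⟨continuous_jostB h1, fun y => (norm_jostB_le h1 y).trans h2⟩

theorem bound_c (h : SmallCurve k t P R Pd Rd) : ∀ᶠ τ in 𝓝[≠] t,
    Continuous (jostC k (P τ) (R τ)) ∧
      ∀ y, ‖jostC k (P τ) (R τ) y‖ ≤ jostBound k (P t) (R t) + 1 := by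
  filter_upwards [h.small_punctured, eventually_jostBound_le h.left.tendsto h.right.tendsto]
    with τ h1 h2
  exact ⟨continuous_jostC h1, fun y => (norm_jostC_le h1 y).trans h2⟩

theorem hasDerivAt_wronskian (h : SmallCurve k t P R Pd Rd) :
    HasDerivAt (fun τ => wronskian k (P τ) (R τ))
      (-∫ x, (Pd x * (jostB k (P t) (R t) x * jostD k (P t) (R t) x)
          - Rd x * (jostA k (P t) (R t) x * jostC k (P t) (R t) x))) t := by
  have hs := h.small_self
  rw [hasDerivAt_iff_tendsto_slope]
  have hlim := (DominatedLimit.schwartz_mul h.left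
    (Eventually.of_forall fun _ => ⟨continuous_jostB hs, norm_jostB_le hs⟩) h.bound_d
    (fun y => tendsto_const_nhds) h.tendsto_d).sub (DominatedLimit.schwartz_mul h.right
    (Eventually.of_forall fun _ => ⟨continuous_jostA hs, norm_jostA_le hs⟩) h.bound_c
    (fun y => tendsto_const_nhds) h.tendsto_c)
  refine hlim.integral.neg.congr' ?_
  filter_upwards [h.small_punctured] with τ hτ
  rw [slope, vsub_eq_sub, wronskian_sub hs hτ, ← integral_smul, ← integral_neg]
  refine integral_congr_ae (Eventually.of_forall fun x => ?_)
  simp only [smul_apply, sub_apply, Complex.real_smul]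
  ring

theorem tendsto_left (h : SmallCurve k t P R Pd Rd) (x : ℝ) :
    Tendsto (fun τ => (τ - t)⁻¹ • (jostC k (P t) (R t) x * jostD k (P τ) (R τ) x
      - jostD k (P t) (R t) x * jostC k (P τ) (R τ) x)) (𝓝[≠] t)
      (𝓝 (-lint (2 * k) (fun y => Pd y * (jostD k (P t) (R t) y * jostD k (P t) (R t) y)
          - Rd y * (jostC k (P t) (R t) y * jostC k (P t) (R t) y)) x)) := by
  have hs := h.small_self
  have hk := hs.pos
  have hlim := (DominatedLimit.schwartz_mul h.left
    (Eventually.of_forall fun _ => ⟨continuous_jostD hs, norm_jostD_le hs⟩) h.bound_d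
    (fun y => tendsto_const_nhds) h.tendsto_d).sub (DominatedLimit.schwartz_mul h.right
    (Eventually.of_forall fun _ => ⟨continuous_jostC hs, norm_jostC_le hs⟩) h.bound_c
    (fun y => tendsto_const_nhds) h.tendsto_c)
  refine (hlim.lint (k := 2 * k) (by positivity) x).neg.congr' ?_
  filter_upwards [h.small_punctured] with τ hτ
  rw [jost_left_sub hs hτ x, lint, lint, ← rint_const_smul, rint, rint, ← integral_neg]
  refine integral_congr_ae (Eventually.of_forall fun x => ?_)
  simp only [smul_apply, sub_apply, Complex.real_smul]
  ring

theorem tendsto_right (h : SmallCurve k t P R Pd Rd) (x : ℝ) :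
    Tendsto (fun τ => (τ - t)⁻¹ • (jostB k (P t) (R t) x * jostA k (P τ) (R τ) x
      - jostA k (P t) (R t) x * jostB k (P τ) (R τ) x)) (𝓝[≠] t)
      (𝓝 (-rint (2 * k) (fun y => Pd y * (jostB k (P t) (R t) y * jostB k (P t) (R t) y)
          - Rd y * (jostA k (P t) (R t) y * jostA k (P t) (R t) y)) x)) := by
  have hs := h.small_self
  have hk := hs.pos
  have hlim := (DominatedLimit.schwartz_mul h.left
    (Eventually.of_forall fun _ => ⟨continuous_jostB hs, norm_jostB_le hs⟩) h.bound_b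
    (fun y => tendsto_const_nhds) h.tendsto_b).sub (DominatedLimit.schwartz_mul h.right
    (Eventually.of_forall fun _ => ⟨continuous_jostA hs, norm_jostA_le hs⟩) h.bound_a
    (fun y => tendsto_const_nhds) h.tendsto_a)
  refine (hlim.rint (k := 2 * k) (by positivity) x).neg.congr' ?_
  filter_upwards [h.small_punctured] with τ hτ
  rw [jost_right_sub hs hτ x, ← rint_const_smul, rint, rint, ← integral_neg]
  refine integral_congr_ae (Eventually.of_forall fun x => ?_)
  simp only [smul_apply, sub_apply, Complex.real_smul]
  ring

end SmallCurve

end Curves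

/-! ### The diagonal Green's function -/

/-- The entry `G_12` of the diagonal Green's function. -/
def diag12 (k : ℝ) (P R : 𝓢(ℝ, ℂ)) (x : ℝ) : ℂ :=
  -(jostA k P R x * jostC k P R x) / wronskian k P R

/-- The entry `G_21` of the diagonal Green's function. -/
def diag21 (k : ℝ) (P R : 𝓢(ℝ, ℂ)) (x : ℝ) : ℂ :=
  jostB k P R x * jostD k P R x / wronskian k P R

/-- The difference `G_11 - G_22` on the diagonal. -/
def diagDiff (k : ℝ) (P R : 𝓢(ℝ, ℂ)) (x : ℝ) : ℂ :=
  (jostA k P R x * jostD k P R x + jostB k P R x * jostC k P R x) / wronskian k P R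

section Diagonal

variable {k : ℝ} {P R : 𝓢(ℝ, ℂ)}

theorem hasDerivAt_diag12 (h : Small k P R) (x : ℝ) :
    HasDerivAt (diag12 k P R) (-(2 * k) * diag12 k P R x - P x * diagDiff k P R x) x := by
  have hW := wronskian_ne_zero h
  refine (((hasDerivAt_jostA h x).mul (hasDerivAt_jostC h x)).neg.div_const _).congr_deriv ?_
  simp only [diag12, diagDiff]
  field_simp
  ring

theorem hasDerivAt_diag21 (h : Small k P R) (x : ℝ) :
    HasDerivAt (diag21 k P R) (2 * k * diag21 k P R x + R x * diagDiff k P R x) x := by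
  have hW := wronskian_ne_zero h
  refine (((hasDerivAt_jostB h x).mul (hasDerivAt_jostD h x)).div_const _).congr_deriv ?_
  simp only [diag21, diagDiff]
  field_simp
  ring

theorem hasDerivAt_diagDiff (h : Small k P R) (x : ℝ) :
    HasDerivAt (diagDiff k P R) (2 * P x * diag21 k P R x - 2 * R x * diag12 k P R x) x := by
  have hW := wronskian_ne_zero h
  refine ((((hasDerivAt_jostA h x).mul (hasDerivAt_jostD h x)).add
    ((hasDerivAt_jostB h x).mul (hasDerivAt_jostC h x))).div_const _).congr_deriv ?_
  simp only [diag21, diag12]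
  field_simp
  ring

theorem diagDiff_sq (h : Small k P R) (x : ℝ) :
    diagDiff k P R x ^ 2 + 4 * (diag12 k P R x * diag21 k P R x) = 1 := by
  have hW := wronskian_ne_zero h
  have := wronskian_eq h x
  simp only [diagDiff, diag12, diag21]
  field_simp
  rw [← this]
  ring

theorem one_add_diagDiff (h : Small k P R) (x : ℝ) :
    1 + diagDiff k P R x = 2 * (jostA k P R x * jostD k P R x) / wronskian k P R := by
  have hW := wronskian_ne_zero h
  have := wronskian_eq h x
  simp only [diagDiff]
  field_simp
  rw [← this]
  ring

theorem one_add_diagDiff_ne_zero (h : Small k P R) (x : ℝ) : 1 + diagDiff k P R x ≠ 0 := by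
  rw [one_add_diagDiff h x]
  exact div_ne_zero (mul_ne_zero two_ne_zero (mul_ne_zero (jostA_ne_zero h x) (jostD_ne_zero h x)))
    (wronskian_ne_zero h)

theorem exists_norm_diag_le (h : Small k P R) :
    ∃ C, ∀ x, ‖diag12 k P R x‖ ≤ C ∧ ‖diag21 k P R x‖ ≤ C ∧ ‖diagDiff k P R x‖ ≤ C := by
  set B := jostBound k P R
  have hB : 0 ≤ B := jostBound_nonneg h
  have key : ∀ {u v : ℂ} {u' v' : ℝ}, ‖u‖ ≤ u' → ‖v‖ ≤ v' → 0 ≤ u' → ‖u * v‖ ≤ u' * v' :=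
    fun hu hv h0 => by
      rw [norm_mul]
      exact mul_le_mul hu hv (norm_nonneg _) h0
  refine ⟨(4 / 3 * (4 / 3) + B * B + 4 / 3 * B) / ‖wronskian k P R‖, fun x => ⟨?_, ?_, ?_⟩⟩
  · rw [diag12, norm_div, norm_neg]
    gcongr
    refine (key (norm_jostA_le h x) (norm_jostC_le h x) (by norm_num)).trans ?_
    nlinarith
  · rw [diag21, norm_div]
    gcongr
    refine (key (norm_jostB_le h x) (norm_jostD_le h x) hB).trans ?_
    nlinarith
  · rw [diagDiff, norm_div]
    gcongr
    refine (norm_add_le _ _).trans ?_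
    refine (add_le_add (key (norm_jostA_le h x) (norm_jostD_le h x) (by norm_num))
      (key (norm_jostB_le h x) (norm_jostC_le h x) hB)).trans ?_
    nlinarith

end Diagonal

section Evolution

variable {k t : ℝ} {P R : ℝ → 𝓢(ℝ, ℂ)} {Pd Rd : 𝓢(ℝ, ℂ)}

/-- Bounded coefficients `B = [[β₀, β₁], [β₂, -β₀]]` that satisfy the zero-curvature equation
`U_t = B_x - [U, B]` with `U = [[-k, P], [R, k]]`. -/
structure ZeroCurvature (k : ℝ) (P R Pd Rd : 𝓢(ℝ, ℂ)) (β₀ β₁ β₂ : ℝ → ℂ) : Prop where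
  hasDerivAt_zero : ∀ x, HasDerivAt β₀ (P x * β₂ x - R x * β₁ x) x
  hasDerivAt_one : ∀ x, HasDerivAt β₁ (Pd x - 2 * k * β₁ x - 2 * P x * β₀ x) x
  hasDerivAt_two : ∀ x, HasDerivAt β₂ (Rd x + 2 * R x * β₀ x + 2 * k * β₂ x) x
  bounded : ∃ C, ∀ x, ‖β₀ x‖ ≤ C ∧ ‖β₁ x‖ ≤ C ∧ ‖β₂ x‖ ≤ C

theorem norm_quadratic_le {β₀ β₁ β₂ u v : ℂ} {C D : ℝ} (h0 : ‖β₀‖ ≤ C) (h1 : ‖β₁‖ ≤ C)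
    (h2 : ‖β₂‖ ≤ C) (hu : ‖u‖ ≤ D) (hv : ‖v‖ ≤ D) :
    ‖β₁ * (u * u) + 2 * β₀ * (u * v) - β₂ * (v * v)‖ ≤ 4 * (C * (D * D)) := by
  have e1 := norm_mul_mul_le h1 hu hu
  have e2 := norm_mul_mul_le h0 hu hv
  have e3 := norm_mul_mul_le h2 hv hv
  calc _ ≤ ‖β₁ * (u * u) + 2 * β₀ * (u * v)‖ + ‖β₂ * (v * v)‖ := norm_sub_le _ _
    _ ≤ ‖β₁ * (u * u)‖ + ‖2 * β₀ * (u * v)‖ + ‖β₂ * (v * v)‖ := by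
        gcongr
        exact norm_add_le _ _
    _ ≤ _ := by
        rw [mul_assoc 2, norm_mul 2, Complex.norm_ofNat]
        linarith

section Explicit

variable {P R : 𝓢(ℝ, ℂ)} {β₀ β₁ β₂ : ℝ → ℂ}

theorem ZeroCurvature.lint_eq (hz : ZeroCurvature k P R Pd Rd β₀ β₁ β₂) (h : Small k P R)
    (x : ℝ) :
    lint (2 * k) (fun y => Pd y * (jostD k P R y * jostD k P R y)
          - Rd y * (jostC k P R y * jostC k P R y)) x
      = β₁ x * (jostD k P R x * jostD k P R x) + 2 * β₀ x * (jostD k P R x * jostC k P R x)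
        - β₂ x * (jostC k P R x * jostC k P R x) := by
  obtain ⟨C, hC⟩ := hz.bounded
  have hk := h.pos
  have := continuous_jostC h
  have := continuous_jostD h
  have := Pd.continuous
  have := Rd.continuous
  symm
  refine eq_lint_of_hasDerivAt (k := 2 * k)
    (X := fun x => β₁ x * (jostD k P R x * jostD k P R x)
      + 2 * β₀ x * (jostD k P R x * jostC k P R x) - β₂ x * (jostC k P R x * jostC k P R x))
    (by positivity) (by fun_prop)
    (fun y => (norm_sub_le _ _).trans (add_le_add
      (norm_mul_mul_le (norm_le_supNorm _ y) (norm_jostD_le h y) (norm_jostD_le h y))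
      (norm_mul_mul_le (norm_le_supNorm _ y) (norm_jostC_le h y) (norm_jostC_le h y))))
    (fun y => norm_quadratic_le (hC y).1 (hC y).2.1 (hC y).2.2
      ((norm_jostD_le h y).trans (le_max_left _ (jostBound k P R)))
      ((norm_jostC_le h y).trans (le_max_right _ _))) (fun y => ?_) x
  have hc := hasDerivAt_jostC h y
  have hd := hasDerivAt_jostD h y
  refine ((((hz.hasDerivAt_one y).mul (hd.mul hd)).add
    (((hz.hasDerivAt_zero y).const_mul 2).mul (hd.mul hc))).sub
    ((hz.hasDerivAt_two y).mul (hc.mul hc))).congr_deriv ?_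
  simp only [Complex.real_smul, Complex.ofReal_mul, Complex.ofReal_ofNat, Pi.mul_apply]
  ring

theorem ZeroCurvature.rint_eq (hz : ZeroCurvature k P R Pd Rd β₀ β₁ β₂) (h : Small k P R)
    (x : ℝ) :
    rint (2 * k) (fun y => Pd y * (jostB k P R y * jostB k P R y)
          - Rd y * (jostA k P R y * jostA k P R y)) x
      = -(β₁ x * (jostB k P R x * jostB k P R x) + 2 * β₀ x * (jostB k P R x * jostA k P R x)
        - β₂ x * (jostA k P R x * jostA k P R x)) := by
  obtain ⟨C, hC⟩ := hz.bounded
  have hk := h.pos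
  have := continuous_jostA h
  have := continuous_jostB h
  have := Pd.continuous
  have := Rd.continuous
  symm
  refine eq_rint_of_hasDerivAt (k := 2 * k)
    (X := fun x => -(β₁ x * (jostB k P R x * jostB k P R x)
      + 2 * β₀ x * (jostB k P R x * jostA k P R x) - β₂ x * (jostA k P R x * jostA k P R x)))
    (by positivity) (by fun_prop)
    (fun y => (norm_sub_le _ _).trans (add_le_add
      (norm_mul_mul_le (norm_le_supNorm _ y) (norm_jostB_le h y) (norm_jostB_le h y))
      (norm_mul_mul_le (norm_le_supNorm _ y) (norm_jostA_le h y) (norm_jostA_le h y))))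
    (fun y => by
      rw [norm_neg]
      exact norm_quadratic_le (hC y).1 (hC y).2.1 (hC y).2.2
        ((norm_jostB_le h y).trans (le_max_right (4 / 3) _))
        ((norm_jostA_le h y).trans (le_max_left _ _))) (fun y => ?_) x
  have ha := hasDerivAt_jostA h y
  have hb := hasDerivAt_jostB h y
  refine ((((hz.hasDerivAt_one y).mul (hb.mul hb)).add
    (((hz.hasDerivAt_zero y).const_mul 2).mul (hb.mul ha))).sub
    ((hz.hasDerivAt_two y).mul (ha.mul ha))).neg.congr_deriv ?_
  simp only [Complex.real_smul, Complex.ofReal_mul, Complex.ofReal_ofNat, Pi.mul_apply]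
  ring

end Explicit

variable {β₀ β₁ β₂ : ℝ → ℂ}

theorem SmallCurve.hasDerivAt_diag12 (h : SmallCurve k t P R Pd Rd)
    (hz : ZeroCurvature k (P t) (R t) Pd Rd β₀ β₁ β₂) (x : ℝ) :
    HasDerivAt (fun τ => diag12 k (P τ) (R τ) x)
      (2 * β₀ x * diag12 k (P t) (R t) x - β₁ x * diagDiff k (P t) (R t) x) t := by
  have hs := h.small_self
  have hW := wronskian_ne_zero hs
  rw [hasDerivAt_iff_tendsto_slope]
  have h1 := (((h.tendsto_a x).const_mul (jostA k (P t) (R t) x)).mul (h.tendsto_left x)).add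
    (((h.tendsto_c x).const_mul (jostC k (P t) (R t) x)).mul (h.tendsto_right x))
  have h2 := h1.div (h.tendsto_wronskian.const_mul (wronskian k (P t) (R t))) (mul_ne_zero hW hW)
  rw [hz.lint_eq hs, hz.rint_eq hs] at h2
  refine (h2.congr' ?_).trans (le_of_eq (congrArg 𝓝 ?_))
  · filter_upwards [h.small_punctured] with τ hτ
    have hWτ := wronskian_ne_zero hτ
    simp only [slope, vsub_eq_sub, diag12, Complex.real_smul, Pi.div_apply]
    rw [div_sub_div _ _ hWτ hW, div_eq_iff (mul_ne_zero hW hWτ), mul_assoc _ (_ / _),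
      mul_comm (wronskian k (P t) (R t)), div_mul_cancel₀ _ (mul_ne_zero hWτ hW),
      ← wronskian_eq hs x, ← wronskian_eq hτ x]
    ring
  · have e := wronskian_eq hs x
    simp only [diag12, diagDiff]
    field_simp
    rw [← e]
    ring

theorem SmallCurve.hasDerivAt_diag21 (h : SmallCurve k t P R Pd Rd)
    (hz : ZeroCurvature k (P t) (R t) Pd Rd β₀ β₁ β₂) (x : ℝ) :
    HasDerivAt (fun τ => diag21 k (P τ) (R τ) x)
      (β₂ x * diagDiff k (P t) (R t) x - 2 * β₀ x * diag21 k (P t) (R t) x) t := by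
  have hs := h.small_self
  have hW := wronskian_ne_zero hs
  rw [hasDerivAt_iff_tendsto_slope]
  have h1 := ((((h.tendsto_d x).const_mul (jostD k (P t) (R t) x)).mul (h.tendsto_right x)).add
    (((h.tendsto_b x).const_mul (jostB k (P t) (R t) x)).mul (h.tendsto_left x))).neg
  have h2 := h1.div (h.tendsto_wronskian.const_mul (wronskian k (P t) (R t))) (mul_ne_zero hW hW)
  rw [hz.lint_eq hs, hz.rint_eq hs] at h2
  refine (h2.congr' ?_).trans (le_of_eq (congrArg 𝓝 ?_))
  · filter_upwards [h.small_punctured] with τ hτ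
    have hWτ := wronskian_ne_zero hτ
    simp only [slope, vsub_eq_sub, diag21, Complex.real_smul, Pi.div_apply]
    rw [div_sub_div _ _ hWτ hW, div_eq_iff (mul_ne_zero hW hWτ), mul_assoc _ (_ / _),
      mul_comm (wronskian k (P t) (R t)), div_mul_cancel₀ _ (mul_ne_zero hWτ hW),
      ← wronskian_eq hs x, ← wronskian_eq hτ x]
    ring
  · have e := wronskian_eq hs x
    simp only [diag21, diagDiff]
    field_simp
    rw [← e]
    ring

theorem SmallCurve.hasDerivAt_diagDiff (h : SmallCurve k t P R Pd Rd)
    (hz : ZeroCurvature k (P t) (R t) Pd Rd β₀ β₁ β₂) (x : ℝ) :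
    HasDerivAt (fun τ => diagDiff k (P τ) (R τ) x)
      (2 * (β₁ x * diag21 k (P t) (R t) x - β₂ x * diag12 k (P t) (R t) x)) t := by
  have hs := h.small_self
  have hW := wronskian_ne_zero hs
  rw [hasDerivAt_iff_tendsto_slope]
  have h1 := ((((h.tendsto_c x).mul_const (jostD k (P t) (R t) x)).mul (h.tendsto_right x)).add
    (((h.tendsto_a x).mul_const (jostB k (P t) (R t) x)).mul (h.tendsto_left x))).const_mul (-2)
  have h2 := h1.div (h.tendsto_wronskian.const_mul (wronskian k (P t) (R t))) (mul_ne_zero hW hW)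
  rw [hz.lint_eq hs, hz.rint_eq hs] at h2
  refine (h2.congr' ?_).trans (le_of_eq (congrArg 𝓝 ?_))
  · filter_upwards [h.small_punctured] with τ hτ
    have hWτ := wronskian_ne_zero hτ
    simp only [slope, vsub_eq_sub, diagDiff, Complex.real_smul, Pi.div_apply]
    rw [div_sub_div _ _ hWτ hW, div_eq_iff (mul_ne_zero hW hWτ), mul_assoc _ (_ / _),
      mul_comm (wronskian k (P t) (R t)), div_mul_cancel₀ _ (mul_ne_zero hWτ hW),
      ← wronskian_eq hs x, ← wronskian_eq hτ x]
    ring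
  · have e := wronskian_eq hs x
    simp only [diag21, diag12]
    field_simp
    rw [← e]
    ring

end Evolution

/-! ### The kernel `exp(-k |x - y|)` -/

theorem integrable_exp_abs {k : ℝ} (hk : 0 < k) :
    Integrable fun x : ℝ => Real.exp (-(k * |x|)) := by
  have h1 : IntegrableOn (fun x : ℝ => Real.exp (-(k * |x|))) (Set.Ioi 0) := by
    have := integrableOn_exp_decay hk 0
    refine this.congr_fun (fun y hy => ?_) measurableSet_Ioi
    simp only [sub_zero]
    rw [abs_of_pos hy]
  have h2 : IntegrableOn (fun x : ℝ => Real.exp (-(k * |x|))) (Set.Iic 0) := by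
    refine (integrableOn_exp_mul_Iic hk 0).congr_fun (fun y hy => ?_) measurableSet_Iic
    simp only
    rw [abs_of_nonpos hy]
    congr 1
    ring
  rw [← integrableOn_univ, ← Set.Iic_union_Ioi (a := (0 : ℝ))]
  exact h2.union h1

theorem integrable_exp_abs_sub {k : ℝ} (hk : 0 < k) (x : ℝ) :
    Integrable fun y : ℝ => Real.exp (-(k * |x - y|)) :=
  (integrable_exp_abs hk).comp_sub_left x

theorem integrable_exp_abs_prod {k : ℝ} (hk : 0 < k) {h : ℝ → ℝ} (hh : Integrable h) :
    Integrable (fun p : ℝ × ℝ => Real.exp (-(k * |p.1 - p.2|)) * h p.2)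
      (volume.prod volume) := by
  have := hh.convolution_integrand (ContinuousLinearMap.mul ℝ ℝ) (integrable_exp_abs hk)
  refine this.congr (Eventually.of_forall fun p => ?_)
  simp [mul_comm]

theorem integrable_exp_abs_prod' {k : ℝ} (hk : 0 < k) {h : ℝ → ℝ} (hh : Integrable h) :
    Integrable (fun p : ℝ × ℝ => Real.exp (-(k * |p.1 - p.2|)) * h p.1)
      (volume.prod volume) := by
  have := (integrable_exp_abs_prod hk hh).swap
  refine this.congr (Eventually.of_forall fun p => ?_)
  simp [abs_sub_comm]

/-! ### The Green's function for positive spectral parameter -/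

section Green

variable (k : ℝ) (P R : 𝓢(ℝ, ℂ))

/-- The right Jost solution without its exponential factor. -/
def vecRight (i : Fin 2) : ℝ → ℂ := ![jostA k P R, jostB k P R] i

/-- The left Jost solution without its exponential factor. -/
def vecLeft (i : Fin 2) : ℝ → ℂ := ![jostC k P R, jostD k P R] i

/-- The dual of the right Jost solution without its exponential factor. -/
def dualRight (j : Fin 2) (y : ℝ) : ℂ :=
  ![jostD k P R y, -jostC k P R y] j / wronskian k P R

/-- The dual of the left Jost solution without its exponential factor. -/
def dualLeft (j : Fin 2) (y : ℝ) : ℂ :=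
  ![jostB k P R y, -jostA k P R y] j / wronskian k P R

/-- The Green's function of `[[∂ + k, -P], [-R, ∂ - k]]` for `k > 0`. -/
def greenPos (x y : ℝ) : Matrix (Fin 2) (Fin 2) ℂ :=
  Matrix.of fun i j => (Real.exp (-(k * |x - y|)) : ℝ) *
    (if y < x then vecRight k P R i x * dualRight k P R j y
      else if x < y then vecLeft k P R i x * dualLeft k P R j y
      else (vecRight k P R i x * dualRight k P R j y
        + vecLeft k P R i x * dualLeft k P R j y) / 2)

/-- The Green's function of the unperturbed operator for `k > 0`. -/
def freePos (x y : ℝ) : Matrix (Fin 2) (Fin 2) ℂ :=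
  !![(Real.exp (-(k * |x - y|)) : ℝ) * heaviside (x - y), 0;
    0, -((Real.exp (-(k * |x - y|)) : ℝ) * heaviside (y - x))]

end Green

section GreenProperties

variable {k : ℝ} {P R : 𝓢(ℝ, ℂ)}

theorem jump (h : Small k P R) (i j : Fin 2) (x : ℝ) :
    vecRight k P R i x * dualRight k P R j x - vecLeft k P R i x * dualLeft k P R j x
      = if i = j then 1 else 0 := by
  have hW := wronskian_ne_zero h
  have e := wronskian_eq h x
  fin_cases i <;> fin_cases j <;>
    simp only [vecRight, vecLeft, dualRight, dualLeft, Fin.zero_eta, Fin.mk_one, Fin.isValue,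
      Matrix.cons_val_zero, Matrix.cons_val_one, Matrix.cons_val_fin_one, if_true, if_false, zero_ne_one, one_ne_zero] <;>
    field_simp <;> first | linear_combination e | ring

theorem continuous_vecRight (h : Small k P R) (i : Fin 2) : Continuous (vecRight k P R i) := by
  fin_cases i
  · exact continuous_jostA h
  · exact continuous_jostB h

theorem continuous_vecLeft (h : Small k P R) (i : Fin 2) : Continuous (vecLeft k P R i) := by
  fin_cases i
  · exact continuous_jostC h
  · exact continuous_jostD h

theorem continuous_dualRight (h : Small k P R) (j : Fin 2) : Continuous (dualRight k P R j) := by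
  fin_cases j
  · exact (continuous_jostD h).div_const _
  · exact (continuous_jostC h).neg.div_const _

theorem continuous_dualLeft (h : Small k P R) (j : Fin 2) : Continuous (dualLeft k P R j) := by
  fin_cases j
  · exact (continuous_jostB h).div_const _
  · exact (continuous_jostA h).neg.div_const _

/-- A common bound for the components of the Jost solutions. -/
def vecBound (k : ℝ) (P R : 𝓢(ℝ, ℂ)) : ℝ := max (4 / 3) (jostBound k P R)

theorem vecBound_pos (k : ℝ) (P R : 𝓢(ℝ, ℂ)) : 0 < vecBound k P R :=
  lt_max_of_lt_left (by norm_num)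

theorem norm_vecRight_le (h : Small k P R) (i : Fin 2) (x : ℝ) :
    ‖vecRight k P R i x‖ ≤ vecBound k P R := by
  fin_cases i
  · exact (norm_jostA_le h x).trans (le_max_left _ _)
  · exact (norm_jostB_le h x).trans (le_max_right _ _)

theorem norm_vecLeft_le (h : Small k P R) (i : Fin 2) (x : ℝ) :
    ‖vecLeft k P R i x‖ ≤ vecBound k P R := by
  fin_cases i
  · exact (norm_jostC_le h x).trans (le_max_right _ _)
  · exact (norm_jostD_le h x).trans (le_max_left _ _)

theorem norm_dualRight_le (h : Small k P R) (j : Fin 2) (x : ℝ) :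
    ‖dualRight k P R j x‖ ≤ vecBound k P R / ‖wronskian k P R‖ := by
  rw [dualRight, norm_div]
  gcongr
  fin_cases j
  · exact (norm_jostD_le h x).trans (le_max_left _ _)
  · rw [Fin.mk_one, Matrix.cons_val_one, Matrix.cons_val_fin_one, norm_neg]
    exact (norm_jostC_le h x).trans (le_max_right _ _)

theorem norm_dualLeft_le (h : Small k P R) (j : Fin 2) (x : ℝ) :
    ‖dualLeft k P R j x‖ ≤ vecBound k P R / ‖wronskian k P R‖ := by
  rw [dualLeft, norm_div]
  gcongr
  fin_cases j
  · exact (norm_jostB_le h x).trans (le_max_right _ _)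
  · rw [Fin.mk_one, Matrix.cons_val_one, Matrix.cons_val_fin_one, norm_neg]
    exact (norm_jostA_le h x).trans (le_max_left _ _)

/-- The constant in the exponential bound of the Green's function. -/
def greenBound (k : ℝ) (P R : 𝓢(ℝ, ℂ)) : ℝ :=
  vecBound k P R * (vecBound k P R / ‖wronskian k P R‖)

theorem greenBound_nonneg (k : ℝ) (P R : 𝓢(ℝ, ℂ)) : 0 ≤ greenBound k P R := by
  have := vecBound_pos k P R
  unfold greenBound
  positivity

theorem norm_greenPos_le (h : Small k P R) (x y : ℝ) (i j : Fin 2) :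
    ‖greenPos k P R x y i j‖ ≤ Real.exp (-(k * |x - y|)) * greenBound k P R := by
  have h1 : ‖vecRight k P R i x * dualRight k P R j y‖ ≤ greenBound k P R := by
    rw [norm_mul]
    exact mul_le_mul (norm_vecRight_le h i x) (norm_dualRight_le h j y) (norm_nonneg _)
      (vecBound_pos k P R).le
  have h2 : ‖vecLeft k P R i x * dualLeft k P R j y‖ ≤ greenBound k P R := by
    rw [norm_mul]
    exact mul_le_mul (norm_vecLeft_le h i x) (norm_dualLeft_le h j y) (norm_nonneg _)
      (vecBound_pos k P R).le
  rw [greenPos, Matrix.of_apply, norm_mul, Complex.norm_real,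
    Real.norm_of_nonneg (Real.exp_nonneg _)]
  refine mul_le_mul_of_nonneg_left ?_ (Real.exp_nonneg _)
  split_ifs
  · exact h1
  · exact h2
  · rw [norm_div, Complex.norm_ofNat, div_le_iff₀ two_pos]
    exact (norm_add_le _ _).trans (by linarith)

theorem greenPos_of_lt {x y : ℝ} (hxy : y < x) (i j : Fin 2) : greenPos k P R x y i j
    = (Real.exp (-(k * (x - y))) : ℝ) * (vecRight k P R i x * dualRight k P R j y) := by
  simp [greenPos, hxy, abs_of_pos (sub_pos.2 hxy)]

theorem greenPos_of_gt {x y : ℝ} (hxy : x < y) (i j : Fin 2) : greenPos k P R x y i j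
    = (Real.exp (-(k * (y - x))) : ℝ) * (vecLeft k P R i x * dualLeft k P R j y) := by
  simp [greenPos, hxy, hxy.not_gt, abs_of_neg (sub_neg.2 hxy)]

theorem greenPos_sub_freePos (h : Small k P R) (x y : ℝ) (i j : Fin 2) :
    (greenPos k P R x y - freePos k x y) i j = (Real.exp (-(k * |x - y|)) : ℝ) *
      (if y ≤ x then vecRight k P R i x * dualRight k P R j y
          - (if i = j then (if i = 0 then 1 else 0) else 0)
        else vecLeft k P R i x * dualLeft k P R j y
          + (if i = j then (if i = 0 then 0 else 1) else 0)) := by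
  have hf : freePos k x y i j = (Real.exp (-(k * |x - y|)) : ℝ) *
      (if i = j then (if i = 0 then heaviside (x - y) else - heaviside (y - x)) else 0) := by
    fin_cases i <;> fin_cases j <;> simp [freePos]
  rw [Matrix.sub_apply, hf, greenPos, Matrix.of_apply, ← mul_sub]
  congr 1
  rcases lt_trichotomy y x with hxy | hxy | hxy
  · fin_cases i <;> fin_cases j <;> simp [hxy, hxy.le, hxy.not_gt, heaviside, hxy.ne, sub_eq_zero]
  · subst hxy
    have hj := jump h i j y
    simp only [lt_irrefl, if_false, le_refl, if_true, sub_self, heaviside]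
    by_cases hij : i = j
    · simp only [hij, if_true] at hj ⊢
      by_cases h0 : j = 0
      · simp only [h0, if_true] at hj ⊢
        linear_combination -hj / 2
      · simp only [h0, if_false] at hj ⊢
        linear_combination -hj / 2
    · simp only [hij, if_false] at hj ⊢
      linear_combination -hj / 2
  · fin_cases i <;> fin_cases j <;> simp [hxy, hxy.not_ge, hxy.not_gt, heaviside, hxy.ne, sub_eq_zero]

theorem continuous_greenPos_sub (h : Small k P R) :
    Continuous fun p : ℝ × ℝ => greenPos k P R p.1 p.2 - freePos k p.1 p.2 := by
  refine continuous_matrix fun i j => ?_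
  simp only [greenPos_sub_freePos h]
  refine Continuous.mul (by fun_prop) ?_
  have h1 := (continuous_vecRight h i).comp (continuous_fst : Continuous (Prod.fst : ℝ × ℝ → ℝ))
  have h2 := (continuous_vecLeft h i).comp (continuous_fst : Continuous (Prod.fst : ℝ × ℝ → ℝ))
  have h3 := (continuous_dualRight h j).comp (continuous_snd : Continuous (Prod.snd : ℝ × ℝ → ℝ))
  have h4 := (continuous_dualLeft h j).comp (continuous_snd : Continuous (Prod.snd : ℝ × ℝ → ℝ))
  refine Continuous.if_le ((h1.mul h3).sub continuous_const) ((h2.mul h4).add continuous_const)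
    continuous_snd continuous_fst fun p hp => ?_
  have hj := jump h i j p.1
  simp only [hp]
  split_ifs at hj ⊢ <;> linear_combination hj

theorem continuous_freePos_offDiag (k : ℝ) {i j : Fin 2} (hij : i ≠ j) :
    Continuous fun p : ℝ × ℝ => freePos k p.1 p.2 i j := by
  have : (fun p : ℝ × ℝ => freePos k p.1 p.2 i j) = fun _ => 0 := by
    funext p
    fin_cases i <;> fin_cases j <;> simp_all [freePos]
  rw [this]
  exact continuous_const

theorem continuous_greenPos_offDiag (h : Small k P R) {i j : Fin 2} (hij : i ≠ j) :
    Continuous fun p : ℝ × ℝ => greenPos k P R p.1 p.2 i j := by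
  have h1 := ((continuous_greenPos_sub h).matrix_elem i j).add (continuous_freePos_offDiag k hij)
  refine h1.congr fun p => ?_
  simp

theorem measurable_greenPos (h : Small k P R) (i j : Fin 2) :
    Measurable fun p : ℝ × ℝ => greenPos k P R p.1 p.2 i j := by
  have h1 : Measurable fun p : ℝ × ℝ => vecRight k P R i p.1 * dualRight k P R j p.2 :=
    ((continuous_vecRight h i).measurable.comp measurable_fst).mul
      ((continuous_dualRight h j).measurable.comp measurable_snd)
  have h2 : Measurable fun p : ℝ × ℝ => vecLeft k P R i p.1 * dualLeft k P R j p.2 :=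
    ((continuous_vecLeft h i).measurable.comp measurable_fst).mul
      ((continuous_dualLeft h j).measurable.comp measurable_snd)
  simp only [greenPos, Matrix.of_apply]
  refine Measurable.mul (Continuous.measurable (by fun_prop)) ?_
  exact Measurable.ite (measurableSet_lt measurable_snd measurable_fst) h1
    (Measurable.ite (measurableSet_lt measurable_fst measurable_snd) h2 ((h1.add h2).div_const 2))

/-! ### The weak form of the equation for the columns of the Green's function -/

theorem hasDerivAt_exp_mul (m y x : ℝ) :
    HasDerivAt (fun x : ℝ => ((Real.exp (m * (x - y)) : ℝ) : ℂ))
      (m * (Real.exp (m * (x - y)) : ℝ)) x := by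
  have h1 : HasDerivAt (fun x : ℝ => Real.exp (m * (x - y))) (m * Real.exp (m * (x - y))) x := by
    have := (((hasDerivAt_id x).sub_const y).const_mul m).exp
    simpa [mul_comm] using this
  simpa using h1.ofReal_comp

/-- The derivatives of the components of `v = exp(-k(x - y)) (a, b)`. -/
theorem hasDerivAt_right_zero (h : Small k P R) (y x : ℝ) :
    HasDerivAt (fun x => ((Real.exp (-k * (x - y)) : ℝ) : ℂ) * vecRight k P R 0 x)
      (-k * ((Real.exp (-k * (x - y)) : ℝ) * vecRight k P R 0 x)
        + P x * ((Real.exp (-k * (x - y)) : ℝ) * vecRight k P R 1 x)) x := by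
  refine ((hasDerivAt_exp_mul (-k) y x).mul (hasDerivAt_jostA h x)).congr_deriv ?_
  simp only [vecRight, Matrix.cons_val_zero, Matrix.cons_val_one, Complex.ofReal_neg,
    Matrix.cons_val_fin_one]
  ring

theorem hasDerivAt_right_one (h : Small k P R) (y x : ℝ) :
    HasDerivAt (fun x => ((Real.exp (-k * (x - y)) : ℝ) : ℂ) * vecRight k P R 1 x)
      (k * ((Real.exp (-k * (x - y)) : ℝ) * vecRight k P R 1 x)
        + R x * ((Real.exp (-k * (x - y)) : ℝ) * vecRight k P R 0 x)) x := by
  refine ((hasDerivAt_exp_mul (-k) y x).mul (hasDerivAt_jostB h x)).congr_deriv ?_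
  simp only [vecRight, Matrix.cons_val_zero, Matrix.cons_val_one, Complex.ofReal_neg,
    Matrix.cons_val_fin_one]
  ring

theorem hasDerivAt_left_zero (h : Small k P R) (y x : ℝ) :
    HasDerivAt (fun x => ((Real.exp (k * (x - y)) : ℝ) : ℂ) * vecLeft k P R 0 x)
      (-k * ((Real.exp (k * (x - y)) : ℝ) * vecLeft k P R 0 x)
        + P x * ((Real.exp (k * (x - y)) : ℝ) * vecLeft k P R 1 x)) x := by
  refine ((hasDerivAt_exp_mul k y x).mul (hasDerivAt_jostC h x)).congr_deriv ?_
  simp only [vecLeft, Matrix.cons_val_zero, Matrix.cons_val_one, Matrix.cons_val_fin_one]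
  ring

theorem hasDerivAt_left_one (h : Small k P R) (y x : ℝ) :
    HasDerivAt (fun x => ((Real.exp (k * (x - y)) : ℝ) : ℂ) * vecLeft k P R 1 x)
      (k * ((Real.exp (k * (x - y)) : ℝ) * vecLeft k P R 1 x)
        + R x * ((Real.exp (k * (x - y)) : ℝ) * vecLeft k P R 0 x)) x := by
  refine ((hasDerivAt_exp_mul k y x).mul (hasDerivAt_jostD h x)).congr_deriv ?_
  simp only [vecLeft, Matrix.cons_val_zero, Matrix.cons_val_one, Matrix.cons_val_fin_one]
  ring

/-- The two rows of the transposed operator `-∂ ± k`, with the potential terms. -/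
def adjRow (k : ℝ) (P R : 𝓢(ℝ, ℂ)) (i : Fin 2) (g₀ g₁ p p' : ℂ) (x : ℝ) : ℂ :=
  ![g₀ * (-p' + k * p) - P x * g₁ * p, g₁ * (-p' - k * p) - R x * g₀ * p] i

theorem adjRow_mul (k : ℝ) (P R : 𝓢(ℝ, ℂ)) (i : Fin 2) (c g₀ g₁ p p' : ℂ) (x : ℝ) :
    adjRow k P R i (c * g₀) (c * g₁) p p' x = c * adjRow k P R i g₀ g₁ p p' x := by
  fin_cases i <;> simp [adjRow] <;> ring

theorem continuous_adjRow (k : ℝ) (P R : 𝓢(ℝ, ℂ)) (i : Fin 2) {g₀ g₁ p p' : ℝ → ℂ}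
    (h0 : Continuous g₀) (h1 : Continuous g₁) (hp : Continuous p) (hp' : Continuous p') :
    Continuous fun x => adjRow k P R i (g₀ x) (g₁ x) (p x) (p' x) x := by
  have := P.continuous
  have := R.continuous
  fin_cases i <;> simp [adjRow] <;> fun_prop

theorem norm_adjRow_le (hk : 0 < k) (i : Fin 2) {g₀ g₁ p p' : ℂ} {x D N : ℝ}
    (h0 : ‖g₀‖ ≤ D) (h1 : ‖g₁‖ ≤ D) (hp : ‖p‖ ≤ N) (hp' : ‖p'‖ ≤ N) :
    ‖adjRow k P R i g₀ g₁ p p' x‖ ≤ D * (N * (1 + k + supNorm P + supNorm R)) := by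
  have hD := (norm_nonneg _).trans h0
  have hN := (norm_nonneg _).trans hp
  have hP := supNorm_nonneg P
  have hR := supNorm_nonneg R
  have a1 : ∀ {g}, ‖g‖ ≤ D → ‖g * (-p' + k * p)‖ ≤ D * (N * (1 + k)) := fun {g} hg => by
    rw [norm_mul]
    refine mul_le_mul hg ?_ (norm_nonneg _) hD
    refine (norm_add_le _ _).trans ?_
    rw [norm_neg, norm_mul, Complex.norm_real, Real.norm_of_nonneg hk.le]
    nlinarith
  have a2 : ∀ {g}, ‖g‖ ≤ D → ‖g * (-p' - k * p)‖ ≤ D * (N * (1 + k)) := fun {g} hg => by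
    rw [norm_mul]
    refine mul_le_mul hg ?_ (norm_nonneg _) hD
    refine (norm_sub_le _ _).trans ?_
    rw [norm_neg, norm_mul, Complex.norm_real, Real.norm_of_nonneg hk.le]
    nlinarith
  have a3 : ∀ (Q : 𝓢(ℝ, ℂ)) {g}, ‖g‖ ≤ D → ‖Q x * g * p‖ ≤ D * (N * supNorm Q) := fun Q g hg => by
    have := norm_mul_mul_le (norm_le_supNorm Q x) hg hp
    rw [mul_assoc]
    linarith
  have b1 : 0 ≤ D * (N * supNorm P) := by positivity
  have b2 : 0 ≤ D * (N * supNorm R) := by positivity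
  fin_cases i
  · refine (norm_sub_le _ _).trans ?_
    have := a1 h0
    have := a3 P h1
    linarith
  · refine (norm_sub_le _ _).trans ?_
    have := a2 h1
    have := a3 R h0
    linarith

theorem hasDerivAt_mul_test {i : Fin 2} {v : Fin 2 → ℝ → ℂ} {p p' : ℝ → ℂ} {x : ℝ}
    (h0 : HasDerivAt (v 0) (-k * v 0 x + P x * v 1 x) x)
    (h1 : HasDerivAt (v 1) (k * v 1 x + R x * v 0 x) x) (hp : HasDerivAt p (p' x) x) :
    HasDerivAt (fun x => -(v i x * p x)) (adjRow k P R i (v 0 x) (v 1 x) (p x) (p' x) x) x := by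
  fin_cases i
  · refine (h0.mul hp).neg.congr_deriv ?_
    simp [adjRow]
    ring
  · refine (h1.mul hp).neg.congr_deriv ?_
    simp [adjRow]
    ring

theorem tendsto_of_norm_le_exp {k D y : ℝ} (hk : 0 < k) {F : ℝ → ℂ}
    (hF : ∀ x, ‖F x‖ ≤ Real.exp (-k * (x - y)) * D) : Tendsto F atTop (𝓝 0) := by
  have h1 : Tendsto (fun x => Real.exp (-k * (x - y)) * D) atTop (𝓝 (0 * D)) := by
    refine Tendsto.mul_const _ ?_
    have h2 : Tendsto (fun x : ℝ => k * (x - y)) atTop atTop :=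
      (tendsto_atTop_add_const_right _ (-y) tendsto_id).const_mul_atTop hk
    refine (Real.tendsto_exp_neg_atTop_nhds_zero.comp h2).congr fun x => ?_
    simp
  rw [zero_mul] at h1
  exact squeeze_zero_norm hF h1

theorem integral_adjRow_right (h : Small k P R) (i : Fin 2) (y : ℝ) {p p' : ℝ → ℂ} {N : ℝ}
    (hp : ∀ x, HasDerivAt p (p' x) x) (hc : Continuous p') (hN : ∀ x, ‖p x‖ ≤ N)
    (hN' : ∀ x, ‖p' x‖ ≤ N) :
    IntegrableOn (fun x => (Real.exp (-k * (x - y)) : ℝ)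
      * adjRow k P R i (vecRight k P R 0 x) (vecRight k P R 1 x) (p x) (p' x) x) (Set.Ioi y) ∧
    ∫ x in Set.Ioi y, (Real.exp (-k * (x - y)) : ℝ)
      * adjRow k P R i (vecRight k P R 0 x) (vecRight k P R 1 x) (p x) (p' x) x
      = vecRight k P R i y * p y := by
  have hk := h.pos
  have hpc : Continuous p := continuous_iff_continuousAt.2 fun x => (hp x).continuousAt
  have hb := fun x => norm_adjRow_le (P := P) (R := R) hk i (x := x) (norm_vecRight_le h 0 x)
    (norm_vecRight_le h 1 x) (hN x) (hN' x)
  have hint : IntegrableOn (fun x => (Real.exp (-k * (x - y)) : ℝ)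
      * adjRow k P R i (vecRight k P R 0 x) (vecRight k P R 1 x) (p x) (p' x) x) (Set.Ioi y) := by
    refine ((integrableOn_exp_decay hk y).mul_const (vecBound k P R
      * (N * (1 + k + supNorm P + supNorm R)))).mono' ?_ (Eventually.of_forall fun x => ?_)
    · have := continuous_adjRow k P R i (continuous_vecRight h 0) (continuous_vecRight h 1) hpc hc
      exact (Continuous.mul (by fun_prop) this).aestronglyMeasurable
    · rw [norm_mul, Complex.norm_real, Real.norm_of_nonneg (Real.exp_nonneg _), neg_mul]
      exact mul_le_mul_of_nonneg_left (hb x) (Real.exp_nonneg _)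
  refine ⟨hint, ?_⟩
  simp only [← adjRow_mul] at hint ⊢
  rw [integral_Ioi_of_hasDerivAt_of_tendsto' (m := 0) (fun x _ => hasDerivAt_mul_test (i := i)
    (v := fun i x => (Real.exp (-k * (x - y)) : ℝ) * vecRight k P R i x)
    (hasDerivAt_right_zero h y x) (hasDerivAt_right_one h y x) (hp x)) hint]
  · simp
  · refine tendsto_of_norm_le_exp hk (y := y) (D := vecBound k P R * N) fun x => ?_
    rw [norm_neg, mul_assoc, norm_mul, norm_mul, Complex.norm_real,
      Real.norm_of_nonneg (Real.exp_nonneg _)]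
    have := norm_vecRight_le h i x
    have := vecBound_pos k P R
    have := hN x
    gcongr

theorem integral_adjRow_left (h : Small k P R) (i : Fin 2) (y : ℝ) {p p' : ℝ → ℂ} {N : ℝ}
    (hp : ∀ x, HasDerivAt p (p' x) x) (hc : Continuous p') (hN : ∀ x, ‖p x‖ ≤ N)
    (hN' : ∀ x, ‖p' x‖ ≤ N) :
    IntegrableOn (fun x => (Real.exp (k * (x - y)) : ℝ)
      * adjRow k P R i (vecLeft k P R 0 x) (vecLeft k P R 1 x) (p x) (p' x) x) (Set.Iic y) ∧
    ∫ x in Set.Iic y, (Real.exp (k * (x - y)) : ℝ)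
      * adjRow k P R i (vecLeft k P R 0 x) (vecLeft k P R 1 x) (p x) (p' x) x
      = -(vecLeft k P R i y * p y) := by
  have hk := h.pos
  have hpc : Continuous p := continuous_iff_continuousAt.2 fun x => (hp x).continuousAt
  have hb := fun x => norm_adjRow_le (P := P) (R := R) hk i (x := x) (norm_vecLeft_le h 0 x)
    (norm_vecLeft_le h 1 x) (hN x) (hN' x)
  have hexp : IntegrableOn (fun x => Real.exp (k * (x - y))) (Set.Iic y) := by
    refine ((integrableOn_exp_mul_Iic hk y).mul_const (Real.exp (-(k * y)))).congr
      (Eventually.of_forall fun x => ?_)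
    simp only
    rw [← Real.exp_add]
    congr 1
    ring
  have hint : IntegrableOn (fun x => (Real.exp (k * (x - y)) : ℝ)
      * adjRow k P R i (vecLeft k P R 0 x) (vecLeft k P R 1 x) (p x) (p' x) x) (Set.Iic y) := by
    refine (hexp.mul_const (vecBound k P R
      * (N * (1 + k + supNorm P + supNorm R)))).mono' ?_ (Eventually.of_forall fun x => ?_)
    · have := continuous_adjRow k P R i (continuous_vecLeft h 0) (continuous_vecLeft h 1) hpc hc
      exact (Continuous.mul (by fun_prop) this).aestronglyMeasurable
    · rw [norm_mul, Complex.norm_real, Real.norm_of_nonneg (Real.exp_nonneg _)]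
      exact mul_le_mul_of_nonneg_left (hb x) (Real.exp_nonneg _)
  refine ⟨hint, ?_⟩
  simp only [← adjRow_mul] at hint ⊢
  rw [integral_Iic_of_hasDerivAt_of_tendsto' (m := 0) (fun x _ => hasDerivAt_mul_test (i := i)
    (v := fun i x => (Real.exp (k * (x - y)) : ℝ) * vecLeft k P R i x)
    (hasDerivAt_left_zero h y x) (hasDerivAt_left_one h y x) (hp x)) hint]
  · simp
  · have h1 : Tendsto (fun x => -((Real.exp (k * (-x - y)) : ℝ) * vecLeft k P R i (-x) * p (-x)))
        atTop (𝓝 0) := by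
      refine tendsto_of_norm_le_exp hk (y := -y) (D := vecBound k P R * N) fun x => ?_
      rw [norm_neg, mul_assoc, norm_mul, norm_mul, Complex.norm_real,
        Real.norm_of_nonneg (Real.exp_nonneg _)]
      have := norm_vecLeft_le h i (-x)
      have := vecBound_pos k P R
      have := hN (-x)
      rw [show k * (-x - y) = -k * (x - -y) by ring]
      gcongr
    refine (h1.comp tendsto_neg_atBot_atTop).congr fun x => ?_
    simp

/-- The columns of the Green's function solve the equation with a point source. -/
theorem integral_adjRow_greenPos (h : Small k P R) (i j : Fin 2) (y : ℝ) {p p' : ℝ → ℂ} {N : ℝ}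
    (hp : ∀ x, HasDerivAt p (p' x) x) (hc : Continuous p') (hN : ∀ x, ‖p x‖ ≤ N)
    (hN' : ∀ x, ‖p' x‖ ≤ N) :
    ∫ x, adjRow k P R i (greenPos k P R x y 0 j) (greenPos k P R x y 1 j) (p x) (p' x) x
      = if i = j then p y else 0 := by
  obtain ⟨i1, e1⟩ := integral_adjRow_right h i y hp hc hN hN'
  obtain ⟨i2, e2⟩ := integral_adjRow_left h i y hp hc hN hN'
  set F := fun x => adjRow k P R i (greenPos k P R x y 0 j) (greenPos k P R x y 1 j)
    (p x) (p' x) x with hF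
  have c1 : Set.EqOn (fun x => dualRight k P R j y * ((Real.exp (-k * (x - y)) : ℝ)
      * adjRow k P R i (vecRight k P R 0 x) (vecRight k P R 1 x) (p x) (p' x) x)) F
      (Set.Ioi y) := fun x hx => by
    simp only [hF, greenPos_of_lt (Set.mem_Ioi.1 hx)]
    rw [← mul_assoc, ← adjRow_mul]
    congr 1 <;> (rw [neg_mul]; ring)
  have c2 : Set.EqOn (fun x => dualLeft k P R j y * ((Real.exp (k * (x - y)) : ℝ)
      * adjRow k P R i (vecLeft k P R 0 x) (vecLeft k P R 1 x) (p x) (p' x) x)) F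
      (Set.Iio y) := fun x hx => by
    simp only [hF, greenPos_of_gt (Set.mem_Iio.1 hx)]
    rw [← mul_assoc, ← adjRow_mul, show -(k * (y - x)) = k * (x - y) by ring]
    congr 1 <;> ring
  have j1 : IntegrableOn F (Set.Ioi y) := IntegrableOn.congr_fun (i1.const_mul _) c1 measurableSet_Ioi
  have j2 : IntegrableOn F (Set.Iic y) := by
    rw [integrableOn_Iic_iff_integrableOn_Iio]
    exact IntegrableOn.congr_fun ((i2.mono_set Set.Iio_subset_Iic_self).const_mul _) c2
      measurableSet_Iio
  have f1 : ∫ x in Set.Ioi y, F x = dualRight k P R j y * (vecRight k P R i y * p y) := by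
    rw [← setIntegral_congr_fun measurableSet_Ioi c1, integral_const_mul, e1]
  have f2 : ∫ x in Set.Iic y, F x = dualLeft k P R j y * (-(vecLeft k P R i y * p y)) := by
    rw [integral_Iic_eq_integral_Iio, ← setIntegral_congr_fun measurableSet_Iio c2,
      ← integral_Iic_eq_integral_Iio, integral_const_mul, e2]
  have hj := jump h i j y
  rw [← setIntegral_univ, ← Set.Iic_union_Ioi (a := y),
    setIntegral_union (Set.Iic_disjoint_Ioi le_rfl) measurableSet_Ioi j2 j1, f1, f2]
  split_ifs at hj ⊢
  · linear_combination p y * hj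
  · linear_combination p y * hj

end GreenProperties

/-! ### The Green's function as an operator on `L^2` -/

/-- The weak form of `[[∂ + k, -P], [-R, ∂ - k]] u = f`. -/
def LaxPos (k : ℝ) (P R : 𝓢(ℝ, ℂ)) (u f : ℝ → Fin 2 → ℂ) : Prop :=
  ∀ (φ : 𝓢(ℝ, ℂ)) (i : Fin 2),
    ∫ x, adjRow k P R i (u x 0) (u x 1) (φ x) (deriv φ x) x = ∫ x, f x i * φ x

/-- The integral operator with kernel `greenPos`. -/
def greenOp (k : ℝ) (P R : 𝓢(ℝ, ℂ)) (f : ℝ → Fin 2 → ℂ) (x : ℝ) : Fin 2 → ℂ :=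
  ∫ y, (greenPos k P R x y).mulVec (f y)

section

variable {k : ℝ} {P R : 𝓢(ℝ, ℂ)}

theorem memLp_exp_abs_sub (hk : 0 < k) (C x : ℝ) :
    MemLp (fun y => Real.exp (-(k * |x - y|)) * C) 2 := by
  rw [memLp_two_iff_integrable_sq (Continuous.aestronglyMeasurable (by fun_prop))]
  refine ((integrable_exp_abs_sub (k := 2 * k) (by positivity) x).mul_const (C ^ 2)).congr
    (Eventually.of_forall fun y => ?_)
  simp only
  rw [mul_pow, ← Real.exp_nat_mul]
  congr 2
  push_cast
  ring

theorem memLp_greenPos_row (h : Small k P R) (x : ℝ) (i j : Fin 2) :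
    MemLp (fun y => greenPos k P R x y i j) 2 := by
  refine (memLp_exp_abs_sub h.pos (greenBound k P R) x).of_le
    ((measurable_greenPos h i j).comp measurable_prodMk_left).aestronglyMeasurable
    (Eventually.of_forall fun y => ?_)
  refine (norm_greenPos_le h x y i j).trans (le_abs_self _)

theorem integrable_greenPos_mul (h : Small k P R) {g : ℝ → ℂ} (hg : MemLp g 2) (x : ℝ)
    (i j : Fin 2) : Integrable fun y => greenPos k P R x y i j * g y :=
  (memLp_greenPos_row h x i j).integrable_mul hg

/-- The integral of a kernel against a vector-valued function, in components. -/
theorem integral_mulVec_apply {G : ℝ → Matrix (Fin 2) (Fin 2) ℂ} {f : ℝ → Fin 2 → ℂ}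
    (h : ∀ i j, Integrable fun y => G y i j * f y j) (i : Fin 2) :
    (∫ y, (G y).mulVec (f y)) i = ∑ j, ∫ y, G y i j * f y j := by
  rw [← integral_finsetSum _ fun j _ => h i j, eval_integral]
  · rfl
  · intro i
    refine (integrable_finsetSum Finset.univ fun j _ => h i j).congr
      (Eventually.of_forall fun y => ?_)
    simp [Matrix.mulVec, dotProduct]

theorem greenOp_apply (h : Small k P R) {f : ℝ → Fin 2 → ℂ} (hf : MemLp f 2) (x : ℝ)
    (i : Fin 2) : greenOp k P R f x i = ∑ j, ∫ y, greenPos k P R x y i j * f y j :=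
  integral_mulVec_apply (fun i j => integrable_greenPos_mul h (hf.eval j) x i j) i

theorem sq_integral_exp_mul_le (hk : 0 < k) {g : ℝ → ℝ} (hg : MemLp g 2) (x : ℝ) :
    (∫ y, Real.exp (-(k * |x - y|)) * g y) ^ 2
      ≤ (∫ y, Real.exp (-(k * |y|))) * ∫ y, Real.exp (-(k * |x - y|)) * g y ^ 2 := by
  have hw := integrable_exp_abs_sub hk x
  have hg2 := (memLp_two_iff_integrable_sq hg.1).1 hg
  have hE : ∀ y, Real.exp (-(k * |x - y|)) ≤ 1 := fun y => by
    rw [Real.exp_le_one_iff]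
    have := abs_nonneg (x - y)
    nlinarith
  have i1 : Integrable fun y => Real.exp (-(k * |x - y|)) * g y := by
    exact ((memLp_exp_abs_sub hk 1 x).integrable_mul hg).congr
      (Eventually.of_forall fun y => by simp)
  have i2 : Integrable fun y => Real.exp (-(k * |x - y|)) * g y ^ 2 := by
    refine hg2.bdd_mul (c := 1) (Continuous.aestronglyMeasurable (by fun_prop))
      (Eventually.of_forall fun y => ?_)
    rw [Real.norm_of_nonneg (Real.exp_nonneg _)]
    exact hE y
  have hS : ∫ y, Real.exp (-(k * |x - y|)) = ∫ y, Real.exp (-(k * |y|)) :=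
    integral_sub_left_eq_self (fun y => Real.exp (-(k * |y|))) volume x
  set S := ∫ y, Real.exp (-(k * |y|))
  set A := ∫ y, Real.exp (-(k * |x - y|)) * g y
  set B := ∫ y, Real.exp (-(k * |x - y|)) * g y ^ 2
  have hS0 : 0 < S := by
    refine (integral_pos_iff_support_of_nonneg (fun y => Real.exp_nonneg _)
      (integrable_exp_abs hk)).2 ?_
    have : Function.support (fun y : ℝ => Real.exp (-(k * |y|))) = Set.univ :=
      Set.eq_univ_of_forall fun y => Real.exp_ne_zero _
    simp [this]
  have key : 0 ≤ ∫ y, Real.exp (-(k * |x - y|)) * (S * g y - A) ^ 2 :=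
    integral_nonneg fun y => mul_nonneg (Real.exp_nonneg _) (sq_nonneg _)
  have e : ∫ y, Real.exp (-(k * |x - y|)) * (S * g y - A) ^ 2
      = S ^ 2 * B - 2 * S * A * A + A ^ 2 * S := by
    have e0 : ∀ y, Real.exp (-(k * |x - y|)) * (S * g y - A) ^ 2
        = S ^ 2 * (Real.exp (-(k * |x - y|)) * g y ^ 2)
          - 2 * S * A * (Real.exp (-(k * |x - y|)) * g y)
          + A ^ 2 * Real.exp (-(k * |x - y|)) := fun y => by ring
    have j1 : Integrable fun y => S ^ 2 * (Real.exp (-(k * |x - y|)) * g y ^ 2)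
        - 2 * S * A * (Real.exp (-(k * |x - y|)) * g y) := (i2.const_mul _).sub (i1.const_mul _)
    simp only [e0]
    rw [integral_add j1 (hw.const_mul _),
      integral_sub (i2.const_mul _) (i1.const_mul _), integral_const_mul, integral_const_mul,
      integral_const_mul, hS]
  rw [e] at key
  have : 0 ≤ S * (S * B - A ^ 2) := by nlinarith
  nlinarith [(mul_nonneg_iff_of_pos_left hS0).1 this]

theorem memLp_integral_greenPos (h : Small k P R) {g : ℝ → ℂ} (hg : MemLp g 2) (i j : Fin 2) :
    MemLp (fun x => ∫ y, greenPos k P R x y i j * g y) 2 := by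
  have hk := h.pos
  have hm : AEStronglyMeasurable (fun x => ∫ y, greenPos k P R x y i j * g y) :=
    AEStronglyMeasurable.integral_prod_right'
      (f := fun p : ℝ × ℝ => greenPos k P R p.1 p.2 i j * g p.2)
      ((measurable_greenPos h i j).aestronglyMeasurable.mul hg.1.comp_snd)
  rw [memLp_two_iff_integrable_sq_norm hm]
  have hg2 := (memLp_two_iff_integrable_sq hg.norm.1).1 hg.norm
  have hH := ((integrable_exp_abs_prod hk hg2).integral_prod_left).const_mul
    (greenBound k P R ^ 2 * ∫ y, Real.exp (-(k * |y|)))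
  refine hH.mono' (hm.norm.pow 2) (Eventually.of_forall fun x => ?_)
  have h1 : ‖∫ y, greenPos k P R x y i j * g y‖
      ≤ greenBound k P R * ∫ y, Real.exp (-(k * |x - y|)) * ‖g y‖ := by
    rw [← integral_const_mul]
    refine norm_integral_le_of_norm_le ?_ (Eventually.of_forall fun y => ?_)
    · have := (memLp_exp_abs_sub hk (greenBound k P R) x).integrable_mul hg.norm
      refine this.congr (Eventually.of_forall fun y => ?_)
      simp only [Pi.mul_apply]
      ring
    · rw [norm_mul, ← mul_assoc, mul_comm (greenBound k P R)]
      exact mul_le_mul_of_nonneg_right (norm_greenPos_le h x y i j) (norm_nonneg _)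
  rw [Real.norm_of_nonneg (by positivity)]
  calc _ ≤ (greenBound k P R * ∫ y, Real.exp (-(k * |x - y|)) * ‖g y‖) ^ 2 :=
        pow_le_pow_left₀ (norm_nonneg _) h1 2
    _ ≤ _ := by
        rw [mul_pow, mul_assoc]
        exact mul_le_mul_of_nonneg_left (sq_integral_exp_mul_le hk hg.norm x) (sq_nonneg _)

theorem memLp_greenOp (h : Small k P R) {f : ℝ → Fin 2 → ℂ} (hf : MemLp f 2) :
    MemLp (greenOp k P R f) 2 := by
  refine MemLp.of_eval fun i => ?_
  have : (fun x => greenOp k P R f x i)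
      = fun x => ∑ j, ∫ y, greenPos k P R x y i j * f y j :=
    funext fun x => greenOp_apply h hf x i
  rw [this]
  exact memLp_finsetSum _ fun j _ => memLp_integral_greenPos h (hf.eval j) i j

theorem memLp_two_deriv (φ : 𝓢(ℝ, ℂ)) : MemLp (fun x => deriv φ x) 2 :=
  (SchwartzMap.derivCLM ℂ ℂ φ).memLp 2 volume

theorem integrable_adjRow_greenPos (h : Small k P R) {g : ℝ → ℂ} (hg : MemLp g 2)
    (φ : 𝓢(ℝ, ℂ)) (i j : Fin 2) :
    Integrable (fun p : ℝ × ℝ => adjRow k P R i (greenPos k P R p.1 p.2 0 j)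
      (greenPos k P R p.1 p.2 1 j) (φ p.1) (deriv φ p.1) p.1 * g p.2)
      (volume.prod volume) := by
  have hk := h.pos
  set N : ℝ → ℝ := fun x => ‖φ x‖ + ‖deriv φ x‖ with hN
  have hN2 : MemLp N 2 := (φ.memLp 2 volume).norm.add (memLp_two_deriv φ).norm
  have i1 := integrable_exp_abs_prod hk ((memLp_two_iff_integrable_sq hg.norm.1).1 hg.norm)
  have i2 := integrable_exp_abs_prod' hk ((memLp_two_iff_integrable_sq hN2.1).1 hN2)
  set C := greenBound k P R * (1 + k + supNorm P + supNorm R) with hC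
  have hC0 : 0 ≤ C := by
    have := greenBound_nonneg k P R
    have := supNorm_nonneg P
    have := supNorm_nonneg R
    positivity
  refine ((i1.add i2).const_mul C).mono' ?_ (Eventually.of_forall fun p => ?_)
  · refine AEStronglyMeasurable.mul ?_ hg.1.comp_snd
    have m0 := measurable_greenPos h 0 j
    have m1 := measurable_greenPos h 1 j
    have mP : Measurable fun p : ℝ × ℝ => P p.1 := P.continuous.measurable.comp measurable_fst
    have mR : Measurable fun p : ℝ × ℝ => R p.1 := R.continuous.measurable.comp measurable_fst
    have mφ : Measurable fun p : ℝ × ℝ => φ p.1 := φ.continuous.measurable.comp measurable_fst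
    have mφ' : Measurable fun p : ℝ × ℝ => deriv φ p.1 :=
      (SchwartzMap.derivCLM ℂ ℂ φ).continuous.measurable.comp measurable_fst
    refine Measurable.aestronglyMeasurable ?_
    fin_cases i
    · exact (m0.mul (mφ'.neg.add (mφ.const_mul _))).sub ((mP.mul m1).mul mφ)
    · exact (m1.mul (mφ'.neg.sub (mφ.const_mul _))).sub ((mR.mul m0).mul mφ)
  · have h1 := norm_adjRow_le (P := P) (R := R) (k := k) hk i (x := p.1) (N := N p.1)
      (norm_greenPos_le h p.1 p.2 0 j) (norm_greenPos_le h p.1 p.2 1 j)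
      (p := φ p.1) (p' := deriv φ p.1) (by simp [hN]) (by simp [hN])
    rw [norm_mul]
    simp only [Pi.add_apply]
    set e := Real.exp (-(k * |p.1 - p.2|))
    have he : 0 ≤ e := Real.exp_nonneg _
    calc _ ≤ e * greenBound k P R * (N p.1 * (1 + k + supNorm P + supNorm R)) * ‖g p.2‖ :=
          mul_le_mul_of_nonneg_right h1 (norm_nonneg _)
      _ = C * (e * (N p.1 * ‖g p.2‖)) := by rw [hC]; ring
      _ ≤ C * (e * (‖g p.2‖ ^ 2 + N p.1 ^ 2)) := by
          refine mul_le_mul_of_nonneg_left (mul_le_mul_of_nonneg_left ?_ he) hC0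
          nlinarith [sq_nonneg (‖g p.2‖ - N p.1), sq_nonneg (‖g p.2‖), sq_nonneg (N p.1)]
      _ = _ := by ring

theorem exists_schwartz_bound (φ : 𝓢(ℝ, ℂ)) :
    ∃ N, (∀ x, ‖φ x‖ ≤ N) ∧ ∀ x, ‖deriv φ x‖ ≤ N :=
  ⟨max (supNorm φ) (supNorm (SchwartzMap.derivCLM ℂ ℂ φ)),
    fun x => (norm_le_supNorm φ x).trans (le_max_left _ _),
    fun x => (norm_le_supNorm (SchwartzMap.derivCLM ℂ ℂ φ) x).trans (le_max_right _ _)⟩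

theorem integral_swap_greenPos (h : Small k P R) {g : ℝ → ℂ} (hg : MemLp g 2)
    (φ : 𝓢(ℝ, ℂ)) (i j : Fin 2) :
    ∫ x, ∫ y, adjRow k P R i (greenPos k P R x y 0 j)
      (greenPos k P R x y 1 j) (φ x) (deriv φ x) x * g y
      = ∫ y, (if i = j then g y * φ y else 0) := by
  obtain ⟨N, hN, hN'⟩ := exists_schwartz_bound φ
  rw [integral_integral_swap (integrable_adjRow_greenPos h hg φ i j)]
  refine integral_congr_ae (Eventually.of_forall fun y => ?_)
  simp only
  rw [integral_mul_const, integral_adjRow_greenPos h i j y (fun x => φ.hasDerivAt x)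
    (SchwartzMap.derivCLM ℂ ℂ φ).continuous hN hN']
  split_ifs <;> ring

theorem laxPos_greenOp (h : Small k P R) {f : ℝ → Fin 2 → ℂ} (hf : MemLp f 2) :
    LaxPos k P R (greenOp k P R f) f := by
  intro φ i
  have e : ∀ x, adjRow k P R i (greenOp k P R f x 0) (greenOp k P R f x 1) (φ x) (deriv φ x) x
      = ∑ j, ∫ y, adjRow k P R i (greenPos k P R x y 0 j)
        (greenPos k P R x y 1 j) (φ x) (deriv φ x) x * f y j := fun x => by
    have hi : ∀ j, ∫ y, adjRow k P R i (greenPos k P R x y 0 j)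
        (greenPos k P R x y 1 j) (φ x) (deriv φ x) x * f y j
        = adjRow k P R i (∫ y, greenPos k P R x y 0 j * f y j)
          (∫ y, greenPos k P R x y 1 j * f y j) (φ x) (deriv φ x) x := fun j => by
      have i0 := integrable_greenPos_mul h (hf.eval j) x 0 j
      have i1 := integrable_greenPos_mul h (hf.eval j) x 1 j
      fin_cases i
      · simp only [adjRow, Fin.zero_eta, Matrix.cons_val_zero]
        rw [← integral_mul_const, ← integral_const_mul, ← integral_mul_const, ← integral_sub]
        · refine integral_congr_ae (Eventually.of_forall fun y => ?_)
          simp only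
          ring
        · exact i0.mul_const _
        · exact (i1.const_mul _).mul_const _
      · simp only [adjRow, Fin.mk_one, Matrix.cons_val_one, Matrix.cons_val_fin_one]
        rw [← integral_mul_const, ← integral_const_mul, ← integral_mul_const, ← integral_sub]
        · refine integral_congr_ae (Eventually.of_forall fun y => ?_)
          simp only
          ring
        · exact i1.mul_const _
        · exact (i0.const_mul _).mul_const _
    rw [greenOp_apply h hf, greenOp_apply h hf]
    simp only [hi, Fin.sum_univ_two]
    fin_cases i <;> simp [adjRow] <;> ring
  simp only [e]
  rw [integral_finsetSum]
  · simp only [integral_swap_greenPos h (hf.eval _) φ]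
    rw [Finset.sum_eq_single i]
    · simp
    · intro j _ hj
      simp [hj.symm]
    · simp
  · intro j _
    exact (integrable_adjRow_greenPos h (hf.eval j) φ i j).integral_prod_left

/-! ### Uniqueness of square-integrable solutions -/

theorem memLp_schwartz_mul (Q φ : 𝓢(ℝ, ℂ)) : MemLp (fun x => Q x * φ x) 2 :=
  (φ.memLp 2 volume).of_le_mul (c := supNorm Q)
    (Q.continuous.mul φ.continuous).aestronglyMeasurable (Eventually.of_forall fun x => by
      rw [norm_mul]
      exact mul_le_mul_of_nonneg_right (norm_le_supNorm Q x) (norm_nonneg _))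

theorem integrable_adjRow (k : ℝ) (P R : 𝓢(ℝ, ℂ)) {w : ℝ → Fin 2 → ℂ} (hw : MemLp w 2)
    (φ : 𝓢(ℝ, ℂ)) (i : Fin 2) :
    Integrable fun x => adjRow k P R i (w x 0) (w x 1) (φ x) (deriv φ x) x := by
  have h0 := hw.eval 0
  have h1 := hw.eval 1
  have hφ := (φ.memLp 2 volume).const_mul (k : ℂ)
  have hφ' := (memLp_two_deriv φ).neg
  fin_cases i
  · refine ((h0.integrable_mul (hφ'.add hφ)).sub
      (h1.integrable_mul (memLp_schwartz_mul P φ))).congr (Eventually.of_forall fun x => ?_)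
    simp [adjRow]
    ring
  · refine ((h1.integrable_mul (hφ'.sub hφ)).sub
      (h0.integrable_mul (memLp_schwartz_mul R φ))).congr (Eventually.of_forall fun x => ?_)
    simp [adjRow]
    ring

theorem LaxPos.sub {u v f : ℝ → Fin 2 → ℂ} (hu : LaxPos k P R u f) (hv : LaxPos k P R v f)
    (hu2 : MemLp u 2) (hv2 : MemLp v 2) : LaxPos k P R (fun x => u x - v x) 0 := by
  intro φ i
  have h1 := integrable_adjRow k P R hu2 φ i
  have h2 := integrable_adjRow k P R hv2 φ i
  have e : ∀ x, adjRow k P R i ((u x - v x) 0) ((u x - v x) 1) (φ x) (deriv φ x) x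
      = adjRow k P R i (u x 0) (u x 1) (φ x) (deriv φ x) x
        - adjRow k P R i (v x 0) (v x 1) (φ x) (deriv φ x) x := fun x => by
    fin_cases i <;> simp [adjRow] <;> ring
  simp only [e]
  rw [integral_sub h1 h2, hu φ i, hv φ i]
  simp

/-- A function that is orthogonal to all derivatives of test functions, and integrable on a set of
infinite measure, vanishes. -/
theorem ae_eq_zero_of_integral_deriv_mul {h : ℝ → ℂ} (hl : LocallyIntegrable h)
    (hd : ∀ χ : ℝ → ℝ, ContDiff ℝ (⊤ : ℕ∞) χ → HasCompactSupport χ → ∫ x, deriv χ x • h x = 0)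
    {S : Set ℝ} (hS : volume S = ⊤) (hi : IntegrableOn h S) : ∀ᵐ x, h x = 0 := by
  let b : ContDiffBump (0 : ℝ) := default
  set g₀ : ℝ → ℝ := b.normed volume with hg₀
  have hg₀c : ContDiff ℝ (⊤ : ℕ∞) g₀ := b.contDiff_normed
  have hg₀s : HasCompactSupport g₀ := b.hasCompactSupport_normed
  have hg₀i : ∫ x, g₀ x = 1 := b.integral_normed
  set c : ℂ := ∫ x, g₀ x • h x with hc
  have key : ∀ g : ℝ → ℝ, ContDiff ℝ (⊤ : ℕ∞) g → HasCompactSupport g →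
      ∫ x, g x • h x = ∫ x, g x • c := by
    intro g hg hgs
    set m := ∫ x, g x with hm
    set G : ℝ → ℝ := fun x => g x - m * g₀ x with hG
    have hGc : ContDiff ℝ (⊤ : ℕ∞) G := hg.sub (contDiff_const.mul hg₀c)
    have hGs : HasCompactSupport G := hgs.sub hg₀s.mul_left
    have hgi : Integrable g := hg.continuous.integrable_of_hasCompactSupport hgs
    have hg₀i' : Integrable g₀ := hg₀c.continuous.integrable_of_hasCompactSupport hg₀s
    have hGi : Integrable G := hgi.sub (hg₀i'.const_mul m)
    have hG0 : ∫ x, G x = 0 := by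
      rw [hG, integral_sub hgi (hg₀i'.const_mul m), integral_const_mul, hg₀i]
      simp [hm]
    obtain ⟨L, hL⟩ := hGs.isCompact.isBounded.subset_closedBall 0
    have hGL : ∀ x, L < |x| → G x = 0 := fun x hx => by
      by_contra hne
      have := hL (subset_tsupport G hne)
      rw [Metric.mem_closedBall, dist_zero_right, Real.norm_eq_abs] at this
      linarith
    set χ : ℝ → ℝ := fun x => ∫ y in Set.Iic x, G y with hχ
    have hχd : ∀ x, HasDerivAt χ (G x) x := fun x => by
      have h1 : χ = fun x => (∫ y in Set.Iic 0, G y) + ∫ y in (0 : ℝ)..x, G y := by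
        funext x
        rw [← intervalIntegral.integral_Iic_sub_Iic hGi.integrableOn hGi.integrableOn]
        ring
      rw [h1]
      exact (intervalIntegral.integral_hasDerivAt_right (hGc.continuous.intervalIntegrable _ _)
        hGc.continuous.stronglyMeasurable.stronglyMeasurableAtFilter
        hGc.continuous.continuousAt).const_add _
    have hχc : ContDiff ℝ (⊤ : ℕ∞) χ := by
      rw [contDiff_infty_iff_deriv]
      refine ⟨fun x => (hχd x).differentiableAt, ?_⟩
      rw [funext fun x => (hχd x).deriv]
      exact hGc
    have hχs : HasCompactSupport χ := by
      refine HasCompactSupport.intro (isCompact_closedBall (0 : ℝ) L) fun x hx => ?_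
      rw [Metric.mem_closedBall, dist_zero_right, Real.norm_eq_abs, not_le] at hx
      rcases lt_or_ge x 0 with hx0 | hx0
      · refine setIntegral_eq_zero_of_forall_eq_zero fun y hy => hGL y ?_
        rw [abs_of_neg hx0] at hx
        rw [abs_of_neg (lt_of_le_of_lt hy hx0)]
        have : y ≤ x := hy
        linarith
      · have h1 : ∫ y in Set.Ioi x, G y = 0 :=
          setIntegral_eq_zero_of_forall_eq_zero fun y hy => hGL y (by
            rw [abs_of_nonneg hx0] at hx
            have : x < y := hy
            rw [abs_of_nonneg (by linarith)]
            linarith)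
        have h2 := setIntegral_union (Set.Iic_disjoint_Ioi (le_refl x)) measurableSet_Ioi
          hGi.integrableOn hGi.integrableOn
        rw [Set.Iic_union_Ioi, setIntegral_univ, hG0, h1, add_zero] at h2
        exact h2.symm
    have h3 := hd χ hχc hχs
    have e1 : Integrable fun x => g x • h x :=
      hl.integrable_smul_left_of_hasCompactSupport hg.continuous hgs
    have e2 : Integrable fun x => g₀ x • h x :=
      hl.integrable_smul_left_of_hasCompactSupport hg₀c.continuous hg₀s
    have e3 : ∀ x, deriv χ x • h x = g x • h x - m • (g₀ x • h x) := fun x => by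
      rw [(hχd x).deriv, hG]
      simp only [sub_smul, mul_smul]
    simp only [e3] at h3
    rw [integral_sub e1 (show Integrable fun x => m • (g₀ x • h x) from e2.smul m), integral_smul, sub_eq_zero] at h3
    rw [h3, integral_smul_const]
  have hae : ∀ᵐ x, h x = c := by
    refine ae_eq_of_integral_contDiff_smul_eq hl (locallyIntegrable_const c) fun g hg hgs => ?_
    exact key g hg hgs
  have hc0 : c = 0 := by
    have h1 : IntegrableOn (fun _ : ℝ => c) S :=
      hi.congr (ae_restrict_of_ae hae)
    rw [integrableOn_const_iff] at h1
    rcases h1 with h1 | h1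
    · exact enorm_eq_zero.1 h1
    · rw [hS] at h1
      exact absurd h1 (lt_irrefl _)
  filter_upwards [hae] with x hx
  rw [hx, hc0]

theorem integral_deriv_mul_eq_zero {w : ℝ → Fin 2 → ℂ} (hw : MemLp w 2)
    (hl : LaxPos k P R w 0) {v : Fin 2 → ℝ → ℂ} (hv : ∀ i, ContDiff ℝ (⊤ : ℕ∞) (v i))
    (h0 : ∀ x, HasDerivAt (v 0) (-k * v 0 x + P x * v 1 x) x)
    (h1 : ∀ x, HasDerivAt (v 1) (k * v 1 x + R x * v 0 x) x) {χ : ℝ → ℝ}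
    (hχ : ContDiff ℝ (⊤ : ℕ∞) χ) (hχs : HasCompactSupport χ) :
    ∫ x, deriv χ x • (w x 0 * v 1 x - w x 1 * v 0 x) = 0 := by
  have hχ' : ContDiff ℝ (⊤ : ℕ∞) fun x => (χ x : ℂ) := Complex.ofRealCLM.contDiff.comp hχ
  have hχs' : HasCompactSupport fun x => (χ x : ℂ) :=
    hχs.comp_left (g := fun x : ℝ => (x : ℂ)) Complex.ofReal_zero
  have hχd : ∀ x, HasDerivAt (fun x => (χ x : ℂ)) ((deriv χ x : ℝ) : ℂ) x := fun x =>
    (hχ.differentiable (by simp) x).hasDerivAt.ofReal_comp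
  let φ₀ : 𝓢(ℝ, ℂ) := HasCompactSupport.toSchwartzMap (f := fun x => (χ x : ℂ) * v 1 x)
    hχs'.mul_right (hχ'.mul (hv 1))
  let φ₁ : 𝓢(ℝ, ℂ) := HasCompactSupport.toSchwartzMap (f := fun x => (χ x : ℂ) * -v 0 x)
    hχs'.mul_right (hχ'.mul (hv 0).neg)
  have e0 : ∀ x, φ₀ x = χ x * v 1 x := fun x => rfl
  have e1 : ∀ x, φ₁ x = χ x * -v 0 x := fun x => rfl
  have d0 : ∀ x, deriv φ₀ x = deriv χ x * v 1 x + χ x * (k * v 1 x + R x * v 0 x) := fun x =>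
    ((hχd x).mul (h1 x)).deriv
  have d1 : ∀ x, deriv φ₁ x = deriv χ x * -v 0 x + χ x * -(-k * v 0 x + P x * v 1 x) := fun x =>
    ((hχd x).mul (h0 x).neg).deriv
  have s0 := hl φ₀ 0
  have s1 := hl φ₁ 1
  simp only [Pi.zero_apply, zero_mul, integral_zero] at s0 s1
  have s2 : ∫ x, (adjRow k P R 0 (w x 0) (w x 1) (φ₀ x) (deriv φ₀ x) x
      + adjRow k P R 1 (w x 0) (w x 1) (φ₁ x) (deriv φ₁ x) x) = 0 := by
    rw [integral_add (integrable_adjRow k P R hw φ₀ 0) (integrable_adjRow k P R hw φ₁ 1), s0, s1,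
      add_zero]
  rw [← neg_eq_zero, ← integral_neg, ← s2]
  refine integral_congr_ae (Eventually.of_forall fun x => ?_)
  simp only [adjRow, Matrix.cons_val_zero, Matrix.cons_val_one, Matrix.cons_val_fin_one,
    e0, e1, d0, d1, Complex.real_smul]
  ring

theorem ae_wronskian_eq_zero {w : ℝ → Fin 2 → ℂ} (hw : MemLp w 2)
    (hl : LaxPos k P R w 0) {v : Fin 2 → ℝ → ℂ} (hv : ∀ i, ContDiff ℝ (⊤ : ℕ∞) (v i))
    (h0 : ∀ x, HasDerivAt (v 0) (-k * v 0 x + P x * v 1 x) x)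
    (h1 : ∀ x, HasDerivAt (v 1) (k * v 1 x + R x * v 0 x) x) {S : Set ℝ}
    (hS : volume S = ⊤) (hi : ∀ i, MemLp (v i) 2 (volume.restrict S)) :
    ∀ᵐ x, w x 0 * v 1 x - w x 1 * v 0 x = 0 := by
  have hloc : ∀ i, LocallyIntegrable fun x => w x i := fun i =>
    (hw.eval i).locallyIntegrable (by norm_num)
  refine ae_eq_zero_of_integral_deriv_mul ?_ (fun χ hχ hχs =>
    integral_deriv_mul_eq_zero hw hl hv h0 h1 hχ hχs) hS ?_
  · refine LocallyIntegrable.sub ?_ ?_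
    · exact (hloc 0).mul_continuous (hv 1).continuous
    · exact (hloc 1).mul_continuous (hv 0).continuous
  · exact (((hw.eval 0).restrict S).integrable_mul (hi 1)).sub
      (((hw.eval 1).restrict S).integrable_mul (hi 0))

end

section

variable {k : ℝ} {P R : 𝓢(ℝ, ℂ)}

theorem memLp_two_exp_mul {m B : ℝ} {u : ℝ → ℂ} (hu : Continuous u) (hB : ∀ x, ‖u x‖ ≤ B)
    {S : Set ℝ} (hS : IntegrableOn (fun x => Real.exp (2 * m * x)) S) :
    MemLp (fun x => ((Real.exp (m * (x - 0)) : ℝ) : ℂ) * u x) 2 (volume.restrict S) := by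
  have hc : Continuous fun x : ℝ => ((Real.exp (m * (x - 0)) : ℝ) : ℂ) * u x := by fun_prop
  rw [memLp_two_iff_integrable_sq_norm hc.aestronglyMeasurable]
  refine (hS.mul_const (B ^ 2)).mono' (hc.norm.pow 2).aestronglyMeasurable
    (Eventually.of_forall fun x => ?_)
  rw [Real.norm_of_nonneg (by positivity), norm_mul, Complex.norm_real,
    Real.norm_of_nonneg (Real.exp_nonneg _), mul_pow, ← Real.exp_nat_mul]
  have e : ((2 : ℕ) : ℝ) * (m * (x - 0)) = 2 * m * x := by push_cast; ring
  rw [e]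
  exact mul_le_mul_of_nonneg_left (pow_le_pow_left₀ (norm_nonneg _) (hB x) 2) (Real.exp_nonneg _)

theorem contDiff_exp_mul (m : ℝ) {u : ℝ → ℂ} (hu : ContDiff ℝ (⊤ : ℕ∞) u) :
    ContDiff ℝ (⊤ : ℕ∞) fun x => ((Real.exp (m * (x - 0)) : ℝ) : ℂ) * u x :=
  (Complex.ofRealCLM.contDiff.comp (by fun_prop : ContDiff ℝ (⊤ : ℕ∞)
    fun x : ℝ => Real.exp (m * (x - 0)))).mul hu

theorem contDiff_vecRight (h : Small k P R) (i : Fin 2) : ContDiff ℝ (⊤ : ℕ∞) (vecRight k P R i) := by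
  fin_cases i
  · exact contDiff_jostA h
  · exact contDiff_jostB h

theorem contDiff_vecLeft (h : Small k P R) (i : Fin 2) : ContDiff ℝ (⊤ : ℕ∞) (vecLeft k P R i) := by
  fin_cases i
  · exact contDiff_jostC h
  · exact contDiff_jostD h

theorem LaxPos.ae_eq_zero (h : Small k P R) {w : ℝ → Fin 2 → ℂ} (hw : MemLp w 2)
    (hl : LaxPos k P R w 0) : w =ᵐ[volume] 0 := by
  have hk := h.pos
  have h1 := ae_wronskian_eq_zero hw hl
    (v := fun i x => ((Real.exp (-k * (x - 0)) : ℝ) : ℂ) * vecRight k P R i x)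
    (fun i => contDiff_exp_mul (-k) (contDiff_vecRight h i)) (hasDerivAt_right_zero h 0)
    (hasDerivAt_right_one h 0) (S := Set.Ioi 0) Real.volume_Ioi fun i =>
      memLp_two_exp_mul (continuous_vecRight h i) (norm_vecRight_le h i)
        (integrableOn_exp_mul_Ioi (by linarith) 0)
  have h2 := ae_wronskian_eq_zero hw hl
    (v := fun i x => ((Real.exp (k * (x - 0)) : ℝ) : ℂ) * vecLeft k P R i x)
    (fun i => contDiff_exp_mul k (contDiff_vecLeft h i)) (hasDerivAt_left_zero h 0)
    (hasDerivAt_left_one h 0) (S := Set.Iic 0) Real.volume_Iic fun i =>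
      memLp_two_exp_mul (continuous_vecLeft h i) (norm_vecLeft_le h i)
        (integrableOn_exp_mul_Iic (by linarith) 0)
  filter_upwards [h1, h2] with x e1 e2
  have n1 : ((Real.exp (-k * (x - 0)) : ℝ) : ℂ) ≠ 0 := Complex.ofReal_ne_zero.2 (Real.exp_ne_zero _)
  have n2 : ((Real.exp (k * (x - 0)) : ℝ) : ℂ) ≠ 0 := Complex.ofReal_ne_zero.2 (Real.exp_ne_zero _)
  have f1 : w x 0 * jostB k P R x - w x 1 * jostA k P R x = 0 := by
    refine (mul_eq_zero.1 (?_ : ((Real.exp (-k * (x - 0)) : ℝ) : ℂ) * _ = 0)).resolve_left n1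
    rw [← e1]
    simp only [vecRight, Matrix.cons_val_zero, Matrix.cons_val_one, Matrix.cons_val_fin_one]
    ring
  have f2 : w x 0 * jostD k P R x - w x 1 * jostC k P R x = 0 := by
    refine (mul_eq_zero.1 (?_ : ((Real.exp (k * (x - 0)) : ℝ) : ℂ) * _ = 0)).resolve_left n2
    rw [← e2]
    simp only [vecLeft, Matrix.cons_val_zero, Matrix.cons_val_one, Matrix.cons_val_fin_one]
    ring
  have hW := wronskian_eq h x
  have hW0 := wronskian_ne_zero h
  funext i
  fin_cases i
  · refine (mul_eq_zero.1 (?_ : wronskian k P R * _ = 0)).resolve_left hW0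
    show wronskian k P R * w x 0 = 0
    rw [← hW]
    linear_combination jostA k P R x * f2 - jostC k P R x * f1
  · refine (mul_eq_zero.1 (?_ : wronskian k P R * _ = 0)).resolve_left hW0
    show wronskian k P R * w x 1 = 0
    rw [← hW]
    linear_combination jostB k P R x * f2 - jostD k P R x * f1

theorem LaxPos.congr {u v f : ℝ → Fin 2 → ℂ} (hu : LaxPos k P R u f) (huv : u =ᵐ[volume] v) :
    LaxPos k P R v f := by
  intro φ i
  rw [← hu φ i]
  refine integral_congr_ae ?_
  filter_upwards [huv] with x hx
  rw [hx]

theorem laxPos_iff (h : Small k P R) {f u : ℝ → Fin 2 → ℂ} (hf : MemLp f 2) (hu : MemLp u 2) :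
    LaxPos k P R u f ↔ u =ᵐ[volume] greenOp k P R f := by
  have hG := laxPos_greenOp h hf
  refine ⟨fun hl => ?_, fun he => hG.congr he.symm⟩
  have hG2 := memLp_greenOp h hf
  filter_upwards [LaxPos.ae_eq_zero h (hu.sub hG2) (hl.sub hG hu hG2)] with x hx
  exact sub_eq_zero.1 hx

end

/-! ### The Green's function of the Lax operator -/

section

variable {κ : ℂ} {q r : 𝓢(ℝ, ℂ)}

theorem IsGreenFunction.unique {G G' : ℝ → ℝ → Matrix (Fin 2) (Fin 2) ℂ}
    (h : IsGreenFunction κ q r G) (h' : IsGreenFunction κ q r G') : G = G' := by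
  have hD : Continuous fun p : ℝ × ℝ => G p.1 p.2 - G' p.1 p.2 :=
    (h.continuous_sub.sub h'.continuous_sub).congr fun p => by simp
  have hDij : ∀ i j, Continuous fun p : ℝ × ℝ => G p.1 p.2 i j - G' p.1 p.2 i j := fun i j =>
    (hD.matrix_elem i j)
  have key : ∀ (g : ℝ → ℝ), ContDiff ℝ (⊤ : ℕ∞) g → HasCompactSupport g → ∀ i j x,
      ∫ y, g y • (G x y i j - G' x y i j) = 0 := by
    intro g hg hgs i j
    have hg2 : MemLp (fun y => (g y : ℂ)) 2 :=
      (hg.continuous.memLp_of_hasCompactSupport hgs).ofReal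
    set f : ℝ → Fin 2 → ℂ := fun y => Pi.single j (g y : ℂ) with hf
    have hf2 : MemLp f 2 := MemLp.of_eval fun l => by
      by_cases hl : l = j
      · subst hl
        simpa [hf] using hg2
      · simp [hf, hl]
    have hu := h.memLp_apply f hf2
    have e1 := (h'.inverse f _ hf2 hu).1 ((h.inverse f _ hf2 hu).2 EventuallyEq.rfl)
    have hi : ∀ {K} (_ : IsGreenFunction κ q r K) x i l, Integrable fun y => K x y i l * f y l :=
      fun hK x i l => (hK.memLp_row x i l).integrable_mul (hf2.eval l)
    have hs : ∀ {K} (_ : IsGreenFunction κ q r K) x,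
        (∫ y, (K x y).mulVec (f y)) i = ∫ y, K x y i j * g y := fun hK x => by
      rw [integral_mulVec_apply (hi hK x), Finset.sum_eq_single j]
      · simp [hf]
      · intro l _ hl
        simp [hf, hl]
      · simp
    have e2 : (fun x => ∫ y, g y • (G x y i j - G' x y i j)) =ᵐ[volume] fun _ => 0 := by
      filter_upwards [e1] with x hx
      have e3 := congrFun hx i
      rw [hs h, hs h'] at e3
      have j1 : Integrable fun y => G x y i j * g y := by simpa [hf] using hi h x i j
      have j2 : Integrable fun y => G' x y i j * g y := by simpa [hf] using hi h' x i j
      rw [← sub_eq_zero, ← integral_sub j1 j2] at e3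
      rw [← e3]
      refine integral_congr_ae (Eventually.of_forall fun y => ?_)
      simp only [Complex.real_smul]
      ring
    have hc : Continuous fun x => ∫ y, g y • (G x y i j - G' x y i j) := by
      have e4 : ∀ x, ∫ y, g y • (G x y i j - G' x y i j)
          = ∫ y in tsupport g, g y • (G x y i j - G' x y i j) := fun x => by
        refine (setIntegral_eq_integral_of_forall_compl_eq_zero fun y hy => ?_).symm
        rw [image_eq_zero_of_notMem_tsupport hy, zero_smul]
      simp only [e4]
      refine continuous_parametric_integral_of_continuous ?_ hgs.isCompact
      exact (hg.continuous.comp continuous_snd).smul (hDij i j)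
    exact congrFun ((hc.ae_eq_iff_eq volume continuous_const).1 e2)
  funext x y
  ext i j
  have hx : Continuous fun y => G x y i j - G' x y i j :=
    (hDij i j).comp (Continuous.prodMk_right x)
  have := ae_eq_zero_of_integral_contDiff_smul_eq_zero (μ := volume) hx.locallyIntegrable
    fun g hg hgs => key g hg hgs i j x
  exact sub_eq_zero.1 (congrFun ((hx.ae_eq_iff_eq volume continuous_const).1 this) y)

theorem green_eq {G : ℝ → ℝ → Matrix (Fin 2) (Fin 2) ℂ} (h : IsGreenFunction κ q r G) :
    green κ q r = G := by
  have hex : ∃ G, IsGreenFunction κ q r G := ⟨G, h⟩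
  rw [green, dif_pos hex]
  exact hex.choose_spec.unique h

theorem spectral_eq (him : (Complex.I * κ ^ 2).im = 0) :
    Complex.I * κ ^ 2 = ((Complex.I * κ ^ 2).re : ℝ) := by
  apply Complex.ext <;> simp [him]

theorem laxEquation_iff_pos (him : (Complex.I * κ ^ 2).im = 0) {u f : ℝ → Fin 2 → ℂ} :
    LaxEquation κ q r u f ↔ LaxPos (Complex.I * κ ^ 2).re (κ • q) (κ • r) u f := by
  simp only [LaxEquation, LaxPos, Fin.forall_fin_two]
  rw [spectral_eq him]
  rfl

theorem laxEquation_iff_neg (him : (Complex.I * κ ^ 2).im = 0) {u f : ℝ → Fin 2 → ℂ} :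
    LaxEquation κ q r u f ↔ LaxPos (-(Complex.I * κ ^ 2).re) (κ • r) (κ • q)
      (fun x i => u x i.rev) (fun x i => f x i.rev) := by
  have r0 : (0 : Fin 2).rev = 1 := rfl
  have r1 : (1 : Fin 2).rev = 0 := rfl
  simp only [LaxEquation, LaxPos, Fin.forall_fin_two, r0, r1]
  rw [spectral_eq him]
  refine forall_congr' fun φ => and_comm.trans ?_
  simp only [adjRow, Matrix.cons_val_zero, Matrix.cons_val_one, Matrix.cons_val_fin_one,
    Complex.ofReal_re, Complex.ofReal_neg, neg_mul, sub_neg_eq_add, ← sub_eq_add_neg,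
    smul_apply, smul_eq_mul]

theorem isGreenFunction_pos (him : (Complex.I * κ ^ 2).im = 0)
    (h : Small (Complex.I * κ ^ 2).re (κ • q) (κ • r)) :
    IsGreenFunction κ q r (greenPos (Complex.I * κ ^ 2).re (κ • q) (κ • r)) where
  continuous_sub := by
    refine (continuous_greenPos_sub h).congr fun p => ?_
    simp only [freeGreen, freePos, if_pos h.pos, abs_of_pos h.pos]
  memLp_row := memLp_greenPos_row h
  memLp_apply f hf := memLp_greenOp h hf
  inverse f u hf hu := (laxEquation_iff_pos him).trans (laxPos_iff h hf hu)

theorem MemLp.rev {f : ℝ → Fin 2 → ℂ} (hf : MemLp f 2) :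
    MemLp (fun x i => f x (Fin.rev i)) 2 :=
  MemLp.of_eval fun i => hf.eval i.rev

theorem integral_greenPos_rev {k : ℝ} {P R : 𝓢(ℝ, ℂ)} (h : Small k P R) {f : ℝ → Fin 2 → ℂ}
    (hf : MemLp f 2) (x : ℝ) :
    ∫ y, ((greenPos k P R x y).submatrix Fin.rev Fin.rev).mulVec (f y)
      = fun i => greenOp k P R (fun y i => f y i.rev) x i.rev := by
  funext i
  rw [greenOp_apply h (MemLp.rev hf), integral_mulVec_apply, Fin.sum_univ_two, Fin.sum_univ_two,
    add_comm]
  · rfl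
  · intro i j
    exact integrable_greenPos_mul h (hf.eval j) x i.rev j.rev

theorem isGreenFunction_neg (him : (Complex.I * κ ^ 2).im = 0)
    (h : Small (-(Complex.I * κ ^ 2).re) (κ • r) (κ • q)) :
    IsGreenFunction κ q r fun x y =>
      (greenPos (-(Complex.I * κ ^ 2).re) (κ • r) (κ • q) x y).submatrix Fin.rev Fin.rev where
  continuous_sub := by
    have hk : (Complex.I * κ ^ 2).re < 0 := neg_pos.1 h.pos
    refine ((continuous_greenPos_sub h).matrix_submatrix Fin.rev Fin.rev).congr fun p => ?_
    ext i j
    simp only [freeGreen, freePos, if_neg hk.not_gt, abs_of_neg hk, Matrix.submatrix_apply,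
      Matrix.sub_apply]
    fin_cases i <;> fin_cases j <;> rfl
  memLp_row x i j := memLp_greenPos_row h x i.rev j.rev
  memLp_apply f hf := by
    simp only [integral_greenPos_rev h hf]
    exact MemLp.rev (memLp_greenOp h (MemLp.rev hf))
  inverse f u hf hu := by
    rw [laxEquation_iff_neg him, laxPos_iff h (MemLp.rev hf) (MemLp.rev hu)]
    simp only [integral_greenPos_rev h hf]
    refine ⟨fun e => ?_, fun e => ?_⟩ <;> filter_upwards [e] with x hx
    · funext i
      have := congrFun hx i.rev
      simpa using this
    · funext i
      have := congrFun hx i.rev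
      simpa using this

theorem greenPos_diag (k : ℝ) (P R : 𝓢(ℝ, ℂ)) (x : ℝ) (i j : Fin 2) :
    greenPos k P R x x i j = (vecRight k P R i x * dualRight k P R j x
        + vecLeft k P R i x * dualLeft k P R j x) / 2 := by
  simp [greenPos]

theorem greenPos_diag_zero_one (k : ℝ) (P R : 𝓢(ℝ, ℂ)) (x : ℝ) :
    greenPos k P R x x 0 1 = diag12 k P R x := by
  simp only [greenPos_diag, diag12, vecRight, vecLeft, dualRight, dualLeft, Matrix.cons_val_zero,
    Matrix.cons_val_one, Matrix.cons_val_fin_one]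
  ring

theorem greenPos_diag_one_zero (k : ℝ) (P R : 𝓢(ℝ, ℂ)) (x : ℝ) :
    greenPos k P R x x 1 0 = diag21 k P R x := by
  simp only [greenPos_diag, diag21, vecRight, vecLeft, dualRight, dualLeft, Matrix.cons_val_zero,
    Matrix.cons_val_one, Matrix.cons_val_fin_one]
  ring

theorem greenPos_diag_sub (k : ℝ) (P R : 𝓢(ℝ, ℂ)) (x : ℝ) :
    greenPos k P R x x 0 0 - greenPos k P R x x 1 1 = diagDiff k P R x := by
  simp only [greenPos_diag, diagDiff, vecRight, vecLeft, dualRight, dualLeft, Matrix.cons_val_zero,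
    Matrix.cons_val_one, Matrix.cons_val_fin_one]
  ring

theorem sgn_of_pos (h : 0 < (Complex.I * κ ^ 2).re) : sgn κ = 1 := by
  simp only [sgn, Real.sign_of_pos h, Complex.ofReal_one]

theorem sgn_of_neg (h : (Complex.I * κ ^ 2).re < 0) : sgn κ = -1 := by
  simp only [sgn, Real.sign_of_neg h, Complex.ofReal_neg, Complex.ofReal_one]

theorem diag_of_pos (him : (Complex.I * κ ^ 2).im = 0)
    (h : Small (Complex.I * κ ^ 2).re (κ • q) (κ • r)) (x : ℝ) :
    g12 κ q r x = diag12 (Complex.I * κ ^ 2).re (κ • q) (κ • r) x ∧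
      g21 κ q r x = diag21 (Complex.I * κ ^ 2).re (κ • q) (κ • r) x ∧
      gam κ q r x + 1 = diagDiff (Complex.I * κ ^ 2).re (κ • q) (κ • r) x := by
  simp only [g12, g21, gam, green_eq (isGreenFunction_pos him h), sgn_of_pos h.pos,
    greenPos_diag_zero_one, greenPos_diag_one_zero, greenPos_diag_sub]
  exact ⟨by ring, by ring, by ring⟩

theorem diag_of_neg (him : (Complex.I * κ ^ 2).im = 0)
    (h : Small (-(Complex.I * κ ^ 2).re) (κ • r) (κ • q)) (x : ℝ) :
    g12 κ q r x = -diag21 (-(Complex.I * κ ^ 2).re) (κ • r) (κ • q) x ∧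
      g21 κ q r x = -diag12 (-(Complex.I * κ ^ 2).re) (κ • r) (κ • q) x ∧
      gam κ q r x + 1 = diagDiff (-(Complex.I * κ ^ 2).re) (κ • r) (κ • q) x := by
  have r0 : (0 : Fin 2).rev = 1 := rfl
  have r1 : (1 : Fin 2).rev = 0 := rfl
  simp only [g12, g21, gam, green_eq (isGreenFunction_neg him h), sgn_of_neg (neg_pos.1 h.pos),
    Matrix.submatrix_apply, r0, r1, greenPos_diag_zero_one, greenPos_diag_one_zero,
    ← greenPos_diag_sub]
  exact ⟨by ring, by ring, by ring⟩

end

/-! ### The Green's function acting on bounded functions -/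

section

variable {k : ℝ} {P R : 𝓢(ℝ, ℂ)}

/-- A column of the Green's function integrated against a function. -/
def greenColumn (k : ℝ) (P R : 𝓢(ℝ, ℂ)) (j i : Fin 2) (E : ℝ → ℂ) (x : ℝ) : ℂ :=
  ∫ y, greenPos k P R x y i j * E y

variable {E : ℝ → ℂ} {M : ℝ}

theorem norm_dualRight_mul_le (h : Small k P R) (hM : ∀ x, ‖E x‖ ≤ M) (j : Fin 2) :
    ∃ B, ∀ x, ‖dualRight k P R j x * E x‖ ≤ B :=
  ⟨_, fun x => by
    rw [norm_mul]
    exact mul_le_mul (norm_dualRight_le h j x) (hM x) (norm_nonneg _)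
      ((norm_nonneg _).trans (norm_dualRight_le h j x))⟩

theorem norm_dualLeft_mul_le (h : Small k P R) (hM : ∀ x, ‖E x‖ ≤ M) (j : Fin 2) :
    ∃ B, ∀ x, ‖dualLeft k P R j x * E x‖ ≤ B :=
  ⟨_, fun x => by
    rw [norm_mul]
    exact mul_le_mul (norm_dualLeft_le h j x) (hM x) (norm_nonneg _)
      ((norm_nonneg _).trans (norm_dualLeft_le h j x))⟩

theorem integrable_greenPos_mul_bounded (h : Small k P R) (hE : Continuous E)
    (hM : ∀ x, ‖E x‖ ≤ M) (i j : Fin 2) (x : ℝ) :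
    Integrable fun y => greenPos k P R x y i j * E y := by
  have hG : Integrable fun y => greenPos k P R x y i j :=
    ((integrable_exp_abs_sub h.pos x).mul_const (greenBound k P R)).mono'
      ((measurable_greenPos h i j).comp measurable_prodMk_left).aestronglyMeasurable
      (Eventually.of_forall fun y => norm_greenPos_le h x y i j)
  exact hG.mul_bdd (c := M) hE.aestronglyMeasurable (Eventually.of_forall hM)

theorem greenColumn_eq (h : Small k P R) (hE : Continuous E) (hM : ∀ x, ‖E x‖ ≤ M)
    (i j : Fin 2) (x : ℝ) : greenColumn k P R j i E x
      = vecRight k P R i x * lint k (fun y => dualRight k P R j y * E y) x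
        + vecLeft k P R i x * rint k (fun y => dualLeft k P R j y * E y) x := by
  have hi := integrable_greenPos_mul_bounded h hE hM i j x
  rw [greenColumn, ← setIntegral_univ, ← Set.Iic_union_Ioi (a := x),
    setIntegral_union (Set.Iic_disjoint_Ioi le_rfl) measurableSet_Ioi hi.integrableOn
      hi.integrableOn, lint_eq_integral, rint, integral_Iic_eq_integral_Iio,
    integral_Iic_eq_integral_Iio, ← integral_const_mul, ← integral_const_mul]
  congr 1
  · refine setIntegral_congr_fun measurableSet_Iio fun y hy => ?_
    simp only [greenPos_of_lt (Set.mem_Iio.1 hy), Complex.real_smul]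
    ring
  · refine setIntegral_congr_fun measurableSet_Ioi fun y hy => ?_
    simp only [greenPos_of_gt (Set.mem_Ioi.1 hy), Complex.real_smul]
    ring

theorem continuous_dualRight_mul (h : Small k P R) (hE : Continuous E) (j : Fin 2) :
    Continuous fun y => dualRight k P R j y * E y := (continuous_dualRight h j).mul hE

theorem continuous_dualLeft_mul (h : Small k P R) (hE : Continuous E) (j : Fin 2) :
    Continuous fun y => dualLeft k P R j y * E y := (continuous_dualLeft h j).mul hE

theorem exists_norm_greenColumn_le (h : Small k P R) (hE : Continuous E) (hM : ∀ x, ‖E x‖ ≤ M)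
    (i j : Fin 2) : ∃ B, ∀ x, ‖greenColumn k P R j i E x‖ ≤ B := by
  obtain ⟨B₁, h1⟩ := norm_dualRight_mul_le h hM j
  obtain ⟨B₂, h2⟩ := norm_dualLeft_mul_le h hM j
  have hV := (vecBound_pos k P R).le
  refine ⟨vecBound k P R * (B₁ / k) + vecBound k P R * (B₂ / k), fun x => ?_⟩
  rw [greenColumn_eq h hE hM]
  refine (norm_add_le _ _).trans (add_le_add ?_ ?_) <;> rw [norm_mul]
  · exact mul_le_mul (norm_vecRight_le h i x) (norm_lint_le h.pos x fun y _ => h1 y)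
      (norm_nonneg _) hV
  · exact mul_le_mul (norm_vecLeft_le h i x) (norm_rint_le h.pos x fun y _ => h2 y)
      (norm_nonneg _) hV

theorem hasDerivAt_greenColumn_zero (h : Small k P R) (hE : Continuous E) (hM : ∀ x, ‖E x‖ ≤ M)
    (j : Fin 2) (x : ℝ) : HasDerivAt (greenColumn k P R j 0 E)
      (-k * greenColumn k P R j 0 E x + P x * greenColumn k P R j 1 E x
        + if 0 = j then E x else 0) x := by
  obtain ⟨B₁, h1⟩ := norm_dualRight_mul_le h hM j
  obtain ⟨B₂, h2⟩ := norm_dualLeft_mul_le h hM j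
  have hj := jump h 0 j x
  rw [funext fun x => greenColumn_eq h hE hM 0 j x, greenColumn_eq h hE hM 1 j x]
  refine (((hasDerivAt_jostA h x).mul (hasDerivAt_lint h.pos
    (continuous_dualRight_mul h hE j) h1 x)).add ((hasDerivAt_jostC h x).mul
    (hasDerivAt_rint h.pos (continuous_dualLeft_mul h hE j) h2 x))).congr_deriv ?_
  simp only [vecRight, vecLeft, Matrix.cons_val_zero, Matrix.cons_val_one, Complex.real_smul,
    Matrix.cons_val_fin_one] at hj ⊢
  split_ifs at hj ⊢ <;> linear_combination E x * hj

theorem hasDerivAt_greenColumn_one (h : Small k P R) (hE : Continuous E) (hM : ∀ x, ‖E x‖ ≤ M)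
    (j : Fin 2) (x : ℝ) : HasDerivAt (greenColumn k P R j 1 E)
      (k * greenColumn k P R j 1 E x + R x * greenColumn k P R j 0 E x
        + if 1 = j then E x else 0) x := by
  obtain ⟨B₁, h1⟩ := norm_dualRight_mul_le h hM j
  obtain ⟨B₂, h2⟩ := norm_dualLeft_mul_le h hM j
  have hj := jump h 1 j x
  rw [funext fun x => greenColumn_eq h hE hM 1 j x, greenColumn_eq h hE hM 0 j x]
  refine (((hasDerivAt_jostB h x).mul (hasDerivAt_lint h.pos
    (continuous_dualRight_mul h hE j) h1 x)).add ((hasDerivAt_jostD h x).mul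
    (hasDerivAt_rint h.pos (continuous_dualLeft_mul h hE j) h2 x))).congr_deriv ?_
  simp only [vecRight, vecLeft, Matrix.cons_val_zero, Matrix.cons_val_one, Complex.real_smul,
    Matrix.cons_val_fin_one] at hj ⊢
  split_ifs at hj ⊢ <;> linear_combination E x * hj

/-- A bounded solution of `X' = -k X + g` with `k ≠ 0` and integrable `g` is integrable. -/
theorem integrable_of_hasDerivAt {k M N : ℝ} (hk : k ≠ 0) {g X : ℝ → ℂ} (hc : Continuous g)
    (hi : Integrable g) (hM : ∀ y, ‖g y‖ ≤ M) (hN : ∀ y, ‖X y‖ ≤ N)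
    (hX : ∀ x, HasDerivAt X (-k * X x + g x) x) : Integrable X := by
  rcases lt_or_gt_of_ne hk with h | h
  · have : X = rint (-k) (fun y => -g y) := funext fun x =>
      eq_rint_of_hasDerivAt (g := fun y => -g y) (M := M) (neg_pos.2 h) hc.neg
        (fun y => by rw [norm_neg]; exact hM y) hN (fun x => (hX x).congr_deriv (by simp)) x
    rw [this]
    exact integrable_rint (neg_pos.2 h) hi.neg
  · have : X = lint k g := funext fun x => eq_lint_of_hasDerivAt h hc hM hN
      (fun x => (hX x).congr_deriv (by simp; ring)) x
    rw [this]
    exact integrable_lint h hi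

end

open scoped FourierTransform

/-! ### The Fourier transform without normalisation -/

/-- `∫ exp(-i ξ x) g(x) dx`. -/
def ft (g : ℝ → ℂ) (ξ : ℝ) : ℂ := ∫ x : ℝ, Complex.exp (-(Complex.I * ξ * x)) * g x

theorem norm_exp_neg_I_mul (ξ x : ℝ) : ‖Complex.exp (-(Complex.I * ξ * x))‖ = 1 := by
  rw [show -(Complex.I * ξ * x) = ((-(ξ * x) : ℝ) : ℂ) * Complex.I by push_cast; ring,
    Complex.norm_exp_ofReal_mul_I]

theorem norm_exp_I_mul (ξ x : ℝ) : ‖Complex.exp (Complex.I * ξ * x)‖ = 1 := by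
  rw [show Complex.I * ξ * x = ((ξ * x : ℝ) : ℂ) * Complex.I by push_cast; ring,
    Complex.norm_exp_ofReal_mul_I]

theorem ft_eq_fourier (g : ℝ → ℂ) (ξ : ℝ) : ft g ξ = 𝓕 g (ξ / (2 * Real.pi)) := by
  rw [Real.fourier_real_eq_integral_exp_smul, ft]
  refine integral_congr_ae (Eventually.of_forall fun x => ?_)
  simp only [smul_eq_mul]
  congr 2
  have := Real.pi_ne_zero
  rw [show -2 * Real.pi * x * (ξ / (2 * Real.pi)) = -(x * ξ) by field_simp]
  push_cast
  ring

theorem fourier_eq_ft (g : ℝ → ℂ) (w : ℝ) : 𝓕 g w = ft g (w * (2 * Real.pi)) := by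
  rw [ft_eq_fourier, mul_div_assoc, div_self (by positivity), mul_one]

theorem fourier_eq_ft_fun (g : ℝ → ℂ) : 𝓕 g = fun w => ft g (w * (2 * Real.pi)) :=
  funext (fourier_eq_ft g)

theorem integrable_exp_mul {g : ℝ → ℂ} (hg : Integrable g) (ξ : ℝ) :
    Integrable fun x : ℝ => Complex.exp (-(Complex.I * ξ * x)) * g x :=
  hg.bdd_mul (c := 1) (Continuous.aestronglyMeasurable (by fun_prop))
    (Eventually.of_forall fun x => (norm_exp_neg_I_mul ξ x).le)

theorem norm_ft_le (g : ℝ → ℂ) (ξ : ℝ) : ‖ft g ξ‖ ≤ ∫ x, ‖g x‖ := by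
  refine (norm_integral_le_integral_norm _).trans (le_of_eq ?_)
  simp only [norm_mul, norm_exp_neg_I_mul, one_mul]

theorem continuous_ft {g : ℝ → ℂ} (hg : Integrable g) : Continuous (ft g) := by
  refine continuous_of_dominated (bound := fun x => ‖g x‖)
    (fun ξ => (integrable_exp_mul hg ξ).aestronglyMeasurable) (fun ξ => ?_) hg.norm
    (Eventually.of_forall fun x => by fun_prop)
  refine Eventually.of_forall fun x => ?_
  rw [norm_mul, norm_exp_neg_I_mul, one_mul]

theorem ft_add {f g : ℝ → ℂ} (hf : Integrable f) (hg : Integrable g) (ξ : ℝ) :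
    ft (fun x => f x + g x) ξ = ft f ξ + ft g ξ := by
  simp only [ft, mul_add]
  exact integral_add (integrable_exp_mul hf ξ) (integrable_exp_mul hg ξ)

theorem ft_const_mul (c : ℂ) (g : ℝ → ℂ) (ξ : ℝ) : ft (fun x => c * g x) ξ = c * ft g ξ := by
  simp only [ft]
  rw [← integral_const_mul]
  refine integral_congr_ae (Eventually.of_forall fun x => ?_)
  simp only
  ring

theorem ft_of_hasDerivAt {f f' : ℝ → ℂ} (hf : Integrable f) (hd : ∀ x, HasDerivAt f (f' x) x)
    (hf' : Integrable f') (ξ : ℝ) : ft f' ξ = Complex.I * ξ * ft f ξ := by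
  have hdf : deriv f = f' := funext fun x => (hd x).deriv
  have := congrFun (Real.fourier_deriv hf (fun x => (hd x).differentiableAt) (by rwa [hdf]))
    (ξ / (2 * Real.pi))
  rw [hdf] at this
  rw [ft_eq_fourier, ft_eq_fourier, this, smul_eq_mul]
  congr 1
  have : (Real.pi : ℂ) ≠ 0 := Complex.ofReal_ne_zero.2 Real.pi_ne_zero
  push_cast
  field_simp

theorem integrable_comp_mul_two_pi {g : ℝ → ℂ} :
    Integrable (fun w => g (w * (2 * Real.pi))) ↔ Integrable g :=
  integrable_comp_mul_right_iff g (by positivity)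

theorem integral_ft_mul_exp {g : ℝ → ℂ} (hc : Continuous g) (hg : Integrable g)
    (hf : Integrable (ft g)) (x : ℝ) :
    ∫ ξ, ft g ξ * Complex.exp (Complex.I * ξ * x) = 2 * Real.pi * g x := by
  have hF : Integrable (𝓕 g) := by
    rw [fourier_eq_ft_fun]
    exact integrable_comp_mul_two_pi.2 hf
  have h1 := congrFun (hc.fourierInv_fourier_eq hg hF) x
  rw [Real.fourierInv_eq', fourier_eq_ft_fun] at h1
  have h2 := Measure.integral_comp_mul_right
    (fun ξ => ft g ξ * Complex.exp (Complex.I * ξ * x)) (2 * Real.pi)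
  rw [abs_of_pos (by positivity)] at h2
  have h3 : ∫ w, ft g (w * (2 * Real.pi))
      * Complex.exp (Complex.I * ((w * (2 * Real.pi) : ℝ) : ℂ) * x) = g x := by
    rw [← h1]
    refine integral_congr_ae (Eventually.of_forall fun w => ?_)
    simp only [smul_eq_mul, RCLike.inner_apply, conj_trivial]
    rw [mul_comm]
    congr 2
    push_cast
    ring
  rw [h3] at h2
  have hp : (Real.pi : ℂ) ≠ 0 := Complex.ofReal_ne_zero.2 Real.pi_ne_zero
  rw [h2, Complex.real_smul, ← mul_assoc]
  push_cast
  rw [mul_inv_cancel₀ (mul_ne_zero two_ne_zero hp), one_mul]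

theorem integral_ft {g : ℝ → ℂ} (hc : Continuous g) (hg : Integrable g)
    (hf : Integrable (ft g)) : ∫ ξ, ft g ξ = 2 * Real.pi * g 0 := by
  rw [← integral_ft_mul_exp hc hg hf 0]
  simp

theorem ft_schwartz (P : 𝓢(ℝ, ℂ)) (ξ : ℝ) : ft P ξ = (𝓕 P : 𝓢(ℝ, ℂ)) (ξ / (2 * Real.pi)) := by
  rw [ft_eq_fourier, SchwartzMap.fourier_coe]

theorem integrable_ft (P : 𝓢(ℝ, ℂ)) : Integrable (ft P) := by
  rw [← integrable_comp_mul_two_pi, ← fourier_eq_ft_fun, ← SchwartzMap.fourier_coe]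
  exact (𝓕 P).integrable

theorem continuous_ft_schwartz (P : 𝓢(ℝ, ℂ)) : Continuous (ft P) := continuous_ft P.integrable

theorem exists_norm_ft_le (P : 𝓢(ℝ, ℂ)) : ∃ C, ∀ ξ, ‖ft P ξ‖ ≤ C := ⟨_, norm_ft_le P⟩

theorem integrable_norm_sq_ft (P : 𝓢(ℝ, ℂ)) : Integrable fun ξ => ‖ft P ξ‖ ^ 2 := by
  obtain ⟨C, hC⟩ := exists_norm_ft_le P
  refine ((integrable_ft P).norm.const_mul C).mono'
    ((continuous_ft_schwartz P).norm.pow 2).aestronglyMeasurable (Eventually.of_forall fun ξ => ?_)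
  rw [Real.norm_of_nonneg (by positivity), sq]
  exact mul_le_mul_of_nonneg_right (hC ξ) (norm_nonneg _)

theorem integral_norm_sq_ft (P : 𝓢(ℝ, ℂ)) : ∫ ξ, ‖ft P ξ‖ ^ 2 = 2 * Real.pi * l2sq P := by
  simp only [ft_schwartz]
  rw [Measure.integral_comp_div (fun w => ‖(𝓕 P : 𝓢(ℝ, ℂ)) w‖ ^ 2), abs_of_pos (by positivity),
    SchwartzMap.integral_norm_sq_fourier, smul_eq_mul, l2sq]

/-- The symbol `(2π)⁻¹ ∫ exp(-i ξ x) P(x) dx` of the multiplication by `P` on the Fourier side. -/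
def symbol (P : 𝓢(ℝ, ℂ)) (ξ : ℝ) : ℂ := ((2 * Real.pi)⁻¹ : ℝ) * ft P ξ

theorem continuous_symbol (P : 𝓢(ℝ, ℂ)) : Continuous (symbol P) :=
  continuous_const.mul (continuous_ft_schwartz P)

theorem integrable_symbol (P : 𝓢(ℝ, ℂ)) : Integrable (symbol P) := (integrable_ft P).const_mul _

theorem exists_norm_symbol_le (P : 𝓢(ℝ, ℂ)) : ∃ C, ∀ ξ, ‖symbol P ξ‖ ≤ C := by
  obtain ⟨C, hC⟩ := exists_norm_ft_le P
  refine ⟨‖(((2 * Real.pi)⁻¹ : ℝ) : ℂ)‖ * C, fun ξ => ?_⟩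
  rw [symbol, norm_mul]
  exact mul_le_mul_of_nonneg_left (hC ξ) (norm_nonneg _)

theorem norm_symbol_sq (P : 𝓢(ℝ, ℂ)) (ξ : ℝ) :
    ‖symbol P ξ‖ ^ 2 = ((2 * Real.pi) ^ 2)⁻¹ * ‖ft P ξ‖ ^ 2 := by
  rw [symbol, norm_mul, mul_pow, Complex.norm_real, Real.norm_of_nonneg (by positivity), inv_pow]

theorem integrable_norm_sq_symbol (P : 𝓢(ℝ, ℂ)) : Integrable fun ξ => ‖symbol P ξ‖ ^ 2 := by
  simp only [norm_symbol_sq]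
  exact (integrable_norm_sq_ft P).const_mul _

theorem integral_norm_sq_symbol (P : 𝓢(ℝ, ℂ)) :
    ∫ ξ, ‖symbol P ξ‖ ^ 2 = (2 * Real.pi)⁻¹ * l2sq P := by
  simp only [norm_symbol_sq]
  rw [integral_const_mul, integral_norm_sq_ft]
  have := Real.pi_pos
  field_simp

theorem symbol_smul (c : ℂ) (P : 𝓢(ℝ, ℂ)) (ξ : ℝ) : symbol (c • P) ξ = c * symbol P ξ := by
  have : ft (⇑(c • P)) ξ = c * ft P ξ := ft_const_mul c P ξ
  rw [symbol, this, symbol]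
  ring

/-- Fourier inversion for a Schwartz function. -/
theorem integral_symbol_mul_exp (P : 𝓢(ℝ, ℂ)) (x : ℝ) :
    ∫ ξ, symbol P ξ * Complex.exp (Complex.I * ξ * x) = P x := by
  have h := integral_ft_mul_exp P.continuous P.integrable (integrable_ft P) x
  simp only [symbol, mul_assoc]
  rw [integral_const_mul]
  simp only [mul_assoc] at h
  have hp : (Real.pi : ℂ) ≠ 0 := Complex.ofReal_ne_zero.2 Real.pi_ne_zero
  rw [h]
  push_cast
  field_simp

/-- The Fourier transform turns the multiplication by a Schwartz function into a convolution. -/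
theorem ft_mul (P : 𝓢(ℝ, ℂ)) {u : ℝ → ℂ} (hu : Integrable u) (ξ : ℝ) :
    ft (fun x => P x * u x) ξ = ∫ ζ, symbol P (ξ - ζ) * ft u ζ := by
  have h1 : ∫ ζ, symbol P (ξ - ζ) * ft u ζ = ∫ ω, symbol P ω * ft u (ξ - ω) := by
    rw [← integral_sub_left_eq_self (fun ω => symbol P ω * ft u (ξ - ω)) volume ξ]
    simp
  have hi : Integrable (fun p : ℝ × ℝ => symbol P p.2 *
      (Complex.exp (-(Complex.I * ((ξ - p.2 : ℝ) : ℂ) * p.1)) * u p.1)) (volume.prod volume) := by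
    refine ((hu.mul_prod (integrable_symbol P)).bdd_mul
      (f := fun p : ℝ × ℝ => Complex.exp (-(Complex.I * ((ξ - p.2 : ℝ) : ℂ) * p.1)))
      (c := 1) (Continuous.aestronglyMeasurable (by fun_prop))
      (Eventually.of_forall fun p => (norm_exp_neg_I_mul _ _).le)).congr
      (Eventually.of_forall fun p => ?_)
    simp only
    ring
  rw [h1, ft]
  have h2 : ∀ ω, symbol P ω * ft u (ξ - ω) = ∫ x : ℝ, symbol P ω *
      (Complex.exp (-(Complex.I * ((ξ - ω : ℝ) : ℂ) * x)) * u x) := fun ω => by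
    rw [integral_const_mul, ft]
  simp only [h2]
  rw [← integral_integral_swap hi]
  refine integral_congr_ae (Eventually.of_forall fun x => ?_)
  simp only
  rw [← integral_symbol_mul_exp P x, ← integral_mul_const, ← integral_const_mul]
  refine integral_congr_ae (Eventually.of_forall fun ω => ?_)
  simp only
  rw [show -(Complex.I * ((ξ - ω : ℝ) : ℂ) * x)
    = -(Complex.I * ξ * x) + Complex.I * ω * x by push_cast; ring, Complex.exp_add]
  ring

/-! ### Sobolev balls -/

theorem fourierHat_eq (q : 𝓢(ℝ, ℂ)) (ξ : ℝ) :
    fourierHat q ξ = ((Real.sqrt (2 * Real.pi))⁻¹ : ℝ) * ft q ξ := rfl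

theorem norm_fourierHat_sq (q : 𝓢(ℝ, ℂ)) (ξ : ℝ) :
    ‖fourierHat q ξ‖ ^ 2 = (2 * Real.pi)⁻¹ * ‖ft q ξ‖ ^ 2 := by
  rw [fourierHat_eq, norm_mul, mul_pow, Complex.norm_real, Real.norm_of_nonneg (by positivity),
    inv_pow, Real.sq_sqrt (by positivity)]

theorem inv_sqrt_mul_fourierHat (q : 𝓢(ℝ, ℂ)) (ξ : ℝ) :
    ((Real.sqrt (2 * Real.pi))⁻¹ : ℝ) * fourierHat q ξ = symbol q ξ := by
  rw [fourierHat_eq, symbol, ← mul_assoc, ← Complex.ofReal_mul, ← mul_inv,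
    Real.mul_self_sqrt (by positivity)]

theorem l2sq_le_sobolevNorm_sq {s : ℝ} (hs0 : 0 < s) (hs1 : s < 1) (q : 𝓢(ℝ, ℂ)) :
    l2sq q ≤ sobolevNorm s q ^ 2 := by
  have hw : ∀ ξ : ℝ, 1 ≤ (4 + ξ ^ 2) ^ s := fun ξ =>
    Real.one_le_rpow (by nlinarith [sq_nonneg ξ]) hs0.le
  have hw' : ∀ ξ : ℝ, (4 + ξ ^ 2) ^ s ≤ 4 + ξ ^ 2 := fun ξ =>
    (Real.rpow_le_rpow_of_exponent_le (by nlinarith [sq_nonneg ξ]) hs1.le).trans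
      (Real.rpow_one _).le
  have hd : ∀ ξ, ‖ft (SchwartzMap.derivCLM ℂ ℂ q) ξ‖ ^ 2 = ξ ^ 2 * ‖ft q ξ‖ ^ 2 := fun ξ => by
    rw [ft_of_hasDerivAt (f' := SchwartzMap.derivCLM ℂ ℂ q) q.integrable
      (fun x => q.hasDerivAt x) (SchwartzMap.derivCLM ℂ ℂ q).integrable]
    simp [mul_pow]
  have hi : Integrable fun ξ => (4 + ξ ^ 2) ^ s * ‖fourierHat q ξ‖ ^ 2 := by
    have h1 := (((integrable_norm_sq_ft q).const_mul 4).add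
      (integrable_norm_sq_ft (SchwartzMap.derivCLM ℂ ℂ q))).const_mul (2 * Real.pi)⁻¹
    simp only [norm_fourierHat_sq]
    refine h1.mono' (Continuous.aestronglyMeasurable ?_) (Eventually.of_forall fun ξ => ?_)
    · exact (Continuous.rpow_const (by fun_prop) fun ξ => Or.inr hs0.le).mul
        (continuous_const.mul ((continuous_ft_schwartz q).norm.pow 2))
    · rw [Real.norm_of_nonneg (by positivity), Pi.add_apply, hd]
      calc (4 + ξ ^ 2) ^ s * ((2 * Real.pi)⁻¹ * ‖ft q ξ‖ ^ 2)
          ≤ (4 + ξ ^ 2) * ((2 * Real.pi)⁻¹ * ‖ft q ξ‖ ^ 2) :=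
            mul_le_mul_of_nonneg_right (hw' ξ) (by positivity)
        _ = _ := by ring
  rw [sobolevNorm, Real.sq_sqrt (integral_nonneg fun ξ => by positivity)]
  have e : l2sq q = ∫ ξ, ‖fourierHat q ξ‖ ^ 2 := by
    simp only [norm_fourierHat_sq]
    rw [integral_const_mul, integral_norm_sq_ft]
    have := Real.pi_pos
    field_simp
  rw [e]
  refine integral_mono ?_ hi fun ξ => le_mul_of_one_le_left (by positivity) (hw ξ)
  simp only [norm_fourierHat_sq]
  exact (integrable_norm_sq_ft q).const_mul _

/-! ### Powers of dominated integral kernels -/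

section Kernels

variable {K : ℝ → ℝ → ℂ} {x y : ℝ → ℝ} {ρ : ℝ}

theorem stronglyMeasurable_kerPow (hK : StronglyMeasurable (Function.uncurry K)) (n : ℕ) :
    StronglyMeasurable (Function.uncurry (kerPow K n)) := by
  induction n with
  | zero => exact hK
  | succ n ih =>
    have h1 : StronglyMeasurable fun p : (ℝ × ℝ) × ℝ => K p.1.1 p.2 :=
      hK.comp_measurable (g := fun p : (ℝ × ℝ) × ℝ => (p.1.1, p.2)) (by fun_prop)
    have h2 : StronglyMeasurable fun p : (ℝ × ℝ) × ℝ => kerPow K n p.2 p.1.2 :=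
      ih.comp_measurable (g := fun p : (ℝ × ℝ) × ℝ => (p.2, p.1.2)) (by fun_prop)
    exact (h1.mul h2).integral_prod_right'

/-- The kernel `K` is dominated by the product kernel `x(ξ) y(η)`, whose trace is at most `ρ`. -/
structure ProductDominated (K : ℝ → ℝ → ℂ) (x y : ℝ → ℝ) (ρ : ℝ) : Prop where
  stronglyMeasurable : StronglyMeasurable (Function.uncurry K)
  nonneg_left : ∀ ξ, 0 ≤ x ξ
  nonneg_right : ∀ ξ, 0 ≤ y ξ
  norm_le : ∀ ξ η, ‖K ξ η‖ ≤ x ξ * y η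
  integrable : Integrable fun ξ => x ξ * y ξ
  integral_le : ∫ ξ, x ξ * y ξ ≤ ρ

namespace ProductDominated

theorem nonneg (h : ProductDominated K x y ρ) : 0 ≤ ρ :=
  (integral_nonneg fun ξ => mul_nonneg (h.nonneg_left ξ) (h.nonneg_right ξ)).trans h.integral_le

theorem measurable_section (h : ProductDominated K x y ρ) (ξ : ℝ) :
    AEStronglyMeasurable (K ξ) :=
  (h.stronglyMeasurable.comp_measurable measurable_prodMk_left).aestronglyMeasurable

theorem norm_integral_le (h : ProductDominated K x y ρ) {V : ℝ → ℂ} {c : ℝ}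
    (hV : Integrable fun ζ => y ζ * ‖V ζ‖) (hc : ∫ ζ, y ζ * ‖V ζ‖ ≤ c) (ξ : ℝ) :
    ‖∫ ζ, K ξ ζ * V ζ‖ ≤ x ξ * c := by
  calc ‖∫ ζ, K ξ ζ * V ζ‖ ≤ ∫ ζ, x ξ * (y ζ * ‖V ζ‖) := by
        refine norm_integral_le_of_norm_le (hV.const_mul _) (Eventually.of_forall fun ζ => ?_)
        rw [norm_mul, ← mul_assoc]
        exact mul_le_mul_of_nonneg_right (h.norm_le ξ ζ) (norm_nonneg _)
    _ ≤ x ξ * c := by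
        rw [integral_const_mul]
        exact mul_le_mul_of_nonneg_left hc (h.nonneg_left ξ)

theorem integrable_mul (h : ProductDominated K x y ρ) {V : ℝ → ℂ}
    (hm : AEStronglyMeasurable V) (hV : Integrable fun ζ => y ζ * ‖V ζ‖) (ξ : ℝ) :
    Integrable fun ζ => K ξ ζ * V ζ := by
  refine (hV.const_mul (x ξ)).mono' ((h.measurable_section ξ).mul hm)
    (Eventually.of_forall fun ζ => ?_)
  rw [norm_mul, ← mul_assoc]
  exact mul_le_mul_of_nonneg_right (h.norm_le ξ ζ) (norm_nonneg _)

theorem integrable_mul_of_le (h : ProductDominated K x y ρ) (hy : Measurable y) {V : ℝ → ℂ}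
    {c : ℝ} (hm : AEStronglyMeasurable V) (hV : ∀ ζ, ‖V ζ‖ ≤ x ζ * c) :
    Integrable (fun ζ => y ζ * ‖V ζ‖) ∧ ∫ ζ, y ζ * ‖V ζ‖ ≤ ρ * c ∨ c < 0 := by
  rcases lt_or_ge c 0 with hc | hc
  · exact Or.inr hc
  have hle : ∀ ζ, y ζ * ‖V ζ‖ ≤ x ζ * y ζ * c := fun ζ => by
    have := mul_le_mul_of_nonneg_left (hV ζ) (h.nonneg_right ζ)
    linarith
  have hi : Integrable fun ζ => y ζ * ‖V ζ‖ := by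
    refine (h.integrable.mul_const c).mono' (hy.aestronglyMeasurable.mul hm.norm)
      (Eventually.of_forall fun ζ => ?_)
    rw [Real.norm_of_nonneg (mul_nonneg (h.nonneg_right ζ) (norm_nonneg _))]
    exact hle ζ
  refine Or.inl ⟨hi, (integral_mono hi (h.integrable.mul_const c) hle).trans ?_⟩
  rw [integral_mul_const]
  exact mul_le_mul_of_nonneg_right h.integral_le hc

theorem measurable_kerPow (h : ProductDominated K x y ρ) (n : ℕ) (η : ℝ) :
    AEStronglyMeasurable fun ξ => kerPow K n ξ η :=
  ((stronglyMeasurable_kerPow h.stronglyMeasurable n).comp_measurable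
    measurable_prodMk_right).aestronglyMeasurable

theorem norm_kerPow_le (h : ProductDominated K x y ρ) (hy : Measurable y) (n : ℕ) (ξ η : ℝ) :
    ‖kerPow K n ξ η‖ ≤ x ξ * (ρ ^ n * y η) := by
  induction n generalizing ξ with
  | zero => simpa [kerPow] using h.norm_le ξ η
  | succ n ih =>
    have hc : 0 ≤ ρ ^ n * y η := mul_nonneg (pow_nonneg h.nonneg n) (h.nonneg_right η)
    obtain ⟨hi, hle⟩ := (h.integrable_mul_of_le hy (h.measurable_kerPow n η) ih).resolve_right
      hc.not_gt
    rw [pow_succ', mul_assoc]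
    exact h.norm_integral_le hi hle ξ

theorem integrable_mul_kerPow (h : ProductDominated K x y ρ) (hy : Measurable y) (n : ℕ)
    (ξ η : ℝ) : Integrable fun ζ => K ξ ζ * kerPow K n ζ η := by
  have hc : 0 ≤ ρ ^ n * y η := mul_nonneg (pow_nonneg h.nonneg n) (h.nonneg_right η)
  exact h.integrable_mul (h.measurable_kerPow n η) ((h.integrable_mul_of_le hy
    (h.measurable_kerPow n η) fun ζ => h.norm_kerPow_le hy n ζ η).resolve_right hc.not_gt).1 ξ

/-- The solution of `V = K(·, η) + z K V` is given by the Neumann series. -/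
theorem hasSum_of_fixedPoint (h : ProductDominated K x y ρ) (hy : Measurable y) (hρ : ρ < 1)
    {z : ℂ} (hz : ‖z‖ ≤ 1) {η : ℝ} {V : ℝ → ℂ} (hm : AEStronglyMeasurable V)
    (hV : Integrable fun ζ => y ζ * ‖V ζ‖)
    (hfix : ∀ ξ, V ξ = K ξ η + z * ∫ ζ, K ξ ζ * V ζ) (ξ : ℝ) :
    HasSum (fun n => z ^ n * kerPow K n ξ η) (V ξ) := by
  set S : ℕ → ℝ → ℂ := fun n ξ => ∑ j ∈ Finset.range n, z ^ j * kerPow K j ξ η with hS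
  have hmS : ∀ n, AEStronglyMeasurable (S n) := fun n =>
    Finset.aestronglyMeasurable_fun_sum _ fun j _ =>
      aestronglyMeasurable_const.mul (h.measurable_kerPow j η)
  have hiS : ∀ n ξ, Integrable fun ζ => K ξ ζ * S n ζ := fun n ξ => by
    simp only [hS, Finset.mul_sum]
    refine integrable_finsetSum _ fun j _ => ?_
    refine ((h.integrable_mul_kerPow hy j ξ η).const_mul (z ^ j)).congr
      (Eventually.of_forall fun ζ => ?_)
    simp only
    ring
  have hstep : ∀ n ξ, S (n + 1) ξ = K ξ η + z * ∫ ζ, K ξ ζ * S n ζ := fun n ξ => by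
    have e : ∀ ζ, K ξ ζ * S n ζ
        = ∑ j ∈ Finset.range n, z ^ j * (K ξ ζ * kerPow K j ζ η) := fun ζ => by
      simp only [hS, Finset.mul_sum]
      exact Finset.sum_congr rfl fun j _ => by ring
    simp only [e]
    rw [integral_finsetSum _ fun j _ => (h.integrable_mul_kerPow hy j ξ η).const_mul _]
    simp only [integral_const_mul, hS]
    rw [Finset.sum_range_succ', Finset.mul_sum, add_comm]
    congr 1
    · simp [kerPow]
    · refine Finset.sum_congr rfl fun j _ => ?_
      rw [pow_succ', mul_assoc]
      rfl
  set c := ∫ ζ, y ζ * ‖V ζ‖ with hc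
  have hc0 : 0 ≤ c := integral_nonneg fun ζ => mul_nonneg (h.nonneg_right ζ) (norm_nonneg _)
  have herr : ∀ n ξ, ‖V ξ - S (n + 1) ξ‖ ≤ x ξ * (ρ ^ n * c) := by
    have hred : ∀ n ξ, V ξ - S (n + 1) ξ = z * ∫ ζ, K ξ ζ * (V ζ - S n ζ) := fun n ξ => by
      simp only [mul_sub]
      rw [integral_sub (h.integrable_mul hm hV ξ) (hiS n ξ), hstep]
      nth_rewrite 1 [hfix ξ]
      ring
    have hz' : ∀ {a : ℂ} {b : ℝ}, ‖a‖ ≤ b → ‖z * a‖ ≤ b := fun {a b} hab => by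
      rw [norm_mul]
      exact (mul_le_of_le_one_left (norm_nonneg _) hz).trans hab
    intro n
    induction n with
    | zero =>
      intro ξ
      rw [hred 0 ξ]
      refine hz' ?_
      simp only [hS, Finset.range_zero, Finset.sum_empty, sub_zero, pow_zero, one_mul]
      exact h.norm_integral_le hV le_rfl ξ
    | succ n ih =>
      intro ξ
      have hn : 0 ≤ ρ ^ n * c := mul_nonneg (pow_nonneg h.nonneg n) hc0
      obtain ⟨hi, hle⟩ := (h.integrable_mul_of_le hy (hm.sub (hmS (n + 1))) ih).resolve_right
        hn.not_gt
      rw [hred (n + 1) ξ, pow_succ', mul_assoc]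
      exact hz' (h.norm_integral_le hi hle ξ)
  have hsum : Summable fun n => z ^ n * kerPow K n ξ η := by
    refine Summable.of_norm_bounded
      ((summable_geometric_of_lt_one h.nonneg hρ).mul_left (x ξ * y η)) fun n => ?_
    rw [norm_mul, norm_pow]
    refine (mul_le_of_le_one_left (norm_nonneg _) (pow_le_one₀ (norm_nonneg _) hz)).trans ?_
    refine (h.norm_kerPow_le hy n ξ η).trans (le_of_eq ?_)
    ring
  rw [hsum.hasSum_iff_tendsto_nat, ← tendsto_add_atTop_iff_nat 1, tendsto_iff_norm_sub_tendsto_zero]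
  have hlim : Tendsto (fun n : ℕ => x ξ * (ρ ^ n * c)) atTop (𝓝 0) := by
    simpa using ((tendsto_pow_atTop_nhds_zero_of_lt_one h.nonneg hρ).mul_const c).const_mul (x ξ)
  refine squeeze_zero (fun n => norm_nonneg _) (fun n => ?_) hlim
  rw [norm_sub_rev]
  exact herr n ξ

theorem integrable_diag (h : ProductDominated K x y ρ) (hy : Measurable y) (n : ℕ) :
    Integrable fun ξ => kerPow K n ξ ξ := by
  refine (h.integrable.mul_const (ρ ^ n)).mono' ?_ (Eventually.of_forall fun ξ => ?_)
  · exact ((stronglyMeasurable_kerPow h.stronglyMeasurable n).comp_measurable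
      (g := fun ξ : ℝ => (ξ, ξ)) (by fun_prop)).aestronglyMeasurable
  · refine (h.norm_kerPow_le hy n ξ ξ).trans (le_of_eq ?_)
    ring

theorem integral_norm_diag_le (h : ProductDominated K x y ρ) (hy : Measurable y) (n : ℕ) :
    ∫ ξ, ‖kerPow K n ξ ξ‖ ≤ ρ ^ (n + 1) := by
  calc ∫ ξ, ‖kerPow K n ξ ξ‖ ≤ ∫ ξ, ρ ^ n * (x ξ * y ξ) := by
        refine integral_mono (h.integrable_diag hy n).norm (h.integrable.const_mul _) fun ξ => ?_
        refine (h.norm_kerPow_le hy n ξ ξ).trans (le_of_eq ?_)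
        ring
    _ ≤ ρ ^ (n + 1) := by
        rw [integral_const_mul, pow_succ]
        exact mul_le_mul_of_nonneg_left h.integral_le (pow_nonneg h.nonneg n)

theorem norm_kerTrace_le (h : ProductDominated K x y ρ) (hy : Measurable y) (n : ℕ) :
    ‖kerTrace (kerPow K n)‖ ≤ ρ ^ (n + 1) :=
  (norm_integral_le_integral_norm _).trans (h.integral_norm_diag_le hy n)

/-- The trace of a Neumann series. -/
theorem hasSum_kerTrace (h : ProductDominated K x y ρ) (hy : Measurable y) (hρ : ρ < 1)
    {z : ℂ} (hz : ‖z‖ ≤ 1) {D : ℝ → ℂ} (hm : AEStronglyMeasurable D)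
    (hD : ∀ ξ, HasSum (fun n => z ^ n * kerPow K n ξ ξ) (D ξ)) :
    Integrable D ∧ HasSum (fun n => z ^ n * kerTrace (kerPow K n)) (∫ ξ, D ξ) := by
  have hb : ∀ n ξ, ‖z ^ n * kerPow K n ξ ξ‖ ≤ ‖kerPow K n ξ ξ‖ := fun n ξ => by
    rw [norm_mul, norm_pow]
    exact mul_le_of_le_one_left (norm_nonneg _) (pow_le_one₀ (norm_nonneg _) hz)
  have hi : ∀ n, Integrable fun ξ => z ^ n * kerPow K n ξ ξ := fun n =>
    (h.integrable_diag hy n).const_mul _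
  have hs : Summable fun n => ∫ ξ, ‖z ^ n * kerPow K n ξ ξ‖ := by
    refine Summable.of_nonneg_of_le (fun n => integral_nonneg fun ξ => norm_nonneg _) (fun n => ?_)
      ((summable_geometric_of_lt_one h.nonneg hρ).mul_left ρ)
    refine (integral_mono (hi n).norm (h.integrable_diag hy n).norm (hb n)).trans ?_
    refine (h.integral_norm_diag_le hy n).trans (le_of_eq ?_)
    ring
  constructor
  · refine (h.integrable.mul_const (1 - ρ)⁻¹).mono' hm (Eventually.of_forall fun ξ => ?_)
    have hg := (hasSum_geometric_of_lt_one h.nonneg hρ).mul_left (x ξ * y ξ)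
    rw [← (hD ξ).tsum_eq]
    refine tsum_of_norm_bounded hg fun n => (hb n ξ).trans ?_
    refine (h.norm_kerPow_le hy n ξ ξ).trans (le_of_eq ?_)
    ring
  · have := hasSum_integral_of_summable_integral_norm hi hs
    simp only [(hD _).tsum_eq, integral_const_mul] at this
    exact this

end ProductDominated

theorem kerPow_conj {K' : ℝ → ℝ → ℂ} {h : ℝ → ℂ} (h0 : ∀ ξ, h ξ ≠ 0)
    (hK : ∀ ξ η, K' ξ η = (h ξ)⁻¹ * K ξ η * h η) (n : ℕ) (ξ η : ℝ) :
    kerPow K' n ξ η = (h ξ)⁻¹ * kerPow K n ξ η * h η := by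
  induction n generalizing ξ with
  | zero => exact hK ξ η
  | succ n ih =>
    simp only [kerPow, kerComp]
    rw [← integral_const_mul, ← integral_mul_const]
    refine integral_congr_ae (Eventually.of_forall fun ζ => ?_)
    simp only
    rw [hK, ih]
    field_simp [h0 ζ]

theorem kerTrace_conj {K' : ℝ → ℝ → ℂ} {h : ℝ → ℂ} (h0 : ∀ ξ, h ξ ≠ 0)
    (hK : ∀ ξ η, K' ξ η = (h ξ)⁻¹ * K ξ η * h η) (n : ℕ) :
    kerTrace (kerPow K' n) = kerTrace (kerPow K n) := by
  refine integral_congr_ae (Eventually.of_forall fun ξ => ?_)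
  simp only
  rw [kerPow_conj h0 hK]
  have := h0 ξ
  field_simp

end Kernels

/-! ### The free resolvent on the Fourier side -/

/-- The symbol `(iξ + k)⁻¹` of `(∂ + k)⁻¹`. -/
def res (k ξ : ℝ) : ℂ := (Complex.I * ξ + k)⁻¹

section Resolvent

variable {k : ℝ}

theorem I_mul_add_ne_zero (hk : k ≠ 0) (ξ : ℝ) : Complex.I * ξ + k ≠ 0 := by
  intro h
  have := congrArg Complex.re h
  simp at this
  exact hk this

theorem res_ne_zero (hk : k ≠ 0) (ξ : ℝ) : res k ξ ≠ 0 := inv_ne_zero (I_mul_add_ne_zero hk ξ)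

theorem continuous_res (hk : k ≠ 0) : Continuous (res k) :=
  Continuous.inv₀ (by fun_prop) (I_mul_add_ne_zero hk)

theorem norm_res_sq (k ξ : ℝ) : ‖res k ξ‖ ^ 2 = (k ^ 2 + ξ ^ 2)⁻¹ := by
  rw [res, norm_inv, inv_pow, ← Complex.normSq_eq_norm_sq, Complex.normSq_apply]
  simp
  ring

theorem norm_res_neg (k ξ : ℝ) : ‖res (-k) ξ‖ = ‖res k ξ‖ := by
  rw [← sq_eq_sq₀ (norm_nonneg _) (norm_nonneg _), norm_res_sq, norm_res_sq, neg_sq]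

theorem norm_res_le (hk : k ≠ 0) (ξ : ℝ) : ‖res k ξ‖ ≤ |k|⁻¹ := by
  rw [← sq_le_sq₀ (norm_nonneg _) (by positivity), norm_res_sq, inv_pow, sq_abs]
  have : 0 < k ^ 2 := by positivity
  exact inv_anti₀ this (by nlinarith [sq_nonneg ξ])

theorem integrable_norm_res_sq (hk : k ≠ 0) :
    Integrable (fun ξ => ‖res k ξ‖ ^ 2) ∧ ∫ ξ, ‖res k ξ‖ ^ 2 = Real.pi / |k| := by
  have e : (fun ξ => ‖res k ξ‖ ^ 2) = fun ξ => (k ^ 2)⁻¹ * (1 + (ξ / k) ^ 2)⁻¹ := funext fun ξ => by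
    rw [norm_res_sq, ← mul_inv]
    congr 1
    field_simp
  rw [e]
  refine ⟨(integrable_inv_one_add_sq.comp_div hk).const_mul _, ?_⟩
  rw [integral_const_mul, Measure.integral_comp_div (fun x => (1 + x ^ 2)⁻¹),
    integral_univ_inv_one_add_sq, smul_eq_mul, ← sq_abs]
  have : |k| ≠ 0 := abs_ne_zero.2 hk
  field_simp

end Resolvent

/-! ### Weighted bounds -/

/-- `∫ |(iζ + k)⁻¹| S(ξ - ζ) dζ`. -/
def resConv (k : ℝ) (S : ℝ → ℝ) (ξ : ℝ) : ℝ := ∫ ζ, ‖res k ζ‖ * S (ξ - ζ)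

section Weighted

variable {k : ℝ} {S : ℝ → ℝ}

theorem integrable_res_mul (hk : k ≠ 0) (hS : Integrable S) (ξ : ℝ) :
    Integrable fun ζ => ‖res k ζ‖ * S (ξ - ζ) :=
  (hS.comp_sub_left ξ).bdd_mul (c := |k|⁻¹) (continuous_res hk).norm.aestronglyMeasurable
    (Eventually.of_forall fun ζ => by rw [norm_norm]; exact norm_res_le hk ζ)

theorem resConv_nonneg (h0 : ∀ ξ, 0 ≤ S ξ) (ξ : ℝ) : 0 ≤ resConv k S ξ :=
  integral_nonneg fun _ => mul_nonneg (norm_nonneg _) (h0 _)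

theorem resConv_le (hk : k ≠ 0) (h0 : ∀ ξ, 0 ≤ S ξ) (hS : Integrable S) (ξ : ℝ) :
    resConv k S ξ ≤ |k|⁻¹ * ∫ ζ, S ζ := by
  rw [← integral_sub_left_eq_self S volume ξ, ← integral_const_mul]
  exact integral_mono (integrable_res_mul hk hS ξ) ((hS.comp_sub_left ξ).const_mul _) fun ζ =>
    mul_le_mul_of_nonneg_right (norm_res_le hk ζ) (h0 _)

theorem measurable_resConv (hk : k ≠ 0) (hc : Continuous S) : Measurable (resConv k S) := by
  have : StronglyMeasurable fun p : ℝ × ℝ => ‖res k p.2‖ * S (p.1 - p.2) :=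
    (((continuous_res hk).comp continuous_snd).norm.mul
      (hc.comp (continuous_fst.sub continuous_snd))).stronglyMeasurable
  exact this.integral_prod_right'.measurable

theorem integrable_res_mul_res (hk : k ≠ 0) (h0 : ∀ ξ, 0 ≤ S ξ) (hc : Continuous S)
    (hS : Integrable S) :
    Integrable (fun p : ℝ × ℝ => ‖res k p.1‖ * (‖res k p.2‖ * S (p.1 - p.2)))
      (volume.prod volume)
    ∧ ∫ p : ℝ × ℝ, ‖res k p.1‖ * (‖res k p.2‖ * S (p.1 - p.2)) ∂(volume.prod volume)
      ≤ Real.pi / |k| * ∫ ζ, S ζ := by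
  obtain ⟨hw, ew⟩ := integrable_norm_res_sq hk
  have i1 : Integrable (fun p : ℝ × ℝ => ‖res k p.2‖ ^ 2 * S (p.1 - p.2))
      (volume.prod volume) := hw.convolution_integrand (ContinuousLinearMap.mul ℝ ℝ) hS
  have i2 : Integrable (fun p : ℝ × ℝ => ‖res k p.1‖ ^ 2 * S (p.1 - p.2))
      (volume.prod volume) := by
    refine ((hw.convolution_integrand (ContinuousLinearMap.mul ℝ ℝ) hS.comp_neg).swap).congr
      (Eventually.of_forall fun p => ?_)
    simp
  have e1 : ∫ p : ℝ × ℝ, ‖res k p.2‖ ^ 2 * S (p.1 - p.2) ∂(volume.prod volume)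
      = Real.pi / |k| * ∫ ζ, S ζ := by
    rw [integral_prod_symm _ i1]
    simp only [integral_const_mul, integral_sub_right_eq_self]
    rw [integral_mul_const, ew]
  have e2 : ∫ p : ℝ × ℝ, ‖res k p.1‖ ^ 2 * S (p.1 - p.2) ∂(volume.prod volume)
      = Real.pi / |k| * ∫ ζ, S ζ := by
    rw [integral_prod _ i2]
    simp only [integral_const_mul, integral_sub_left_eq_self]
    rw [integral_mul_const, ew]
  have hle : ∀ p : ℝ × ℝ, ‖res k p.1‖ * (‖res k p.2‖ * S (p.1 - p.2))
      ≤ (‖res k p.2‖ ^ 2 * S (p.1 - p.2) + ‖res k p.1‖ ^ 2 * S (p.1 - p.2)) / 2 := fun p => by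
    nlinarith [mul_nonneg (sq_nonneg (‖res k p.1‖ - ‖res k p.2‖)) (h0 (p.1 - p.2))]
  have hi : Integrable (fun p : ℝ × ℝ => ‖res k p.1‖ * (‖res k p.2‖ * S (p.1 - p.2)))
      (volume.prod volume) := by
    refine ((i1.add i2).div_const 2).mono' (Continuous.aestronglyMeasurable ?_)
      (Eventually.of_forall fun p => ?_)
    · have := continuous_res hk
      fun_prop
    · rw [Real.norm_of_nonneg (mul_nonneg (norm_nonneg _) (mul_nonneg (norm_nonneg _) (h0 _)))]
      exact hle p
  refine ⟨hi, (integral_mono hi ((i1.add i2).div_const 2) hle).trans (le_of_eq ?_)⟩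
  simp only [Pi.add_apply]
  rw [integral_div, integral_add i1 i2, e1, e2]
  ring

theorem integral_res_mul_resConv (hk : k ≠ 0) (h0 : ∀ ξ, 0 ≤ S ξ) (hc : Continuous S)
    (hS : Integrable S) : Integrable (fun ξ => ‖res k ξ‖ * resConv k S ξ)
      ∧ ∫ ξ, ‖res k ξ‖ * resConv k S ξ ≤ Real.pi / |k| * ∫ ζ, S ζ := by
  obtain ⟨hi, hle⟩ := integrable_res_mul_res hk h0 hc hS
  have e : ∀ ξ, ‖res k ξ‖ * resConv k S ξ
      = ∫ ζ, ‖res k ξ‖ * (‖res k ζ‖ * S (ξ - ζ)) := fun ξ => by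
    rw [integral_const_mul, resConv]
  simp only [e]
  refine ⟨hi.integral_prod_left, ?_⟩
  rw [← integral_prod _ hi]
  exact hle

end Weighted

theorem integral_mul_le_sqrt_mul_sqrt {w f g : ℝ → ℝ} (hw : ∀ x, 0 ≤ w x)
    (h1 : Integrable fun x => w x * f x ^ 2) (h2 : Integrable fun x => w x * g x ^ 2)
    (h3 : Integrable fun x => w x * (f x * g x)) :
    ∫ x, w x * (f x * g x)
      ≤ Real.sqrt (∫ x, w x * f x ^ 2) * Real.sqrt (∫ x, w x * g x ^ 2) := by
  set a := ∫ x, w x * f x ^ 2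
  set b := ∫ x, w x * (f x * g x)
  set c := ∫ x, w x * g x ^ 2
  have ha : 0 ≤ a := integral_nonneg fun x => mul_nonneg (hw x) (sq_nonneg _)
  have key : ∀ t : ℝ, 0 ≤ a * (t * t) + 2 * b * t + c := fun t => by
    have h0 : 0 ≤ ∫ x, w x * (t * f x + g x) ^ 2 :=
      integral_nonneg fun x => mul_nonneg (hw x) (sq_nonneg _)
    have e : ∀ x, w x * (t * f x + g x) ^ 2
        = (t * t) * (w x * f x ^ 2) + 2 * t * (w x * (f x * g x)) + w x * g x ^ 2 := fun x => by
      ring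
    have i : Integrable fun x => (t * t) * (w x * f x ^ 2) + 2 * t * (w x * (f x * g x)) :=
      (h1.const_mul _).add (h3.const_mul _)
    simp only [e] at h0
    rw [integral_add i h2, integral_add (h1.const_mul _) (h3.const_mul _), integral_const_mul,
      integral_const_mul] at h0
    linarith
  have hd := discrim_le_zero key
  rw [discrim] at hd
  rw [← Real.sqrt_mul ha]
  refine Real.le_sqrt_of_sq_le ?_
  nlinarith

/-! ### The unsymmetrised kernel of `ΛΓ` -/

/-- The kernel of `(∂ + k)⁻¹ P (∂ - k)⁻¹ R` on the Fourier side. -/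
def baseKernel (k : ℝ) (P R : 𝓢(ℝ, ℂ)) (ξ η : ℝ) : ℂ :=
  res k ξ * ∫ ζ, symbol P (ξ - ζ) * (res (-k) ζ * symbol R (ζ - η))

section BaseKernel

variable {k : ℝ}

/-- The left factor of the dominating kernel. -/
def baseLeft (k : ℝ) (P : 𝓢(ℝ, ℂ)) (ξ : ℝ) : ℝ :=
  ‖res k ξ‖ * Real.sqrt (resConv k (fun t => ‖symbol P t‖ ^ 2) ξ)

/-- The right factor of the dominating kernel. -/
def baseRight (k : ℝ) (R : 𝓢(ℝ, ℂ)) (η : ℝ) : ℝ :=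
  Real.sqrt (resConv k (fun t => ‖symbol R (-t)‖ ^ 2) η)

theorem integrable_symbol_mul (hk : k ≠ 0) (P R : 𝓢(ℝ, ℂ)) (ξ η : ℝ) :
    Integrable fun ζ => symbol P (ξ - ζ) * (res (-k) ζ * symbol R (ζ - η)) := by
  obtain ⟨C, hC⟩ := exists_norm_symbol_le R
  have hc : Continuous fun ζ => res (-k) ζ * symbol R (ζ - η) :=
    (continuous_res (neg_ne_zero.2 hk)).mul ((continuous_symbol R).comp (by fun_prop))
  refine ((integrable_symbol P).comp_sub_left ξ).mul_bdd (c := |k|⁻¹ * C)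
    hc.aestronglyMeasurable (Eventually.of_forall fun ζ => ?_)
  rw [norm_mul, norm_res_neg]
  exact mul_le_mul (norm_res_le hk ζ) (hC _) (norm_nonneg _) (by positivity)

theorem norm_baseKernel_le (hk : k ≠ 0) (P R : 𝓢(ℝ, ℂ)) (ξ η : ℝ) :
    ‖baseKernel k P R ξ η‖ ≤ baseLeft k P ξ * baseRight k R η := by
  rw [baseKernel, norm_mul, baseLeft, baseRight, mul_assoc]
  refine mul_le_mul_of_nonneg_left ?_ (norm_nonneg _)
  refine (norm_integral_le_integral_norm _).trans ?_
  have e : ∀ ζ, ‖symbol P (ξ - ζ) * (res (-k) ζ * symbol R (ζ - η))‖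
      = ‖res k ζ‖ * (‖symbol P (ξ - ζ)‖ * ‖symbol R (-(η - ζ))‖) := fun ζ => by
    rw [norm_mul, norm_mul, norm_res_neg, neg_sub]
    ring
  have h3 := (integrable_symbol_mul hk P R ξ η).norm
  simp only [e] at h3 ⊢
  exact integral_mul_le_sqrt_mul_sqrt (fun ζ => norm_nonneg _)
    (integrable_res_mul hk (integrable_norm_sq_symbol P) ξ)
    (integrable_res_mul hk (integrable_norm_sq_symbol R).comp_neg η) h3

theorem measurable_baseRight (hk : k ≠ 0) (R : 𝓢(ℝ, ℂ)) : Measurable (baseRight k R) :=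
  (measurable_resConv hk (((continuous_symbol R).comp continuous_neg).norm.pow 2)).sqrt

theorem exists_baseRight_le (hk : k ≠ 0) (R : 𝓢(ℝ, ℂ)) : ∃ C, ∀ η, ‖baseRight k R η‖ ≤ C :=
  ⟨_, fun η => by
    rw [baseRight, Real.norm_of_nonneg (Real.sqrt_nonneg _)]
    exact Real.sqrt_le_sqrt (resConv_le hk (fun ξ => by positivity)
      (integrable_norm_sq_symbol R).comp_neg η)⟩

theorem stronglyMeasurable_baseKernel (hk : k ≠ 0) (P R : 𝓢(ℝ, ℂ)) :
    StronglyMeasurable (Function.uncurry (baseKernel k P R)) := by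
  have h1 : StronglyMeasurable fun p : (ℝ × ℝ) × ℝ =>
      symbol P (p.1.1 - p.2) * (res (-k) p.2 * symbol R (p.2 - p.1.2)) := by
    have := continuous_symbol P
    have := continuous_symbol R
    have := continuous_res (neg_ne_zero.2 hk)
    exact Continuous.stronglyMeasurable (by fun_prop)
  exact ((continuous_res hk).comp continuous_fst).stronglyMeasurable.mul h1.integral_prod_right'

theorem productDominated_baseKernel (hk : k ≠ 0) (P R : 𝓢(ℝ, ℂ)) :
    ProductDominated (baseKernel k P R) (baseLeft k P) (baseRight k R)
      ((l2sq P + l2sq R) / (4 * |k|)) := by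
  obtain ⟨i1, e1⟩ := integral_res_mul_resConv hk (S := fun t => ‖symbol P t‖ ^ 2)
    (fun ξ => by positivity) ((continuous_symbol P).norm.pow 2) (integrable_norm_sq_symbol P)
  obtain ⟨i2, e2⟩ := integral_res_mul_resConv hk (S := fun t => ‖symbol R (-t)‖ ^ 2)
    (fun ξ => by positivity) (((continuous_symbol R).comp continuous_neg).norm.pow 2)
    (integrable_norm_sq_symbol R).comp_neg
  rw [integral_neg_eq_self (fun t => ‖symbol R t‖ ^ 2)] at e2
  rw [integral_norm_sq_symbol] at e1 e2
  set X := resConv k (fun t => ‖symbol P t‖ ^ 2) with hX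
  set Y := resConv k (fun t => ‖symbol R (-t)‖ ^ 2) with hY
  have hX0 : ∀ ξ, 0 ≤ X ξ := resConv_nonneg fun ξ => by positivity
  have hY0 : ∀ ξ, 0 ≤ Y ξ := resConv_nonneg fun ξ => by positivity
  have hle : ∀ ξ, baseLeft k P ξ * baseRight k R ξ
      ≤ (‖res k ξ‖ * X ξ + ‖res k ξ‖ * Y ξ) / 2 := fun ξ => by
    rw [baseLeft, baseRight, ← hX, ← hY, mul_assoc]
    have := mul_nonneg (norm_nonneg (res k ξ)) (sq_nonneg (Real.sqrt (X ξ) - Real.sqrt (Y ξ)))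
    rw [sub_sq, Real.sq_sqrt (hX0 ξ), Real.sq_sqrt (hY0 ξ)] at this
    linarith
  have hn : ∀ ξ, 0 ≤ baseLeft k P ξ * baseRight k R ξ := fun ξ =>
    mul_nonneg (mul_nonneg (norm_nonneg _) (Real.sqrt_nonneg _)) (Real.sqrt_nonneg _)
  have hi : Integrable fun ξ => baseLeft k P ξ * baseRight k R ξ := by
    refine ((i1.add i2).div_const 2).mono' ?_ (Eventually.of_forall fun ξ => ?_)
    · refine AEStronglyMeasurable.mul ?_ (measurable_baseRight hk R).aestronglyMeasurable
      exact (continuous_res hk).norm.aestronglyMeasurable.mul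
        (measurable_resConv hk ((continuous_symbol P).norm.pow 2)).sqrt.aestronglyMeasurable
    · rw [Real.norm_of_nonneg (hn ξ)]
      exact hle ξ
  exact {
    stronglyMeasurable := stronglyMeasurable_baseKernel hk P R
    nonneg_left := fun ξ => mul_nonneg (norm_nonneg _) (Real.sqrt_nonneg _)
    nonneg_right := fun ξ => Real.sqrt_nonneg _
    norm_le := norm_baseKernel_le hk P R
    integrable := hi
    integral_le := by
      refine (integral_mono hi ((i1.add i2).div_const 2) hle).trans ?_
      simp only [Pi.add_apply]
      rw [integral_div, integral_add i1 i2]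
      have hk' : |k| ≠ 0 := abs_ne_zero.2 hk
      have hp := Real.pi_ne_zero
      have e3 : (l2sq P + l2sq R) / (4 * |k|)
          = (Real.pi / |k| * ((2 * Real.pi)⁻¹ * l2sq P)
            + Real.pi / |k| * ((2 * Real.pi)⁻¹ * l2sq R)) / 2 := by
        field_simp
        ring
      rw [e3]
      linarith }

/-- The action of the kernel on an integrable function, in factorised form. -/
theorem integral_baseKernel_mul (hk : k ≠ 0) (P R : 𝓢(ℝ, ℂ)) {V : ℝ → ℂ} (hV : Integrable V)
    (ξ : ℝ) : ∫ η, baseKernel k P R ξ η * V η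
      = res k ξ * ∫ ζ, symbol P (ξ - ζ) * (res (-k) ζ * ∫ η, symbol R (ζ - η) * V η) := by
  obtain ⟨C, hC⟩ := exists_norm_symbol_le R
  have hr := continuous_res (neg_ne_zero.2 hk)
  have hR := continuous_symbol R
  have hi : Integrable (fun p : ℝ × ℝ => symbol P (ξ - p.2) * (res (-k) p.2
      * symbol R (p.2 - p.1)) * V p.1) (volume.prod volume) := by
    refine ((hV.mul_prod ((integrable_symbol P).comp_sub_left ξ)).mul_bdd
      (f := fun p : ℝ × ℝ => V p.1 * symbol P (ξ - p.2))
      (g := fun p : ℝ × ℝ => res (-k) p.2 * symbol R (p.2 - p.1)) (c := |k|⁻¹ * C)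
      (Continuous.aestronglyMeasurable (by fun_prop)) (Eventually.of_forall fun p => ?_)).congr
      (Eventually.of_forall fun p => ?_)
    · rw [norm_mul, norm_res_neg]
      exact mul_le_mul (norm_res_le hk _) (hC _) (norm_nonneg _) (by positivity)
    · simp only
      ring
  simp only [baseKernel, mul_assoc (res k ξ)]
  rw [integral_const_mul]
  simp only [← integral_mul_const]
  rw [integral_integral_swap hi]
  congr 1
  refine integral_congr_ae (Eventually.of_forall fun ζ => ?_)
  simp only
  rw [← integral_const_mul, ← integral_const_mul]
  refine integral_congr_ae (Eventually.of_forall fun η => ?_)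
  simp only
  ring

end BaseKernel

/-! ### The response to exponentials and the trace formula -/

/-- The exponential `exp(i η y)`. -/
def expI (η y : ℝ) : ℂ := Complex.exp (Complex.I * η * y)

theorem continuous_expI (η : ℝ) : Continuous (expI η) := by
  unfold expI
  fun_prop

theorem norm_expI (η y : ℝ) : ‖expI η y‖ = 1 := norm_exp_I_mul η y

theorem hasDerivAt_expI (η x : ℝ) : HasDerivAt (expI η) (Complex.I * η * expI η x) x := by
  have h : HasDerivAt (fun y : ℝ => Complex.I * η * y) (Complex.I * η) x := by
    simpa using (Complex.ofRealCLM.hasDerivAt (x := x)).const_mul (Complex.I * η)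
  exact h.cexp.congr_deriv (mul_comm _ _)

theorem ft_mul_expI (R : 𝓢(ℝ, ℂ)) (η ζ : ℝ) :
    ft (fun x => R x * expI η x) ζ = 2 * Real.pi * symbol R (ζ - η) := by
  have hp : (Real.pi : ℂ) ≠ 0 := Complex.ofReal_ne_zero.2 Real.pi_ne_zero
  have : ft R (ζ - η) = 2 * Real.pi * symbol R (ζ - η) := by
    rw [symbol]
    push_cast
    field_simp
  rw [← this, ft, ft]
  refine integral_congr_ae (Eventually.of_forall fun x => ?_)
  simp only [expI]
  rw [show -(Complex.I * ((ζ - η : ℝ) : ℂ) * x) = -(Complex.I * ζ * x) + Complex.I * η * x by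
    push_cast; ring, Complex.exp_add]
  ring

theorem integrable_schwartz_mul_bounded (P : 𝓢(ℝ, ℂ)) {u : ℝ → ℂ} {B : ℝ} (hu : Continuous u)
    (hB : ∀ x, ‖u x‖ ≤ B) : Integrable fun x => P x * u x :=
  P.integrable.mul_bdd (c := B) hu.aestronglyMeasurable (Eventually.of_forall hB)

theorem norm_schwartz_mul_le (P : 𝓢(ℝ, ℂ)) {u : ℝ → ℂ} {B : ℝ} (hB : ∀ x, ‖u x‖ ≤ B) (x : ℝ) :
    ‖P x * u x‖ ≤ supNorm P * B := by
  rw [norm_mul]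
  exact mul_le_mul (norm_le_supNorm P x) (hB x) (norm_nonneg _) (supNorm_nonneg P)

/-- The Fourier transform of a bounded solution of `X' = -k X + g`. -/
theorem ft_of_ode {k M N : ℝ} (hk : k ≠ 0) {g X : ℝ → ℂ} (hc : Continuous g)
    (hi : Integrable g) (hM : ∀ y, ‖g y‖ ≤ M) (hN : ∀ y, ‖X y‖ ≤ N)
    (hX : ∀ x, HasDerivAt X (-k * X x + g x) x) (ξ : ℝ) : ft X ξ = res k ξ * ft g ξ := by
  have hXi := integrable_of_hasDerivAt hk hc hi hM hN hX
  have h1 := ft_of_hasDerivAt hXi hX ((hXi.const_mul _).add hi) ξ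
  rw [ft_add (hXi.const_mul _) hi, ft_const_mul] at h1
  have h0 := I_mul_add_ne_zero hk ξ
  rw [res, eq_inv_mul_iff_mul_eq₀ h0]
  linear_combination -h1

/-- Bounded solutions of `u₀' = -k u₀ + z P u₁ + exp(iη·)`, `u₁' = k u₁ + R u₀`. -/
structure ExpResponse (k : ℝ) (z : ℂ) (P R : 𝓢(ℝ, ℂ)) (η : ℝ) (u₀ u₁ : ℝ → ℂ) : Prop where
  bounded_zero : ∃ B, ∀ x, ‖u₀ x‖ ≤ B
  bounded_one : ∃ B, ∀ x, ‖u₁ x‖ ≤ B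
  hasDerivAt_zero : ∀ x, HasDerivAt u₀ (-k * u₀ x + z * (P x * u₁ x) + expI η x) x
  hasDerivAt_one : ∀ x, HasDerivAt u₁ (k * u₁ x + R x * u₀ x) x

namespace ExpResponse

variable {k : ℝ} {z : ℂ} {P R : 𝓢(ℝ, ℂ)} {η : ℝ} {u₀ u₁ : ℝ → ℂ}

theorem continuous_zero (h : ExpResponse k z P R η u₀ u₁) : Continuous u₀ :=
  continuous_iff_continuousAt.2 fun x => (h.hasDerivAt_zero x).continuousAt

theorem continuous_one (h : ExpResponse k z P R η u₀ u₁) : Continuous u₁ :=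
  continuous_iff_continuousAt.2 fun x => (h.hasDerivAt_one x).continuousAt

theorem integrable_left (h : ExpResponse k z P R η u₀ u₁) : Integrable fun x => P x * u₁ x := by
  obtain ⟨B, hB⟩ := h.bounded_one
  exact integrable_schwartz_mul_bounded P h.continuous_one hB

theorem exists_norm_ft_le (h : ExpResponse k z P R η u₀ u₁) (hk : k ≠ 0) :
    ∃ C, ∀ ξ, ‖ft (fun x => P x * u₁ x) ξ‖ ≤ C * ‖res k ξ‖ := by
  obtain ⟨B₀, h0⟩ := h.bounded_zero
  obtain ⟨B₁, h1⟩ := h.bounded_one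
  have hB : ∀ x, ‖k * u₁ x + R x * u₀ x‖ ≤ |k| * B₁ + supNorm R * B₀ := fun x => by
    refine (norm_add_le _ _).trans (add_le_add ?_ (norm_schwartz_mul_le R h0 x))
    rw [norm_mul, Complex.norm_real]
    exact mul_le_mul_of_nonneg_left (h1 x) (norm_nonneg _)
  have hc : Continuous fun x => k * u₁ x + R x * u₀ x :=
    (continuous_const.mul h.continuous_one).add (R.continuous.mul h.continuous_zero)
  have hd : ∀ x, HasDerivAt (fun x => P x * u₁ x)
      (SchwartzMap.derivCLM ℂ ℂ P x * u₁ x + P x * (k * u₁ x + R x * u₀ x)) x := fun x =>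
    (P.hasDerivAt x).mul (h.hasDerivAt_one x)
  have hdi : Integrable fun x =>
      SchwartzMap.derivCLM ℂ ℂ P x * u₁ x + P x * (k * u₁ x + R x * u₀ x) :=
    (integrable_schwartz_mul_bounded _ h.continuous_one h1).add
      (integrable_schwartz_mul_bounded P hc hB)
  have hki := h.integrable_left.const_mul (k : ℂ)
  refine ⟨∫ x, ‖SchwartzMap.derivCLM ℂ ℂ P x * u₁ x + P x * (k * u₁ x + R x * u₀ x)
    + k * (P x * u₁ x)‖, fun ξ => ?_⟩
  have e := ft_add hdi hki ξ
  rw [ft_of_hasDerivAt h.integrable_left hd hdi, ft_const_mul, ← add_mul] at e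
  have e' : ft (fun x => P x * u₁ x) ξ = ft (fun x =>
      SchwartzMap.derivCLM ℂ ℂ P x * u₁ x + P x * (k * u₁ x + R x * u₀ x) + k * (P x * u₁ x)) ξ
      * res k ξ := by
    rw [e, res, mul_comm, inv_mul_cancel_left₀ (I_mul_add_ne_zero hk ξ)]
  rw [e', norm_mul]
  exact mul_le_mul_of_nonneg_right (norm_ft_le _ ξ) (norm_nonneg _)

/-- The amplitude that solves the fixed-point equation of the Neumann series. -/
def amplitude (k : ℝ) (P : 𝓢(ℝ, ℂ)) (η : ℝ) (u₁ : ℝ → ℂ) (ξ : ℝ) : ℂ :=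
  res k ξ * ft (fun x => P x * u₁ x) ξ / (2 * Real.pi * res k η)

theorem continuous_amplitude (h : ExpResponse k z P R η u₀ u₁) (hk : k ≠ 0) :
    Continuous (amplitude k P η u₁) :=
  ((continuous_res hk).mul (continuous_ft h.integrable_left)).div_const _

theorem integrable_amplitude (h : ExpResponse k z P R η u₀ u₁) (hk : k ≠ 0) :
    Integrable (amplitude k P η u₁) := by
  obtain ⟨C, hC⟩ := h.exists_norm_ft_le hk
  refine Integrable.div_const (((integrable_norm_res_sq hk).1.const_mul C).mono'
    ((continuous_res hk).mul (continuous_ft h.integrable_left)).aestronglyMeasurable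
    (Eventually.of_forall fun ξ => ?_)) _
  rw [Pi.mul_apply, norm_mul]
  calc ‖res k ξ‖ * ‖ft (fun x => P x * u₁ x) ξ‖ ≤ ‖res k ξ‖ * (C * ‖res k ξ‖) :=
        mul_le_mul_of_nonneg_left (hC ξ) (norm_nonneg _)
    _ = _ := by ring

theorem two_pi_mul_res_ne_zero (hk : k ≠ 0) (η : ℝ) : (2 * Real.pi * res k η : ℂ) ≠ 0 :=
  mul_ne_zero (mul_ne_zero two_ne_zero (Complex.ofReal_ne_zero.2 Real.pi_ne_zero))
    (res_ne_zero hk η)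

theorem ft_right (h : ExpResponse k z P R η u₀ u₁) (hk : k ≠ 0) (ζ : ℝ) :
    ft (fun x => R x * u₀ x) ζ = 2 * Real.pi * res k η
      * (symbol R (ζ - η) + z * ∫ ξ, symbol R (ζ - ξ) * amplitude k P η u₁ ξ) := by
  obtain ⟨B₀, h0⟩ := h.bounded_zero
  obtain ⟨B₁, h1⟩ := h.bounded_one
  set w : ℝ → ℂ := fun x => u₀ x - res k η * expI η x with hw
  have hwd : ∀ x, HasDerivAt w (-k * w x + z * (P x * u₁ x)) x := fun x => by
    refine ((h.hasDerivAt_zero x).sub ((hasDerivAt_expI η x).const_mul (res k η))).congr_deriv ?_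
    have e : res k η * (Complex.I * η + k) = 1 := inv_mul_cancel₀ (I_mul_add_ne_zero hk η)
    simp only [hw]
    linear_combination -expI η x * e
  have hwb : ∀ x, ‖w x‖ ≤ B₀ + ‖res k η‖ := fun x => by
    refine (norm_sub_le _ _).trans (add_le_add (h0 x) ?_)
    rw [norm_mul, norm_expI, mul_one]
  have hg : Continuous fun x => z * (P x * u₁ x) :=
    continuous_const.mul (P.continuous.mul h.continuous_one)
  have hgi : Integrable fun x => z * (P x * u₁ x) := h.integrable_left.const_mul z
  have hgb : ∀ x, ‖z * (P x * u₁ x)‖ ≤ ‖z‖ * (supNorm P * B₁) := fun x => by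
    rw [norm_mul]
    exact mul_le_mul_of_nonneg_left (norm_schwartz_mul_le P h1 x) (norm_nonneg _)
  have hwi := integrable_of_hasDerivAt hk hg hgi hgb hwb hwd
  have hwc : Continuous w := continuous_iff_continuousAt.2 fun x => (hwd x).continuousAt
  have hft : ∀ ξ, ft w ξ = z * (2 * Real.pi * res k η) * amplitude k P η u₁ ξ := fun ξ => by
    rw [ft_of_ode hk hg hgi hgb hwb hwd, ft_const_mul, amplitude]
    field_simp [two_pi_mul_res_ne_zero hk η, res_ne_zero hk η]
  have e1 : (fun x => R x * u₀ x) = fun x => R x * w x + res k η * (R x * expI η x) :=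
    funext fun x => by simp only [hw]; ring
  rw [e1, ft_add (integrable_schwartz_mul_bounded R hwc hwb)
    ((integrable_schwartz_mul_bounded R (continuous_expI η) fun x => (norm_expI η x).le).const_mul _),
    ft_const_mul, ft_mul_expI, ft_mul R hwi]
  simp only [hft]
  have e2 : ∫ ξ, symbol R (ζ - ξ) * (z * (2 * Real.pi * res k η) * amplitude k P η u₁ ξ)
      = z * (2 * Real.pi * res k η) * ∫ ξ, symbol R (ζ - ξ) * amplitude k P η u₁ ξ := by
    rw [← integral_const_mul]
    refine integral_congr_ae (Eventually.of_forall fun ξ => ?_)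
    simp only
    ring
  rw [e2]
  ring

theorem amplitude_eq (h : ExpResponse k z P R η u₀ u₁) (hk : k ≠ 0) (ξ : ℝ) :
    amplitude k P η u₁ ξ = baseKernel k P R ξ η
      + z * ∫ ζ, baseKernel k P R ξ ζ * amplitude k P η u₁ ζ := by
  obtain ⟨B₀, h0⟩ := h.bounded_zero
  obtain ⟨B₁, h1⟩ := h.bounded_one
  have hk' := neg_ne_zero.2 hk
  have hRc : Continuous fun x => R x * u₀ x := R.continuous.mul h.continuous_zero
  have hRi : Integrable fun x => R x * u₀ x :=
    integrable_schwartz_mul_bounded R h.continuous_zero h0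
  have hd : ∀ x, HasDerivAt u₁ (-(-k : ℝ) * u₁ x + R x * u₀ x) x := fun x =>
    (h.hasDerivAt_one x).congr_deriv (by push_cast; ring)
  have hu : Integrable u₁ := integrable_of_hasDerivAt hk' hRc hRi (norm_schwartz_mul_le R h0) h1 hd
  have hV := h.integrable_amplitude hk
  have hN := two_pi_mul_res_ne_zero hk η
  obtain ⟨C, hC⟩ := exists_norm_symbol_le R
  have hCV : ∀ ζ, ‖∫ ξ, symbol R (ζ - ξ) * amplitude k P η u₁ ξ‖
      ≤ ∫ ξ, C * ‖amplitude k P η u₁ ξ‖ := fun ζ =>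
    norm_integral_le_of_norm_le (hV.norm.const_mul C) (Eventually.of_forall fun ξ => by
      rw [norm_mul]
      exact mul_le_mul_of_nonneg_right (hC _) (norm_nonneg _))
  have hmV : AEStronglyMeasurable fun ζ => ∫ ξ, symbol R (ζ - ξ) * amplitude k P η u₁ ξ := by
    have : StronglyMeasurable fun p : ℝ × ℝ => symbol R (p.1 - p.2) * amplitude k P η u₁ p.2 :=
      (((continuous_symbol R).comp (continuous_fst.sub continuous_snd)).mul
        ((h.continuous_amplitude hk).comp continuous_snd)).stronglyMeasurable
    exact this.integral_prod_right'.aestronglyMeasurable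
  have hi2 : Integrable fun ζ => symbol P (ξ - ζ) * (res (-k) ζ
      * ∫ ξ, symbol R (ζ - ξ) * amplitude k P η u₁ ξ) := by
    refine ((integrable_symbol P).comp_sub_left ξ).mul_bdd
      (c := |k|⁻¹ * ∫ ξ, C * ‖amplitude k P η u₁ ξ‖)
      ((continuous_res hk').aestronglyMeasurable.mul hmV) (Eventually.of_forall fun ζ => ?_)
    rw [norm_mul, norm_res_neg]
    exact mul_le_mul (norm_res_le hk ζ) (hCV ζ) (norm_nonneg _) (by positivity)
  have e : ∀ ζ, symbol P (ξ - ζ) * ft u₁ ζ = 2 * Real.pi * res k η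
      * (symbol P (ξ - ζ) * (res (-k) ζ * symbol R (ζ - η)) + z * (symbol P (ξ - ζ) * (res (-k) ζ
      * ∫ ξ, symbol R (ζ - ξ) * amplitude k P η u₁ ξ))) := fun ζ => by
    rw [ft_of_ode hk' hRc hRi (norm_schwartz_mul_le R h0) h1 hd, h.ft_right hk]
    ring
  rw [integral_baseKernel_mul hk P R hV, baseKernel]
  nth_rewrite 1 [amplitude]
  rw [ft_mul P hu]
  simp only [e]
  rw [integral_const_mul, integral_add (integrable_symbol_mul hk P R ξ η) (hi2.const_mul z),
    integral_const_mul, div_eq_iff hN]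
  ring

/-- The Neumann series for the amplitude. -/
theorem hasSum_amplitude (h : ExpResponse k z P R η u₀ u₁) (hk : k ≠ 0)
    (hs : (l2sq P + l2sq R) / (4 * |k|) < 1) (hz : ‖z‖ ≤ 1) (ξ : ℝ) :
    HasSum (fun n => z ^ n * kerPow (baseKernel k P R) n ξ η) (amplitude k P η u₁ ξ) := by
  obtain ⟨C, hC⟩ := exists_baseRight_le hk R
  exact (productDominated_baseKernel hk P R).hasSum_of_fixedPoint (measurable_baseRight hk R) hs hz
    (h.continuous_amplitude hk).aestronglyMeasurable
    ((h.integrable_amplitude hk).norm.bdd_mul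
      (measurable_baseRight hk R).aestronglyMeasurable (Eventually.of_forall hC))
    (h.amplitude_eq hk) ξ

end ExpResponse

section Trace

variable {k : ℝ} {z : ℂ} {P R : 𝓢(ℝ, ℂ)} {G : ℝ → ℝ → ℂ} {C c : ℝ}

/-- The trace formula: the sum of the traces of the powers is the integral of a diagonal entry of
the Green's function against the potential. -/
theorem hasSum_kerTrace_baseKernel (hk : k ≠ 0) (hs : (l2sq P + l2sq R) / (4 * |k|) < 1)
    (hz : ‖z‖ ≤ 1) (hG : Continuous fun p : ℝ × ℝ => G p.1 p.2) (hc : 0 < c)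
    (hGb : ∀ x y, ‖G x y‖ ≤ Real.exp (-(c * |x - y|)) * C) {u : ℝ → ℝ → ℂ}
    (hu : ∀ η, ExpResponse k z P R η (u η) fun x => ∫ y, G x y * expI η y) :
    HasSum (fun n => z ^ n * kerTrace (kerPow (baseKernel k P R) n)) (∫ x, P x * G x x) := by
  set H : ℝ → ℂ := fun s => ∫ x, P x * G x (x - s) with hH
  have hGs : Continuous fun p : ℝ × ℝ => G p.1 (p.1 - p.2) :=
    hG.comp (continuous_fst.prodMk (continuous_fst.sub continuous_snd))
  have hb : ∀ x s, ‖G x (x - s)‖ ≤ Real.exp (-(c * |s|)) * C := fun x s => by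
    simpa using hGb x (x - s)
  have hC : 0 ≤ C := by
    have := (norm_nonneg _).trans (hb 0 0)
    simpa using this
  have hb' : ∀ x s, ‖P x * G x (x - s)‖ ≤ ‖P x‖ * C := fun x s => by
    rw [norm_mul]
    refine mul_le_mul_of_nonneg_left ((hb x s).trans (mul_le_of_le_one_left hC ?_)) (norm_nonneg _)
    rw [Real.exp_le_one_iff]
    have := abs_nonneg s
    nlinarith
  have hi : Integrable (fun p : ℝ × ℝ => P p.1 * G p.1 (p.1 - p.2)) (volume.prod volume) := by
    refine (P.integrable.norm.mul_prod ((integrable_exp_abs hc).mul_const C)).mono'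
      ((P.continuous.comp continuous_fst).mul hGs).aestronglyMeasurable
      (Eventually.of_forall fun p => ?_)
    rw [norm_mul]
    exact mul_le_mul_of_nonneg_left (hb _ _) (norm_nonneg _)
  have hHi : Integrable H := hi.integral_prod_right
  have hHc : Continuous H := by
    refine continuous_of_dominated (bound := fun x => ‖P x‖ * C) (fun s => ?_)
      (fun s => Eventually.of_forall fun x => hb' x s) (P.integrable.norm.mul_const C)
      (Eventually.of_forall fun x => ?_)
    · exact (P.continuous.mul (hGs.comp (continuous_id.prodMk continuous_const))).aestronglyMeasurable
    · exact continuous_const.mul (hGs.comp (continuous_const.prodMk continuous_id))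
  have hft : ∀ η, ExpResponse.amplitude k P η (fun x => ∫ y, G x y * expI η y) η
      = (2 * Real.pi : ℂ)⁻¹ * ft H η := fun η => by
    have e1 : ft (fun x => P x * ∫ y, G x y * expI η y) η = ft H η := by
      have e2 : ∀ x : ℝ, Complex.exp (-(Complex.I * η * x)) * (P x * ∫ y, G x y * expI η y)
          = ∫ s : ℝ, Complex.exp (-(Complex.I * η * s)) * (P x * G x (x - s)) := fun x => by
        rw [← integral_sub_left_eq_self (fun y => G x y * expI η y) volume x,
          ← integral_const_mul, ← integral_const_mul]
        refine integral_congr_ae (Eventually.of_forall fun s => ?_)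
        simp only [expI]
        rw [show Complex.I * η * ((x - s : ℝ) : ℂ)
          = Complex.I * η * x + -(Complex.I * η * s) by push_cast; ring, Complex.exp_add]
        have := Complex.exp_ne_zero (Complex.I * η * x)
        rw [Complex.exp_neg (Complex.I * η * x)]
        field_simp
      have hi' : Integrable (fun p : ℝ × ℝ => Complex.exp (-(Complex.I * η * p.2))
          * (P p.1 * G p.1 (p.1 - p.2))) (volume.prod volume) :=
        hi.bdd_mul (c := 1) (Continuous.aestronglyMeasurable (by fun_prop))
          (Eventually.of_forall fun p => (norm_exp_neg_I_mul η p.2).le)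
      rw [ft]
      simp only [e2]
      rw [integral_integral_swap hi', ft]
      simp only [integral_const_mul, hH]
    have hp : (Real.pi : ℂ) ≠ 0 := Complex.ofReal_ne_zero.2 Real.pi_ne_zero
    have hr := res_ne_zero hk η
    rw [ExpResponse.amplitude, e1]
    field_simp
  have hm : AEStronglyMeasurable fun η => (2 * Real.pi : ℂ)⁻¹ * ft H η :=
    (continuous_const.mul (continuous_ft hHi)).aestronglyMeasurable
  obtain ⟨hD, hsum⟩ := (productDominated_baseKernel hk P R).hasSum_kerTrace
    (measurable_baseRight hk R) hs hz hm fun η => by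
      rw [← hft]
      exact (hu η).hasSum_amplitude hk hs hz η
  have hp : (2 * Real.pi : ℂ) ≠ 0 :=
    mul_ne_zero two_ne_zero (Complex.ofReal_ne_zero.2 Real.pi_ne_zero)
  have hfti : Integrable (ft H) := by
    refine (hD.const_mul (2 * Real.pi : ℂ)).congr (Eventually.of_forall fun η => ?_)
    simp only
    rw [mul_inv_cancel_left₀ hp]
  rw [integral_const_mul, integral_ft hHc hHi hfti, inv_mul_cancel_left₀ hp] at hsum
  simpa [hH] using hsum

end Trace

/-! ### The perturbation determinant as a Wronskian -/

theorem l2sq_smul (c : ℂ) (P : 𝓢(ℝ, ℂ)) : l2sq (c • P) = ‖c‖ ^ 2 * l2sq P := by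
  rw [l2sq, l2sq, ← integral_const_mul]
  refine integral_congr_ae (Eventually.of_forall fun x => ?_)
  simp only [smul_apply, smul_eq_mul, norm_mul, mul_pow]

theorem l2sq_real_smul (z : ℝ) (P : 𝓢(ℝ, ℂ)) : l2sq (z • P) = z ^ 2 * l2sq P := by
  rw [l2sq, l2sq, ← integral_const_mul]
  refine integral_congr_ae (Eventually.of_forall fun x => ?_)
  simp only [smul_apply, norm_smul, mul_pow, Real.norm_eq_abs, sq_abs]

theorem jostInner_zero (k : ℝ) (w : ℝ → ℂ) (x : ℝ) : jostInner k 0 w x = 0 := by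
  simp [jostInner, rint]

theorem jostA_zero_left {k : ℝ} {R : 𝓢(ℝ, ℂ)} (h : Small k 0 R) (x : ℝ) : jostA k 0 R x = 1 := by
  rw [(jostA_spec h).2.2 x]
  simp [jostOp, rint]

theorem jostA_zero_right {k : ℝ} {P : 𝓢(ℝ, ℂ)} (h : Small k P 0) (x : ℝ) : jostA k P 0 x = 1 := by
  rw [(jostA_spec h).2.2 x]
  simp [jostOp, jostInner_zero, rint]

theorem wronskian_zero_left {k : ℝ} {R : 𝓢(ℝ, ℂ)} (h : Small k 0 R) : wronskian k 0 R = 1 := by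
  have h' : Small k (refl R) 0 := by simpa using h.refl
  simp [wronskian, jostC, jostD, jostB, jostA_zero_left h, map_zero, jostA_zero_right h',
    jostInner_zero]

theorem wronskian_zero_right {k : ℝ} {P : 𝓢(ℝ, ℂ)} (h : Small k P 0) : wronskian k P 0 = 1 := by
  have h' : Small k 0 (refl P) := by simpa using h.refl
  rw [← wronskian_refl, map_zero, wronskian_zero_left h']

theorem eventually_l2sq_lt {k t : ℝ} {P R : ℝ → 𝓢(ℝ, ℂ)} {Pd Rd : 𝓢(ℝ, ℂ)}
    (hP : HasTimeDeriv P Pd t) (hR : HasTimeDeriv R Rd t)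
    (h : l2sq (P t) + l2sq (R t) < k) : ∀ᶠ τ in 𝓝 t, l2sq (P τ) + l2sq (R τ) < k := by
  have hl := ((continuous_l2sq.tendsto _).comp hP.tendsto).add
    ((continuous_l2sq.tendsto _).comp hR.tendsto)
  have h1 : ∀ᶠ τ in 𝓝[≠] t, l2sq (P τ) + l2sq (R τ) < k := hl.eventually (gt_mem_nhds h)
  rw [eventually_nhdsWithin_iff] at h1
  filter_upwards [h1] with τ hτ
  by_cases e : τ = t
  · subst e
    exact h
  · exact hτ e

theorem smallCurve_of_lt {k t : ℝ} {P R : ℝ → 𝓢(ℝ, ℂ)} {Pd Rd : 𝓢(ℝ, ℂ)}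
    (hP : HasTimeDeriv P Pd t) (hR : HasTimeDeriv R Rd t) (hk : 0 < k)
    (h : l2sq (P t) + l2sq (R t) < k) : SmallCurve k t P R Pd Rd :=
  ⟨hP, hR, (eventually_l2sq_lt hP hR h).mono fun _ hτ => ⟨hk, hτ.le⟩⟩

theorem SmallCurve.hasDerivAt_log_wronskian {k t : ℝ} {P R : ℝ → 𝓢(ℝ, ℂ)} {Pd Rd : 𝓢(ℝ, ℂ)}
    (h : SmallCurve k t P R Pd Rd) :
    HasDerivAt (fun τ => Complex.log (wronskian k (P τ) (R τ)))
      (-∫ x, (Pd x * diag21 k (P t) (R t) x + Rd x * diag12 k (P t) (R t) x)) t := by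
  refine (h.hasDerivAt_wronskian.clog_real (wronskian_mem_slitPlane h.small_self)).congr_deriv ?_
  rw [neg_div, ← integral_div]
  congr 1
  refine integral_congr_ae (Eventually.of_forall fun x => ?_)
  simp only [diag21, diag12]
  ring

theorem hasTimeDeriv_const (P : 𝓢(ℝ, ℂ)) (t : ℝ) : HasTimeDeriv (fun _ => P) 0 t := by
  simpa using hasTimeDeriv_affine P 0 t

theorem hasTimeDeriv_smul (P : 𝓢(ℝ, ℂ)) (t : ℝ) : HasTimeDeriv (fun τ => τ • P) P t := by
  simpa using hasTimeDeriv_affine 0 P t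

theorem l2sq_real_smul_le {z : ℝ} (h0 : 0 ≤ z) (h1 : z ≤ 1) (P : 𝓢(ℝ, ℂ)) :
    l2sq (z • P) ≤ l2sq P := by
  rw [l2sq_real_smul]
  exact mul_le_of_le_one_left (l2sq_nonneg P) (pow_le_one₀ h0 h1)

/-- Integration of a power series that represents the derivative of `-L` on `[0, 1]`. -/
theorem hasSum_of_hasDerivAt {T : ℕ → ℂ} {ρ : ℝ} (hρ0 : 0 ≤ ρ) (hρ : ρ < 1)
    (hT : ∀ n, ‖T n‖ ≤ ρ ^ (n + 1)) {L D : ℝ → ℂ} (h0 : L 0 = 0)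
    (hL : ∀ z ∈ Set.Icc (0 : ℝ) 1, HasDerivAt L (-D z) z)
    (hD : ∀ z ∈ Set.Icc (0 : ℝ) 1, HasSum (fun n => (z : ℂ) ^ n * T n) (D z)) :
    HasSum (fun n : ℕ => 1 / ((n : ℂ) + 1) * T n) (-L 1) := by
  have hb : ∀ n, ∀ z ∈ Set.Icc (0 : ℝ) 1, ‖(z : ℂ) ^ n * T n‖ ≤ ρ ^ (n + 1) := fun n z hz => by
    rw [norm_mul, norm_pow, Complex.norm_real, Real.norm_of_nonneg hz.1]
    exact (mul_le_of_le_one_left (norm_nonneg _) (pow_le_one₀ hz.1 hz.2)).trans (hT n)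
  have hs : Summable fun n : ℕ => ρ ^ (n + 1) :=
    (summable_nat_add_iff 1).2 (summable_geometric_of_lt_one hρ0 hρ)
  have hc : ContinuousOn D (Set.Icc 0 1) := by
    refine (continuousOn_tsum (fun n => Continuous.continuousOn (by fun_prop)) hs hb).congr
      fun z hz => (hD z hz).tsum_eq.symm
  have hu : Set.uIcc (0 : ℝ) 1 = Set.Icc 0 1 := Set.uIcc_of_le zero_le_one
  have hI : Set.uIoc (0 : ℝ) 1 ⊆ Set.Icc 0 1 := by
    rw [Set.uIoc_of_le zero_le_one]
    exact Set.Ioc_subset_Icc_self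
  have e1 : ∫ z in (0 : ℝ)..1, -D z = L 1 - L 0 :=
    intervalIntegral.integral_eq_sub_of_hasDerivAt (fun z hz => hL z (hu ▸ hz))
      (ContinuousOn.intervalIntegrable (by rw [hu]; exact hc.neg))
  have e2 := intervalIntegral.hasSum_integral_of_dominated_convergence (μ := volume) (a := 0)
    (b := 1) (F := fun n (z : ℝ) => (z : ℂ) ^ n * T n) (f := D) (fun n _ => ρ ^ (n + 1))
    (fun n => Continuous.aestronglyMeasurable (by fun_prop))
    (fun n => Eventually.of_forall fun z hz => hb n z (hI hz))
    (Eventually.of_forall fun z _ => hs) (by simp)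
    (Eventually.of_forall fun z hz => hD z (hI hz))
  rw [intervalIntegral.integral_neg, h0, sub_zero, neg_eq_iff_eq_neg] at e1
  rw [e1] at e2
  refine e2.congr_fun fun n => ?_
  rw [intervalIntegral.integral_mul_const]
  congr 1
  have := integral_pow (a := 0) (b := 1) n
  have e3 : ∫ z in (0 : ℝ)..1, (z : ℂ) ^ n = ((∫ z in (0 : ℝ)..1, z ^ n : ℝ) : ℂ) := by
    rw [← intervalIntegral.integral_ofReal]
    simp
  rw [e3, this]
  simp

section LogSeries

variable {k : ℝ} {P R : 𝓢(ℝ, ℂ)}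

theorem expResponse_pos {z : ℝ} (h : Small k (z • P) R) (η : ℝ) :
    ExpResponse k z P R η (greenColumn k (z • P) R 0 0 (expI η))
      (fun x => ∫ y, greenPos k (z • P) R x y 1 0 * expI η y) where
  bounded_zero := exists_norm_greenColumn_le h (continuous_expI η) (fun x => (norm_expI η x).le) 0 0
  bounded_one := exists_norm_greenColumn_le h (continuous_expI η) (fun x => (norm_expI η x).le) 1 0
  hasDerivAt_zero x := by
    refine (hasDerivAt_greenColumn_zero h (continuous_expI η) (fun x => (norm_expI η x).le)
      0 x).congr_deriv ?_
    simp only [smul_apply, Complex.real_smul, if_pos, greenColumn]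
    ring
  hasDerivAt_one x := by
    refine (hasDerivAt_greenColumn_one h (continuous_expI η) (fun x => (norm_expI η x).le)
      0 x).congr_deriv ?_
    simp [greenColumn]

theorem expResponse_neg {z : ℝ} (h : Small k R (z • P)) (η : ℝ) :
    ExpResponse (-k) z P R η (greenColumn k R (z • P) 1 1 (expI η))
      (fun x => ∫ y, greenPos k R (z • P) x y 0 1 * expI η y) where
  bounded_zero := exists_norm_greenColumn_le h (continuous_expI η) (fun x => (norm_expI η x).le) 1 1
  bounded_one := exists_norm_greenColumn_le h (continuous_expI η) (fun x => (norm_expI η x).le) 0 1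
  hasDerivAt_zero x := by
    refine (hasDerivAt_greenColumn_one h (continuous_expI η) (fun x => (norm_expI η x).le)
      1 x).congr_deriv ?_
    simp only [smul_apply, Complex.real_smul, if_pos, greenColumn]
    push_cast
    ring
  hasDerivAt_one x := by
    refine (hasDerivAt_greenColumn_zero h (continuous_expI η) (fun x => (norm_expI η x).le)
      1 x).congr_deriv ?_
    simp [greenColumn]

theorem small_ratio (hk : 0 < k) (h : l2sq P + l2sq R < k) :
    (l2sq P + l2sq R) / (4 * k) < 1 := by
  rw [div_lt_one (by positivity)]
  linarith

theorem norm_real_le_one {z : ℝ} (hz : z ∈ Set.Icc (0 : ℝ) 1) : ‖(z : ℂ)‖ ≤ 1 := by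
  rw [Complex.norm_real, Real.norm_of_nonneg hz.1]
  exact hz.2

theorem hasSum_log_wronskian_pos (hk : 0 < k) (h : l2sq P + l2sq R < k) :
    HasSum (fun n : ℕ => 1 / ((n : ℂ) + 1) * kerTrace (kerPow (baseKernel k P R) n))
      (-Complex.log (wronskian k P R)) := by
  have hk0 := hk.ne'
  have hd := productDominated_baseKernel hk0 P R
  rw [abs_of_pos hk] at hd
  have hs : ∀ z ∈ Set.Icc (0 : ℝ) 1, l2sq (z • P) + l2sq R < k := fun z hz => by
    linarith [l2sq_real_smul_le hz.1 hz.2 P]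
  have := hasSum_of_hasDerivAt hd.nonneg (small_ratio hk h)
    (hd.norm_kerTrace_le (measurable_baseRight hk0 R))
    (L := fun z : ℝ => Complex.log (wronskian k (z • P) R))
    (D := fun z : ℝ => ∫ x, P x * diag21 k (z • P) R x) ?_ (fun z hz => ?_) fun z hz => ?_
  · simpa using this
  · have h0 : Small k 0 R := ⟨hk, by simpa using (hs 0 ⟨le_rfl, zero_le_one⟩).le⟩
    simp [wronskian_zero_left h0]
  · refine (smallCurve_of_lt (hasTimeDeriv_smul P z) (hasTimeDeriv_const R z) hk
      (hs z hz)).hasDerivAt_log_wronskian.congr_deriv ?_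
    simp
  · have hS : Small k (z • P) R := ⟨hk, (hs z hz).le⟩
    have := hasSum_kerTrace_baseKernel hk0 (by rw [abs_of_pos hk]; exact small_ratio hk h)
      (norm_real_le_one hz) (G := fun x y => greenPos k (z • P) R x y 1 0)
      (continuous_greenPos_offDiag hS (by decide)) hk (fun x y => norm_greenPos_le hS x y 1 0)
      (expResponse_pos hS)
    simpa only [greenPos_diag_one_zero] using this

theorem hasSum_log_wronskian_neg (hk : 0 < k) (h : l2sq P + l2sq R < k) :
    HasSum (fun n : ℕ => 1 / ((n : ℂ) + 1) * kerTrace (kerPow (baseKernel (-k) P R) n))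
      (-Complex.log (wronskian k R P)) := by
  have hk0 := neg_ne_zero.2 hk.ne'
  have hd := productDominated_baseKernel hk0 P R
  rw [abs_neg, abs_of_pos hk] at hd
  have hs : ∀ z ∈ Set.Icc (0 : ℝ) 1, l2sq R + l2sq (z • P) < k := fun z hz => by
    linarith [l2sq_real_smul_le hz.1 hz.2 P]
  have := hasSum_of_hasDerivAt hd.nonneg (small_ratio hk h)
    (hd.norm_kerTrace_le (measurable_baseRight hk0 R))
    (L := fun z : ℝ => Complex.log (wronskian k R (z • P)))
    (D := fun z : ℝ => ∫ x, P x * diag12 k R (z • P) x) ?_ (fun z hz => ?_) fun z hz => ?_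
  · simpa using this
  · have h0 : Small k R 0 := ⟨hk, by simpa using (hs 0 ⟨le_rfl, zero_le_one⟩).le⟩
    simp [wronskian_zero_right h0]
  · refine (smallCurve_of_lt (hasTimeDeriv_const R z) (hasTimeDeriv_smul P z) hk
      (hs z hz)).hasDerivAt_log_wronskian.congr_deriv ?_
    simp
  · have hS : Small k R (z • P) := ⟨hk, (hs z hz).le⟩
    have := hasSum_kerTrace_baseKernel hk0 (by rw [abs_neg, abs_of_pos hk]; exact small_ratio hk h)
      (norm_real_le_one hz) (G := fun x y => greenPos k R (z • P) x y 0 1)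
      (continuous_greenPos_offDiag hS (by decide)) hk (fun x y => norm_greenPos_le hS x y 0 1)
      (expResponse_neg hS)
    simpa only [greenPos_diag_zero_one] using this

end LogSeries

theorem cpow_neg_half_mul_self {w : ℂ} (hw : w ≠ 0) :
    w ^ (-(1 / 2) : ℂ) * w ^ (-(1 / 2) : ℂ) = w⁻¹ := by
  rw [← Complex.cpow_add _ _ hw, ← Complex.cpow_neg_one]
  norm_num

theorem kerComp_lambda_gamma {κ : ℂ} {k : ℝ} (hk : k ≠ 0) (hκ : Complex.I * κ ^ 2 = k)
    (q r : 𝓢(ℝ, ℂ)) (ξ η : ℝ) :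
    kerComp (kerLambda κ q) (kerGamma κ r) ξ η = ((Complex.I * ξ + k) ^ (-(1 / 2) : ℂ))⁻¹
      * baseKernel k (κ • q) (κ • r) ξ η * (Complex.I * η + k) ^ (-(1 / 2) : ℂ) := by
  have h0 := I_mul_add_ne_zero hk ξ
  have hc : (Complex.I * ξ + k) ^ (-(1 / 2) : ℂ) ≠ 0 := by
    rw [Complex.cpow_ne_zero_iff]
    exact Or.inl h0
  have hr : res k ξ = (Complex.I * ξ + k) ^ (-(1 / 2) : ℂ) * (Complex.I * ξ + k) ^ (-(1 / 2) : ℂ) :=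
    (cpow_neg_half_mul_self h0).symm
  rw [baseKernel, hr, mul_assoc ((Complex.I * ξ + k) ^ (-(1 / 2) : ℂ)) _ (∫ _, _),
    inv_mul_cancel_left₀ hc, ← integral_const_mul, ← integral_mul_const, kerComp]
  refine integral_congr_ae (Eventually.of_forall fun ζ => ?_)
  have hm : res (-k) ζ = (Complex.I * ζ - k) ^ (-(1 / 2) : ℂ)
      * (Complex.I * ζ - k) ^ (-(1 / 2) : ℂ) := by
    have := I_mul_add_ne_zero (neg_ne_zero.2 hk) ζ
    rw [Complex.ofReal_neg, ← sub_eq_add_neg] at this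
    rw [cpow_neg_half_mul_self this, res, Complex.ofReal_neg, ← sub_eq_add_neg]
  simp only [kerLambda, kerGamma, hκ, hm, symbol_smul, mul_assoc κ, inv_sqrt_mul_fourierHat]
  ring

theorem A_eq_of_hasSum {κ : ℂ} {k : ℝ} (hk : k ≠ 0) (hκ : Complex.I * κ ^ 2 = k)
    {q r : 𝓢(ℝ, ℂ)} {l : ℂ} (h : HasSum (fun n : ℕ => 1 / ((n : ℂ) + 1)
      * kerTrace (kerPow (baseKernel k (κ • q) (κ • r)) n)) l) : A κ q r = -sgn κ * l := by
  have hc : ∀ ξ : ℝ, (Complex.I * ξ + k) ^ (-(1 / 2) : ℂ) ≠ 0 := fun ξ => by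
    rw [Complex.cpow_ne_zero_iff]
    exact Or.inl (I_mul_add_ne_zero hk ξ)
  simp only [A, kerTrace_conj hc (kerComp_lambda_gamma hk hκ q r)]
  rw [h.tsum_eq]

/-! ### Both signs of the spectral parameter -/

/-- The spectral parameter `iκ^2` is real and nonzero, and the potentials are small. -/
structure SmallPotentials (κ : ℂ) (q r : 𝓢(ℝ, ℂ)) : Prop where
  im_eq : (Complex.I * κ ^ 2).im = 0
  lt : l2sq (κ • q) + l2sq (κ • r) < |(Complex.I * κ ^ 2).re|

theorem smallPotentials_of_ball {κ : ℂ} {s : ℝ} (hs0 : 0 < s) (hs1 : s < 1 / 2)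
    (hκ : Admissible κ) {q r : 𝓢(ℝ, ℂ)} (hq : q ∈ schwartzBall s (1 / 2))
    (hr : r ∈ schwartzBall s (1 / 2)) : SmallPotentials κ q r := by
  refine ⟨hκ.1, ?_⟩
  have hb : ∀ {p : 𝓢(ℝ, ℂ)}, p ∈ schwartzBall s (1 / 2) → l2sq p ≤ 1 / 4 := fun {p} hp => by
    have h1 := l2sq_le_sobolevNorm_sq hs0 (by linarith) p
    have h2 := pow_le_pow_left₀ (Real.sqrt_nonneg _) (show sobolevNorm s p ≤ 1 / 2 from hp) 2
    have h3 : sobolevNorm s p ^ 2 ≤ (1 / 2) ^ 2 := h2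
    linarith
  have hn : ‖κ‖ ^ 2 = |(Complex.I * κ ^ 2).re| := by
    have := congrArg norm (spectral_eq hκ.1)
    rw [norm_mul, Complex.norm_I, one_mul, norm_pow, Complex.norm_real] at this
    exact this
  have h1 := hκ.2
  rw [l2sq_smul, l2sq_smul, hn]
  nlinarith [hb hq, hb hr]

namespace SmallPotentials

variable {κ : ℂ} {q r : 𝓢(ℝ, ℂ)}

theorem re_ne_zero (h : SmallPotentials κ q r) : (Complex.I * κ ^ 2).re ≠ 0 := by
  intro h0
  have := h.lt
  rw [h0, abs_zero] at this
  linarith [l2sq_nonneg (κ • q), l2sq_nonneg (κ • r)]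

/-- Either `iκ^2` is positive, or the system with exchanged components has a positive parameter. -/
theorem cases (h : SmallPotentials κ q r) :
    (0 < (Complex.I * κ ^ 2).re ∧ l2sq (κ • q) + l2sq (κ • r) < (Complex.I * κ ^ 2).re) ∨
      (0 < -(Complex.I * κ ^ 2).re ∧ l2sq (κ • r) + l2sq (κ • q) < -(Complex.I * κ ^ 2).re) := by
  rcases lt_or_gt_of_ne h.re_ne_zero with h0 | h0
  · refine Or.inr ⟨neg_pos.2 h0, ?_⟩
    rw [← abs_of_neg h0, add_comm]
    exact h.lt
  · refine Or.inl ⟨h0, ?_⟩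
    rw [← abs_of_pos h0]
    exact h.lt

theorem existsUnique_green (h : SmallPotentials κ q r) : ∃! G, IsGreenFunction κ q r G := by
  rcases h.cases with ⟨h0, h1⟩ | ⟨h0, h1⟩
  · exact ⟨_, isGreenFunction_pos h.im_eq ⟨h0, h1.le⟩, fun G hG =>
      hG.unique (isGreenFunction_pos h.im_eq ⟨h0, h1.le⟩)⟩
  · exact ⟨_, isGreenFunction_neg h.im_eq ⟨h0, h1.le⟩, fun G hG =>
      hG.unique (isGreenFunction_neg h.im_eq ⟨h0, h1.le⟩)⟩

theorem two_add_gam_ne_zero (h : SmallPotentials κ q r) (x : ℝ) : 2 + gam κ q r x ≠ 0 := by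
  rw [show 2 + gam κ q r x = 1 + (gam κ q r x + 1) by ring]
  rcases h.cases with ⟨h0, h1⟩ | ⟨h0, h1⟩
  · rw [(diag_of_pos h.im_eq ⟨h0, h1.le⟩ x).2.2]
    exact one_add_diagDiff_ne_zero ⟨h0, h1.le⟩ x
  · rw [(diag_of_neg h.im_eq ⟨h0, h1.le⟩ x).2.2]
    exact one_add_diagDiff_ne_zero ⟨h0, h1.le⟩ x

theorem gam_sq (h : SmallPotentials κ q r) (x : ℝ) :
    (gam κ q r x + 1) ^ 2 + 4 * (g12 κ q r x * g21 κ q r x) = 1 := by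
  rcases h.cases with ⟨h0, h1⟩ | ⟨h0, h1⟩
  · obtain ⟨e1, e2, e3⟩ := diag_of_pos h.im_eq ⟨h0, h1.le⟩ x
    rw [e1, e2, e3]
    exact diagDiff_sq ⟨h0, h1.le⟩ x
  · obtain ⟨e1, e2, e3⟩ := diag_of_neg h.im_eq ⟨h0, h1.le⟩ x
    rw [e1, e2, e3, ← diagDiff_sq ⟨h0, h1.le⟩ x]
    ring

theorem exists_norm_le (h : SmallPotentials κ q r) :
    ∃ C, ∀ x, ‖g12 κ q r x‖ ≤ C ∧ ‖g21 κ q r x‖ ≤ C ∧ ‖gam κ q r x + 1‖ ≤ C := by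
  rcases h.cases with ⟨h0, h1⟩ | ⟨h0, h1⟩
  · obtain ⟨C, hC⟩ := exists_norm_diag_le ⟨h0, h1.le⟩
    refine ⟨C, fun x => ?_⟩
    obtain ⟨e1, e2, e3⟩ := diag_of_pos h.im_eq ⟨h0, h1.le⟩ x
    rw [e1, e2, e3]
    exact hC x
  · obtain ⟨C, hC⟩ := exists_norm_diag_le ⟨h0, h1.le⟩
    refine ⟨C, fun x => ?_⟩
    obtain ⟨e1, e2, e3⟩ := diag_of_neg h.im_eq ⟨h0, h1.le⟩ x
    rw [e1, e2, e3, norm_neg, norm_neg]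
    exact ⟨(hC x).2.1, (hC x).1, (hC x).2.2⟩

theorem hasDerivAt_g12 (h : SmallPotentials κ q r) (x : ℝ) :
    HasDerivAt (g12 κ q r)
      (-(2 * (Complex.I * κ ^ 2)) * g12 κ q r x - κ * q x * (gam κ q r x + 1)) x := by
  rw [spectral_eq h.im_eq]
  rcases h.cases with ⟨h0, h1⟩ | ⟨h0, h1⟩
  · have hd := diag_of_pos h.im_eq ⟨h0, h1.le⟩
    rw [(hd x).2.2, funext fun x => (hd x).1]
    exact hasDerivAt_diag12 ⟨h0, h1.le⟩ x
  · have hd := diag_of_neg h.im_eq ⟨h0, h1.le⟩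
    rw [(hd x).2.2, funext fun x => (hd x).1]
    refine (hasDerivAt_diag21 ⟨h0, h1.le⟩ x).neg.congr_deriv ?_
    simp only [smul_apply, smul_eq_mul, Complex.ofReal_neg]
    ring

theorem hasDerivAt_g21 (h : SmallPotentials κ q r) (x : ℝ) :
    HasDerivAt (g21 κ q r)
      (2 * (Complex.I * κ ^ 2) * g21 κ q r x + κ * r x * (gam κ q r x + 1)) x := by
  rw [spectral_eq h.im_eq]
  rcases h.cases with ⟨h0, h1⟩ | ⟨h0, h1⟩
  · have hd := diag_of_pos h.im_eq ⟨h0, h1.le⟩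
    rw [(hd x).2.2, funext fun x => (hd x).2.1]
    exact hasDerivAt_diag21 ⟨h0, h1.le⟩ x
  · have hd := diag_of_neg h.im_eq ⟨h0, h1.le⟩
    rw [(hd x).2.2, funext fun x => (hd x).2.1]
    refine (hasDerivAt_diag12 ⟨h0, h1.le⟩ x).neg.congr_deriv ?_
    simp only [smul_apply, smul_eq_mul, Complex.ofReal_neg]
    ring

theorem hasDerivAt_gam (h : SmallPotentials κ q r) (x : ℝ) :
    HasDerivAt (gam κ q r) (2 * κ * (q x * g21 κ q r x - r x * g12 κ q r x)) x := by
  rcases h.cases with ⟨h0, h1⟩ | ⟨h0, h1⟩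
  · have hd := diag_of_pos h.im_eq ⟨h0, h1.le⟩
    rw [(hd x).1, (hd x).2.1, funext fun x => eq_sub_of_add_eq (hd x).2.2]
    refine ((hasDerivAt_diagDiff ⟨h0, h1.le⟩ x).sub_const 1).congr_deriv ?_
    simp only [smul_apply, smul_eq_mul]
    ring
  · have hd := diag_of_neg h.im_eq ⟨h0, h1.le⟩
    rw [(hd x).1, (hd x).2.1, funext fun x => eq_sub_of_add_eq (hd x).2.2]
    refine ((hasDerivAt_diagDiff ⟨h0, h1.le⟩ x).sub_const 1).congr_deriv ?_
    simp only [smul_apply, smul_eq_mul]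
    ring

theorem continuous_g12 (h : SmallPotentials κ q r) : Continuous (g12 κ q r) :=
  continuous_iff_continuousAt.2 fun x => (h.hasDerivAt_g12 x).continuousAt

theorem continuous_g21 (h : SmallPotentials κ q r) : Continuous (g21 κ q r) :=
  continuous_iff_continuousAt.2 fun x => (h.hasDerivAt_g21 x).continuousAt

theorem A_eq_pos (h : SmallPotentials κ q r) (h0 : 0 < (Complex.I * κ ^ 2).re) :
    A κ q r = Complex.log (wronskian (Complex.I * κ ^ 2).re (κ • q) (κ • r)) := by
  have hlt := h.lt
  rw [abs_of_pos h0] at hlt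
  rw [A_eq_of_hasSum h0.ne' (spectral_eq h.im_eq) (hasSum_log_wronskian_pos h0 hlt), sgn_of_pos h0]
  ring

theorem A_eq_neg (h : SmallPotentials κ q r) (h0 : 0 < -(Complex.I * κ ^ 2).re) :
    A κ q r = -Complex.log (wronskian (-(Complex.I * κ ^ 2).re) (κ • r) (κ • q)) := by
  have hlt := h.lt
  have h1 := neg_pos.1 h0
  rw [abs_of_neg h1] at hlt
  have := hasSum_log_wronskian_neg h0 hlt
  rw [neg_neg] at this
  rw [A_eq_of_hasSum h1.ne (spectral_eq h.im_eq) this, sgn_of_neg h1]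
  ring

end SmallPotentials

theorem HasTimeDeriv.smul {f : ℝ → 𝓢(ℝ, ℂ)} {w : 𝓢(ℝ, ℂ)} {t : ℝ} (h : HasTimeDeriv f w t)
    (c : ℂ) : HasTimeDeriv (fun τ => c • f τ) (c • w) t :=
  h.map (c • ContinuousLinearMap.id ℂ 𝓢(ℝ, ℂ))

section Curve

variable {κ : ℂ} {t : ℝ} {q r : ℝ → 𝓢(ℝ, ℂ)} {qd rd : 𝓢(ℝ, ℂ)}

theorem SmallPotentials.eventually (h : SmallPotentials κ (q t) (r t)) (hq : HasTimeDeriv q qd t)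
    (hr : HasTimeDeriv r rd t) : ∀ᶠ τ in 𝓝 t, SmallPotentials κ (q τ) (r τ) :=
  (eventually_l2sq_lt (hq.smul κ) (hr.smul κ) h.lt).mono fun _ hτ => ⟨h.im_eq, hτ⟩

/-- The derivative of `A(κ)` along a curve. -/
theorem SmallPotentials.hasDerivAt_A (h : SmallPotentials κ (q t) (r t))
    (hq : HasTimeDeriv q qd t) (hr : HasTimeDeriv r rd t) :
    HasDerivAt (fun τ => A κ (q τ) (r τ))
      (∫ x, (qd x * (-κ * g21 κ (q t) (r t) x) + rd x * (-κ * g12 κ (q t) (r t) x))) t := by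
  have hev := h.eventually hq hr
  rcases h.cases with ⟨h0, h1⟩ | ⟨h0, h1⟩
  · have hd := diag_of_pos h.im_eq ⟨h0, h1.le⟩
    refine ((smallCurve_of_lt (hq.smul κ) (hr.smul κ) h0 h1).hasDerivAt_log_wronskian.congr_deriv
      ?_).congr_of_eventuallyEq (hev.mono fun τ hτ => hτ.A_eq_pos h0)
    rw [← integral_neg]
    refine integral_congr_ae (Eventually.of_forall fun x => ?_)
    simp only [(hd x).1, (hd x).2.1, smul_apply, smul_eq_mul]
    ring
  · have hd := diag_of_neg h.im_eq ⟨h0, h1.le⟩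
    refine ((smallCurve_of_lt (hr.smul κ) (hq.smul κ) h0
      h1).hasDerivAt_log_wronskian.neg.congr_deriv
      ?_).congr_of_eventuallyEq (hev.mono fun τ hτ => hτ.A_eq_neg h0)
    rw [neg_neg]
    refine integral_congr_ae (Eventually.of_forall fun x => ?_)
    simp only [(hd x).1, (hd x).2.1, smul_apply, smul_eq_mul]
    ring

theorem ZeroCurvature.swap {k : ℝ} {P R Pd Rd : 𝓢(ℝ, ℂ)} {β₀ β₁ β₂ : ℝ → ℂ}
    (h : ZeroCurvature k P R Pd Rd β₀ β₁ β₂) :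
    ZeroCurvature (-k) R P Rd Pd (fun x => -β₀ x) β₂ β₁ where
  hasDerivAt_zero x := (h.hasDerivAt_zero x).neg.congr_deriv (by ring)
  hasDerivAt_one x := (h.hasDerivAt_two x).congr_deriv (by push_cast; ring)
  hasDerivAt_two x := (h.hasDerivAt_one x).congr_deriv (by push_cast; ring)
  bounded := by
    obtain ⟨C, hC⟩ := h.bounded
    exact ⟨C, fun x => ⟨by rw [norm_neg]; exact (hC x).1, (hC x).2.2, (hC x).2.1⟩⟩

/-- The evolution of the diagonal Green's function under a zero-curvature flow. -/
theorem SmallPotentials.hasDerivAt_time (h : SmallPotentials κ (q t) (r t))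
    (hq : HasTimeDeriv q qd t) (hr : HasTimeDeriv r rd t) {β₀ β₁ β₂ : ℝ → ℂ}
    (hz : ZeroCurvature (Complex.I * κ ^ 2).re (κ • q t) (κ • r t) (κ • qd) (κ • rd) β₀ β₁ β₂)
    (x : ℝ) :
    HasDerivAt (fun τ => g12 κ (q τ) (r τ) x)
      (2 * β₀ x * g12 κ (q t) (r t) x - β₁ x * (gam κ (q t) (r t) x + 1)) t ∧
    HasDerivAt (fun τ => g21 κ (q τ) (r τ) x)
      (β₂ x * (gam κ (q t) (r t) x + 1) - 2 * β₀ x * g21 κ (q t) (r t) x) t ∧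
    HasDerivAt (fun τ => gam κ (q τ) (r τ) x)
      (2 * (β₁ x * g21 κ (q t) (r t) x - β₂ x * g12 κ (q t) (r t) x)) t := by
  have hev := h.eventually hq hr
  rcases h.cases with ⟨h0, h1⟩ | ⟨h0, h1⟩
  · obtain ⟨e1, e2, e3⟩ := diag_of_pos h.im_eq ⟨h0, h1.le⟩ x
    have hc := smallCurve_of_lt (hq.smul κ) (hr.smul κ) h0 h1
    have hd : ∀ᶠ τ in 𝓝 t, Small (Complex.I * κ ^ 2).re (κ • q τ) (κ • r τ) := hc.small
    rw [e1, e2, e3]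
    refine ⟨(hc.hasDerivAt_diag12 hz x).congr_of_eventuallyEq
        (hd.mono fun τ hτ => (diag_of_pos h.im_eq hτ x).1),
      (hc.hasDerivAt_diag21 hz x).congr_of_eventuallyEq
        (hd.mono fun τ hτ => (diag_of_pos h.im_eq hτ x).2.1),
      ((hc.hasDerivAt_diagDiff hz x).sub_const 1).congr_of_eventuallyEq
        (hd.mono fun τ hτ => eq_sub_of_add_eq (diag_of_pos h.im_eq hτ x).2.2)⟩
  · obtain ⟨e1, e2, e3⟩ := diag_of_neg h.im_eq ⟨h0, h1.le⟩ x
    have hc := smallCurve_of_lt (hr.smul κ) (hq.smul κ) h0 h1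
    have hd : ∀ᶠ τ in 𝓝 t, Small (-(Complex.I * κ ^ 2).re) (κ • r τ) (κ • q τ) := hc.small
    rw [e1, e2, e3]
    refine ⟨((hc.hasDerivAt_diag21 hz.swap x).neg.congr_deriv ?_).congr_of_eventuallyEq
        (hd.mono fun τ hτ => (diag_of_neg h.im_eq hτ x).1),
      ((hc.hasDerivAt_diag12 hz.swap x).neg.congr_deriv ?_).congr_of_eventuallyEq
        (hd.mono fun τ hτ => (diag_of_neg h.im_eq hτ x).2.1),
      (((hc.hasDerivAt_diagDiff hz.swap x).sub_const 1).congr_deriv ?_).congr_of_eventuallyEq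
        (hd.mono fun τ hτ => eq_sub_of_add_eq (diag_of_neg h.im_eq hτ x).2.2)⟩ <;> ring

end Curve

/-! ### The flow of `A(κ)` -/

theorem eq_of_integral_schwartz_mul_eq {u v : ℝ → ℂ} (hu : Continuous u) (hv : Continuous v)
    (h : ∀ f : 𝓢(ℝ, ℂ), ∫ x, f x * u x = ∫ x, f x * v x) : u = v := by
  have key := ae_eq_of_integral_contDiff_smul_eq (μ := volume) hu.locallyIntegrable
    hv.locallyIntegrable fun g hg hgs => ?_
  · exact (hu.ae_eq_iff_eq volume hv).1 key
  · have hg' : ContDiff ℝ (⊤ : ℕ∞) fun x => (g x : ℂ) := Complex.ofRealCLM.contDiff.comp hg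
    have hgs' : HasCompactSupport fun x => (g x : ℂ) :=
      hgs.comp_left (g := fun x : ℝ => (x : ℂ)) Complex.ofReal_zero
    simp only [Complex.real_smul]
    exact h (HasCompactSupport.toSchwartzMap hgs' hg')

theorem SmallPotentials.functionalDerivs_eq {κ : ℂ} {q r u v : 𝓢(ℝ, ℂ)}
    (h : SmallPotentials κ q r) (hF : HasFunctionalDerivs (A κ) q r u v) :
    (∀ x, u x = -κ * g21 κ q r x) ∧ ∀ x, v x = -κ * g12 κ q r x := by
  have e0 : q + (0 : ℝ) • (0 : 𝓢(ℝ, ℂ)) = q := by simp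
  have key : ∀ f g : 𝓢(ℝ, ℂ), (∫ x, f x * u x) + ∫ x, g x * v x
      = ∫ x, (f x * (-κ * g21 κ q r x) + g x * (-κ * g12 κ q r x)) := fun f g => by
    have h' : SmallPotentials κ (q + (0 : ℝ) • f) (r + (0 : ℝ) • g) := by simpa using h
    have := h'.hasDerivAt_A (q := fun θ => q + θ • f) (r := fun θ => r + θ • g)
      (hasTimeDeriv_affine q f 0) (hasTimeDeriv_affine r g 0)
    simp only [zero_smul, add_zero] at this
    exact (hF f g).unique this
  constructor
  · refine congrFun (eq_of_integral_schwartz_mul_eq u.continuous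
      (continuous_const.mul h.continuous_g21) fun f => ?_)
    simpa using key f 0
  · refine congrFun (eq_of_integral_schwartz_mul_eq v.continuous
      (continuous_const.mul h.continuous_g12) fun f => ?_)
    simpa using key 0 f

section Flow

variable {κ ϰ : ℂ} {t : ℝ} {q r : ℝ → 𝓢(ℝ, ℂ)} {qd rd : 𝓢(ℝ, ℂ)}

/-- The time derivatives of the potentials under the flow of `A(κ)`. -/
structure FlowAt (κ : ℂ) (q r : ℝ → 𝓢(ℝ, ℂ)) (t : ℝ) (qd rd : 𝓢(ℝ, ℂ)) : Prop where
  left : HasTimeDeriv q qd t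
  right : HasTimeDeriv r rd t
  left_eq : ∀ x, qd x = 2 * Complex.I * κ ^ 3 * g12 κ (q t) (r t) x
    + κ ^ 2 * q t x * (gam κ (q t) (r t) x + 1)
  right_eq : ∀ x, rd x = -(2 * Complex.I * κ ^ 3 * g21 κ (q t) (r t) x)
    - κ ^ 2 * r t x * (gam κ (q t) (r t) x + 1)

theorem exists_flowAt {I : Set ℝ} (h : SmallPotentials κ (q t) (r t))
    (hf : IsHamiltonianFlow (A κ) I q r) (ht : t ∈ I) : ∃ qd rd, FlowAt κ q r t qd rd := by
  obtain ⟨u, v, hF, hq, hr⟩ := hf t ht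
  obtain ⟨hu, hv⟩ := h.functionalDerivs_eq hF
  refine ⟨_, _, hq, hr, fun x => ?_, fun x => ?_⟩
  · rw [SchwartzMap.derivCLM_apply, show ⇑v = fun x => -κ * g12 κ (q t) (r t) x from funext hv,
      ((h.hasDerivAt_g12 x).const_mul (-κ)).deriv]
    ring
  · rw [SchwartzMap.derivCLM_apply, show ⇑u = fun x => -κ * g21 κ (q t) (r t) x from funext hu,
      ((h.hasDerivAt_g21 x).const_mul (-κ)).deriv]
    ring

theorem FlowAt.zeroCurvature (hf : FlowAt κ q r t qd rd) (h : SmallPotentials κ (q t) (r t))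
    (h' : SmallPotentials ϰ (q t) (r t)) (hne : κ ^ 2 - ϰ ^ 2 ≠ 0) :
    ZeroCurvature (Complex.I * ϰ ^ 2).re (ϰ • q t) (ϰ • r t) (ϰ • qd) (ϰ • rd)
      (fun x => -(Xi κ ϰ / 2) * (gam κ (q t) (r t) x + 1))
      (fun x => -Theta κ ϰ * g12 κ (q t) (r t) x)
      (fun x => -Theta κ ϰ * g21 κ (q t) (r t) x) where
  hasDerivAt_zero x := by
    refine (((h.hasDerivAt_gam x).add_const 1).const_mul (-(Xi κ ϰ / 2))).congr_deriv ?_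
    simp only [smul_apply, smul_eq_mul, Xi, Theta]
    field_simp
    ring
  hasDerivAt_one x := by
    refine ((h.hasDerivAt_g12 x).const_mul (-Theta κ ϰ)).congr_deriv ?_
    rw [← spectral_eq h'.im_eq]
    simp only [smul_apply, smul_eq_mul, Xi, Theta, hf.left_eq]
    field_simp
    ring
  hasDerivAt_two x := by
    refine ((h.hasDerivAt_g21 x).const_mul (-Theta κ ϰ)).congr_deriv ?_
    rw [← spectral_eq h'.im_eq]
    simp only [smul_apply, smul_eq_mul, Xi, Theta, hf.right_eq]
    field_simp
    ring
  bounded := by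
    obtain ⟨C, hC⟩ := h.exists_norm_le
    refine ⟨max (‖-(Xi κ ϰ / 2)‖ * C) (‖-Theta κ ϰ‖ * C), fun x => ⟨?_, ?_, ?_⟩⟩ <;> rw [norm_mul]
    · exact (mul_le_mul_of_nonneg_left (hC x).2.2 (norm_nonneg _)).trans (le_max_left _ _)
    · exact (mul_le_mul_of_nonneg_left (hC x).1 (norm_nonneg _)).trans (le_max_right _ _)
    · exact (mul_le_mul_of_nonneg_left (hC x).2.1 (norm_nonneg _)).trans (le_max_right _ _)

/-- The evolution of the diagonal Green's function at `ϰ` under the flow of `A(κ)`. -/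
theorem FlowAt.hasDerivAt_green (hf : FlowAt κ q r t qd rd) (h : SmallPotentials κ (q t) (r t))
    (h' : SmallPotentials ϰ (q t) (r t)) (hne : κ ^ 2 - ϰ ^ 2 ≠ 0) (x : ℝ) :
    HasDerivAt (fun τ => g12 ϰ (q τ) (r τ) x)
      (-Xi κ ϰ * g12 ϰ (q t) (r t) x * (gam κ (q t) (r t) x + 1)
        + Theta κ ϰ * g12 κ (q t) (r t) x * (gam ϰ (q t) (r t) x + 1)) t ∧
    HasDerivAt (fun τ => g21 ϰ (q τ) (r τ) x)
      (Xi κ ϰ * g21 ϰ (q t) (r t) x * (gam κ (q t) (r t) x + 1)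
        - Theta κ ϰ * g21 κ (q t) (r t) x * (gam ϰ (q t) (r t) x + 1)) t ∧
    HasDerivAt (fun τ => gam ϰ (q τ) (r τ) x)
      (-2 * Theta κ ϰ * (g12 κ (q t) (r t) x * g21 ϰ (q t) (r t) x
        - g21 κ (q t) (r t) x * g12 ϰ (q t) (r t) x)) t := by
  obtain ⟨h1, h2, h3⟩ := h'.hasDerivAt_time hf.left hf.right (hf.zeroCurvature h h' hne) x
  exact ⟨h1.congr_deriv (by ring), h2.congr_deriv (by ring), h3.congr_deriv (by ring)⟩

/-- The conservation law of the density `2iϰγ - (q g_21 + r g_12)`. -/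
theorem FlowAt.gammaDensity_law (hf : FlowAt κ q r t qd rd) (h : SmallPotentials κ (q t) (r t))
    (h' : SmallPotentials ϰ (q t) (r t)) (hne : κ ^ 2 - ϰ ^ 2 ≠ 0) (x : ℝ) :
    ∃ a b, HasDerivAt (fun τ => gammaDensity ϰ (q τ) (r τ) x) a t ∧
      HasDerivAt (jGamma ϰ κ (q t) (r t)) b x ∧ a + b = 0 := by
  obtain ⟨t1, t2, t3⟩ := hf.hasDerivAt_green h h' hne x
  refine ⟨_, _, (t3.const_mul (2 * Complex.I * ϰ)).sub
    (((hf.left.hasDerivAt_eval x).mul t2).add ((hf.right.hasDerivAt_eval x).mul t1)),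
    ((((h.hasDerivAt_g12 x).mul (h'.hasDerivAt_g21 x)).add
      ((h.hasDerivAt_g21 x).mul (h'.hasDerivAt_g12 x))).const_mul _).sub
    ((((h.hasDerivAt_gam x).add_const 1).mul ((h'.hasDerivAt_gam x).add_const 1)).const_mul _), ?_⟩
  simp only [hf.left_eq, hf.right_eq, Xi, Theta]
  field_simp
  ring

/-- The conservation law of the density `ρ`. -/
theorem FlowAt.rho_law (hf : FlowAt κ q r t qd rd) (h : SmallPotentials κ (q t) (r t))
    (h' : SmallPotentials ϰ (q t) (r t)) (hne : κ ^ 2 - ϰ ^ 2 ≠ 0) (x : ℝ) :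
    ∃ a b, HasDerivAt (fun τ => rho ϰ (q τ) (r τ) x) a t ∧
      HasDerivAt (jA ϰ κ (q t) (r t)) b x ∧ a + b = 0 := by
  obtain ⟨t1, t2, t3⟩ := hf.hasDerivAt_green h h' hne x
  have hm := h'.two_add_gam_ne_zero x
  refine ⟨_, _, ((((hf.left.hasDerivAt_eval x).mul t2).add
    ((hf.right.hasDerivAt_eval x).mul t1)).div (t3.const_add 2) hm).const_mul (-ϰ),
    (((((h.hasDerivAt_g12 x).mul (h'.hasDerivAt_g21 x)).add
      ((h'.hasDerivAt_g12 x).mul (h.hasDerivAt_g21 x))).div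
      ((h'.hasDerivAt_gam x).const_add 2) hm).const_mul _).sub
    ((h.hasDerivAt_gam x).const_mul _), ?_⟩
  have hκ : κ ≠ 0 := by
    rintro rfl
    exact h.re_ne_zero (by simp)
  have rel := h'.gam_sq x
  clear t1 t2 t3
  simp only [hf.left_eq, hf.right_eq, Pi.add_apply, Pi.mul_apply]
  generalize g12 κ (q t) (r t) x = A₁
  generalize g21 κ (q t) (r t) x = A₂
  generalize gam κ (q t) (r t) x = A₀
  generalize g12 ϰ (q t) (r t) x = a₁ at *
  generalize g21 ϰ (q t) (r t) x = a₂ at *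
  generalize gam ϰ (q t) (r t) x = a₀ at *
  generalize q t x = Q
  generalize r t x = R
  have hΘ : Theta κ ϰ * (κ ^ 2 - ϰ ^ 2) = ϰ * κ ^ 3 := div_mul_cancel₀ _ hne
  have hΞ : ϰ * (κ ^ 2 + Xi κ ϰ) = Theta κ ϰ * κ := by
    rw [Xi, Theta]
    field_simp
    ring
  have hd : (2 + a₀)⁻¹ * (2 + a₀) = 1 := inv_mul_cancel₀ hm
  have e1 : Theta κ ϰ * (ϰ / (2 * κ)) * (2 * κ * (Q * A₂ - R * A₁))
      = Theta κ ϰ * ϰ * (Q * A₂ - R * A₁) := by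
    field_simp
  rw [e1]
  simp only [div_eq_mul_inv, ← inv_pow]
  generalize (2 + a₀)⁻¹ = d at hd ⊢
  linear_combination (2 + a₀) * d ^ 2 * (2 * Complex.I * (A₁ * a₂ - A₂ * a₁)) * hΘ
    - (2 + a₀) * d ^ 2 * (A₀ + 1) * (Q * a₂ - R * a₁) * hΞ
    + ϰ * Theta κ ϰ * (Q * A₂ - R * A₁) * d ^ 2 * rel
    + ϰ * Theta κ ϰ * (Q * A₂ - R * A₁) * (d * (2 + a₀) + 1) * hd

end Flow

end DNLS

end

theorem mainTheorem2 (s : ℝ) (hs0 : 0 < s) (hs1 : s < 1 / 2) :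
    ∃ δ : ℝ, 0 < δ ∧
      -- well-posedness of the Green's function, and non-vanishing of the denominator in `ρ`
      (∀ κ : ℂ, DNLS.Admissible κ →
        ∀ q ∈ DNLS.schwartzBall s δ, ∀ r ∈ DNLS.schwartzBall s δ,
          (∃! G, DNLS.IsGreenFunction κ q r G) ∧ ∀ x : ℝ, 2 + DNLS.gam κ q r x ≠ 0) ∧
      -- the dynamics along the flow of `A(κ)`
      (∀ κ ϰ : ℂ, DNLS.Admissible κ → DNLS.Admissible ϰ → κ ^ 2 ≠ ϰ ^ 2 →
        ∀ (I : Set ℝ) (q r : ℝ → 𝓢(ℝ, ℂ)), IsOpen I →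
          (∀ t ∈ I, q t ∈ DNLS.schwartzBall s δ ∧ r t ∈ DNLS.schwartzBall s δ) →
          DNLS.IsHamiltonianFlow (DNLS.A κ) I q r →
          (∀ t ∈ I, ∀ x : ℝ,
            HasDerivAt (fun τ => DNLS.g12 ϰ (q τ) (r τ) x)
              (-DNLS.Xi κ ϰ * DNLS.g12 ϰ (q t) (r t) x * (DNLS.gam κ (q t) (r t) x + 1)
                + DNLS.Theta κ ϰ * DNLS.g12 κ (q t) (r t) x
                  * (DNLS.gam ϰ (q t) (r t) x + 1)) t ∧
            HasDerivAt (fun τ => DNLS.g21 ϰ (q τ) (r τ) x)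
              (DNLS.Xi κ ϰ * DNLS.g21 ϰ (q t) (r t) x * (DNLS.gam κ (q t) (r t) x + 1)
                - DNLS.Theta κ ϰ * DNLS.g21 κ (q t) (r t) x
                  * (DNLS.gam ϰ (q t) (r t) x + 1)) t ∧
            HasDerivAt (fun τ => DNLS.gam ϰ (q τ) (r τ) x)
              (-2 * DNLS.Theta κ ϰ
                * (DNLS.g12 κ (q t) (r t) x * DNLS.g21 ϰ (q t) (r t) x
                  - DNLS.g21 κ (q t) (r t) x * DNLS.g12 ϰ (q t) (r t) x)) t) ∧
          DNLS.MicroscopicLaw I (fun t x => DNLS.gammaDensity ϰ (q t) (r t) x)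
            (fun t x => DNLS.jGamma ϰ κ (q t) (r t) x) ∧
          DNLS.MicroscopicLaw I (fun t x => DNLS.rho ϰ (q t) (r t) x)
            (fun t x => DNLS.jA ϰ κ (q t) (r t) x)) := by
  have hball : ∀ {κ : ℂ}, DNLS.Admissible κ → ∀ {q r : 𝓢(ℝ, ℂ)},
      q ∈ DNLS.schwartzBall s (1 / 2) → r ∈ DNLS.schwartzBall s (1 / 2) →
      DNLS.SmallPotentials κ q r := fun hκ _ _ hq hr =>
    DNLS.smallPotentials_of_ball hs0 hs1 hκ hq hr
  refine ⟨1 / 2, by norm_num, fun κ hκ q hq r hr => ?_, ?_⟩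
  · exact ⟨(hball hκ hq hr).existsUnique_green, (hball hκ hq hr).two_add_gam_ne_zero⟩
  · intro κ ϰ hκ hϰ hne I q r _ hB hF
    have hne' : κ ^ 2 - ϰ ^ 2 ≠ 0 := sub_ne_zero.2 hne
    have h : ∀ t ∈ I, DNLS.SmallPotentials κ (q t) (r t) := fun t ht =>
      hball hκ (hB t ht).1 (hB t ht).2
    have h' : ∀ t ∈ I, DNLS.SmallPotentials ϰ (q t) (r t) := fun t ht =>
      hball hϰ (hB t ht).1 (hB t ht).2
    refine ⟨fun t ht x => ?_, fun t ht x => ?_, fun t ht x => ?_⟩ <;>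
      obtain ⟨qd, rd, hf⟩ := DNLS.exists_flowAt (h t ht) hF ht
    · exact hf.hasDerivAt_green (h t ht) (h' t ht) hne' x
    · obtain ⟨a, b, ha, hb, hab⟩ := hf.gammaDensity_law (h t ht) (h' t ht) hne' x
      exact ⟨ha.differentiableAt, hb.differentiableAt, by rw [ha.deriv, hb.deriv, hab]⟩
    · obtain ⟨a, b, ha, hb, hab⟩ := hf.rho_law (h t ht) (h' t ht) hne' x
      exact ⟨ha.differentiableAt, hb.differentiableAt, by rw [ha.deriv, hb.deriv, hab]⟩
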